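/- **Setting.** Let $F$ consist of a finite set $C$ of constants, a set $F_U$ of uninterpreted function symbols with fixed arities and a finite set $F_{AC}$ of binary associative-commutative (AC) symbols. For a set $S$ of equations between ground terms, $ACCC(S)$ is the least relation on ground terms that contains $S$ and all instances of the AC axioms of the symbols in $F_{AC}$, and is reflexive, symmetric, transitive and closed under application of function symbols. For $f\in F_{AC}$ an $f$-monomial $f(M)$ is given by a nonempty finite multiset $M$ of constants, and $f(\{c\})$ is $c$. A pure equation (or rule) is one of $c=d$, $h(c_1,\dots,c_k)=d$ with $h\in F_U$, or $f(M)=f(M')$ with $f\in F_{AC}$, with constants as arguments. *Purification.* Let $N$ be a finite set of new constants and let every $u\in N$ stand for a nonconstant ground term $\delta(u)$ over $F$, different constants for terms that differ modulo AC. A finite set $P$ of pure equations over $C\cup N$ is a purification of $S$ if (i) for each $u$ there is an equation $t=u$ in $P$ with $t$ nonconstant whose left side becomes $\delta(u)$ modulo AC when every new constant is replaced by the term it stands for; (ii) after this replacement every equation of $P$ is, modulo AC, trivial or an equation of $S$ (up to symmetry); (iii) every equation of $S$ that is not trivial modulo AC arises in this way from one of $P$. Write $P=S_C\cup S_U\cup\bigcup_f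 S_f$ for its constant equations, its flat uninterpreted equations and its equations on $f$-monomials. *Orderings.* $\gg_C$ is a total (strict) ordering on the constants $C\cup N$. For each $f\in F_{AC}$, $\gg_f$ is a total (strict) ordering on $f$-monomials that extends $\gg_C$, is admissible ($f(A)\gg_f f(B)$ if $B\subsetneq A$; $f(A_1)\gg_f f(A_2)$ implies $f(A_1\cup B)\gg_f f(A_2\cup B)$), and makes nonconstant monomials bigger than constants. Flat terms $h(c_1,\dots,c_k)$ are bigger than constants ($\gg_U$). *Rewriting.* A rule $f(A_1)\to f(A_2)$ rewrites $f(M)$ with $A_1\subseteq M$ to $f((M-A_1)\cup A_2)$ ($\cup$ is multiset sum). A set of pure rules rewrites ground terms modulo AC by replacing a subterm (of some AC-equal term) that is a left side by the right side. A rewrite relation is canonical if it is terminating and locally confluent. A set of rules is reduced if neither side of a rule can be rewritten by another of its rules. The critical pair of $f(A_1)\to f(A_2)$ and $f(B_1)\to f(B_2)$ is $(f((L-A_1)\cup A_2),\,f((L-B_1)\cup B_2))$ with $L=(A_1\cup B_1)-(A_1\cap B_1)$. **Algorithm** (input $P$, $\gg_C$, $\gg_f$; all choices of equations, symbols and normal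 forms are arbitrary). The canonical system of a set of constant equations consists of the rules $c\to\hat c$, where $\hat c\ne c$ is the $\gg_C$-least constant of the class of $c$. * *Uninterpreted part.* Given constant rules $R_C$ and flat rules: replace all constants in the flat rules by their canonical forms; among flat rules with the same left side keep the one with the least right side $d$ and add $d'\to d$ for the other right sides $d'$. If such new constant rules arise, replace $R_C$ by the canonical system of $R_C$ together with them, and repeat. This is first run on the canonical system of $S_C$ and the rules $h(c_1,\dots,c_k)\to d$ from $S_U$. * *Completion*, for each $f\in F_{AC}$. Replace the constants in $S_f$ by their canonical forms; let $T$ be the resulting set of equations and $R_f=\emptyset$. While $T\ne\emptyset$: remove an equation from $T$ and compute normal forms of its sides with $R_f$; if they are equal, discard it; otherwise orient them with $\gg_f$ into a rule $l\to r$, add to $T$ the critical pairs of $l\to r$ with all rules of $R_f$, move the rules of $R_f$ whose left side is reducible by $l\to r$ to $T$, add $l\to r$ to $R_f$, and replace every right side reducible by $l\to r$ by a normal form. * *Propagation.* Add the constant rules of all $R_f$ to $R_C$ and form the canonical system. If it equals $R_C$, stop. Otherwise let it be the new $R_C$, run the uninterpreted part, and update, for the resulting $R_C$, every $R_f$ that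 has a rule with a constant not in canonical form; collect the new constant rules found by the updates. If there are any, replace $R_C$ by the canonical system of $R_C$ together with them, and repeat from the uninterpreted part; otherwise stop. * *Update* of $R_f$ by $R_C$. Rules of $R_f$ whose left side is not in normal form for $R_C$ become equations in a set $E$; the other rules are kept, their right sides are put in normal form for the kept rules and $R_C$, and $R_C$ is added to them. Let $T=\emptyset$. Process the equations of $E$ as in completion, except that critical pairs are replaced by normal forms of their components and dropped if these are equal, and that new equations (including removed rules) are collected in $T$; when $E$ is empty, set $E:=T$, $T:=\emptyset$, until both are empty. Constant rules generated here are the new constant rules. * *Output.* $R_S$ is the union of $R_C$, the flat rules and all $R_f$ (a rule between singleton monomials counts as a constant rule). **Theorem.** Every finite set $S$ of ground equations over $F$ has a purification. Let $P$ be any purification of $S$ and let $\gg_C$, $\gg_f$ $(f\in F_{AC})$ be orderings as above. Then the algorithm has no infinite run on $P$, every run ends by returning a result, and all runs return the same $R_S$. This $R_S$ is finite, and $R_S=R_C\cup R_U\cup\bigcup_{f\in F_{AC}}R_f$, where $R_C$ consists of the constant rules of $R_S$, $R_U$ of the flat rules for uninterpreted symbols, and $R_f$ of the rules on $f$-monomials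 with nonconstant left side. Each of $R_C$, $R_U$, $R_f$ and $R_S$ itself is reduced, canonical on the ground terms (modulo AC) of the extended signature, and oriented by the orderings; each $R_f$ is also canonical as a rewrite system on $f$-monomials. With rules viewed as equations, $ACCC(R_S)=ACCC(P)$ on the extended signature, and for ground terms $s,t$ over the original signature, $s=t\in ACCC(R_S)$ if and only if $s=t\in ACCC(S)$. Moreover, $R_S$ is the only set of pure rules that is oriented by these orderings (with constant rules written as $c\to d$), reduced and canonical and has the same congruence closure $ACCC(P)$ on the extended signature. -/

import Mathlib

universe u v w x

namespace ACC

open Relation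

/-! ### Ground terms, AC congruence closure -/

/-- Function symbols: uninterpreted symbols `U` with their arities, and (binary) AC symbols `A`.
The constants are a separate parameter of `Term`. -/
structure Sig where
  U : Type u
  ar : U → ℕ
  A : Type v

/-- Ground terms over the signature `F` and the constants `K`. -/
inductive Term (F : Sig.{u, v}) (K : Type w) : Type (max u v w)
  | con (c : K) : Term F K
  | app (h : F.U) (a : Fin (F.ar h) → Term F K) : Term F K
  | ac (f : F.A) (s t : Term F K) : Term F K

/-- Replace every constant `c` of a term by the term `g c`. -/
def Term.subst {F : Sig.{u, v}} {K : Type w} {L : Type x} (g : K → Term F L) :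
    Term F K → Term F L
  | .con c => g c
  | .app h a => .app h (fun i => (a i).subst g)
  | .ac f s t => .ac f (s.subst g) (t.subst g)

/-- The AC congruence closure of a set `S` of ground equations. -/
inductive Closure {F : Sig.{u, v}} {K : Type w} (S : Set (Term F K × Term F K)) :
    Term F K → Term F K → Prop
  | of {s t : Term F K} : (s, t) ∈ S → Closure S s t
  | refl (s : Term F K) : Closure S s s
  | symm {s t : Term F K} : Closure S s t → Closure S t s
  | trans {s t r : Term F K} : Closure S s t → Closure S t r → Closure S s r
  | app (h : F.U) {a b : Fin (F.ar h) → Term F K} :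
      (∀ i, Closure S (a i) (b i)) → Closure S (.app h a) (.app h b)
  | ac (f : F.A) {s s' t t' : Term F K} :
      Closure S s s' → Closure S t t' → Closure S (.ac f s t) (.ac f s' t')
  | comm (f : F.A) (s t : Term F K) : Closure S (.ac f s t) (.ac f t s)
  | assoc (f : F.A) (s t r : Term F K) :
      Closure S (.ac f s (.ac f t r)) (.ac f (.ac f s t) r)

/-- Equality modulo the AC axioms alone, i.e. equality of flattened terms. -/
def ACEq {F : Sig.{u, v}} {K : Type w} (s t : Term F K) : Prop := Closure ∅ s t

/-- Equality modulo AC as a setoid. -/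
def acSetoid (F : Sig.{u, v}) (K : Type w) : Setoid (Term F K) :=
  ⟨ACEq, fun s => .refl s, fun h => .symm h, fun h k => .trans h k⟩

/-- Ground terms modulo AC (flattened ground terms). -/
def ACTerm (F : Sig.{u, v}) (K : Type w) : Type (max u v w) := Quotient (acSetoid F K)

/-- The flattened term of a ground term. -/
def Term.cls {F : Sig.{u, v}} {K : Type w} (s : Term F K) : ACTerm F K :=
  Quotient.mk (acSetoid F K) s

/-! ### Pure equations and rules -/

/-- `IsMono f M s`: the term `s` is built with `f` alone from the multiset `M` of constants, so that
its flattened form is the `f`-monomial `f(M)`; the monomial of `{c}` is `c` itself. -/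
inductive IsMono {F : Sig.{u, v}} {K : Type w} (f : F.A) : Multiset K → Term F K → Prop
  | single (c : K) : IsMono f {c} (.con c)
  | add {M N : Multiset K} {s t : Term F K} :
      IsMono f M s → IsMono f N t → IsMono f (M + N) (.ac f s t)

/-- Pure flat equations (or, read from left to right, rules): `c = d`, `h(a₁,…,aₖ) = d`, and
`f(M) = f(N)` for an AC symbol `f`. -/
inductive PureEq (F : Sig.{u, v}) (K : Type w) : Type (max u v w)
  | con (c d : K) : PureEq F K
  | flat (h : F.U) (a : Fin (F.ar h) → K) (d : K) : PureEq F K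
  | ac (f : F.A) (M N : Multiset K) : PureEq F K

/-- The pairs of terms denoted by a pure equation (all ways to write the two sides as terms). -/
inductive PureEq.Denotes {F : Sig.{u, v}} {K : Type w} :
    PureEq F K → Term F K → Term F K → Prop
  | con (c d : K) : Denotes (.con c d) (.con c) (.con d)
  | flat (h : F.U) (a : Fin (F.ar h) → K) (d : K) :
      Denotes (.flat h a d) (.app h (fun i => .con (a i))) (.con d)
  | ac (f : F.A) {M N : Multiset K} {s t : Term F K} :
      IsMono f M s → IsMono f N t → Denotes (.ac f M N) s t

/-- A set of pure equations (or rules) viewed as a set of equations between terms. -/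
def termEqs {F : Sig.{u, v}} {K : Type w} (E : Set (PureEq F K)) : Set (Term F K × Term F K) :=
  {p | ∃ e ∈ E, e.Denotes p.1 p.2}

/-! ### Purification -/

/-- `P` is a purification of the ground equations `S` in the signature extended by the constants
`N`, where the new constant `u` stands for the nonconstant term `δ u`:
* there is one new constant for each abstracted term (modulo AC), and `P` contains an equation
  `t = u` with `t` nonconstant that defines `u`;
* if the new constants are read as the terms they stand for, every equation of `P` is trivial or an
  equation of `S`, and every nontrivial equation of `S` is obtained from one of `P`. -/
structure IsPurification {F : Sig.{u, v}} {C : Type w} {N : Type x}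
    (S : Set (Term F C × Term F C)) (δ : N → Term F C) (P : Set (PureEq F (C ⊕ N))) : Prop where
  finite : P.Finite
  nonempty : ∀ f M M', PureEq.ac f M M' ∈ P → M ≠ 0 ∧ M' ≠ 0
  nonconstant : ∀ u c, δ u ≠ .con c
  distinct : ∀ u u', ACEq (δ u) (δ u') → u = u'
  defined : ∀ u, ∃ s, (s, Term.con (Sum.inr u)) ∈ termEqs P ∧ (∀ c, s ≠ .con c) ∧
    ACEq (s.subst (Sum.elim .con δ)) (δ u)
  sound : ∀ s t, (s, t) ∈ termEqs P →
    ACEq (s.subst (Sum.elim .con δ)) (t.subst (Sum.elim .con δ)) ∨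
    ∃ q ∈ S,
      (ACEq (s.subst (Sum.elim .con δ)) q.1 ∧ ACEq (t.subst (Sum.elim .con δ)) q.2) ∨
      (ACEq (s.subst (Sum.elim .con δ)) q.2 ∧ ACEq (t.subst (Sum.elim .con δ)) q.1)
  complete : ∀ q ∈ S, ACEq q.1 q.2 ∨
    ∃ s t, (s, t) ∈ termEqs P ∧
      ((ACEq (s.subst (Sum.elim .con δ)) q.1 ∧ ACEq (t.subst (Sum.elim .con δ)) q.2) ∨
       (ACEq (s.subst (Sum.elim .con δ)) q.2 ∧ ACEq (t.subst (Sum.elim .con δ)) q.1))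

/-! ### Orderings -/

/-- A total ordering `gtC` on the constants and, for every AC symbol `f`, a total admissible
ordering `gt f` on `f`-monomials (nonempty multisets) which extends it and in which nonconstant
monomials are bigger than constants. In the ordering on flat uninterpreted terms every `h(a₁,…,aₖ)`
is bigger than every constant, so that it needs no data. -/
structure Orderings (F : Sig.{u, v}) (K : Type w) where
  gtC : K → K → Prop
  gt : F.A → Multiset K → Multiset K → Prop
  gtC_irrefl : ∀ a, ¬ gtC a a
  gtC_trans : ∀ a b c, gtC a b → gtC b c → gtC a c
  gtC_total : ∀ a b, a ≠ b → gtC a b ∨ gtC b a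
  gt_irrefl : ∀ f M, M ≠ 0 → ¬ gt f M M
  gt_trans : ∀ f M N L, M ≠ 0 → N ≠ 0 → L ≠ 0 → gt f M N → gt f N L → gt f M L
  gt_total : ∀ f M N, M ≠ 0 → N ≠ 0 → M ≠ N → gt f M N ∨ gt f N M
  gt_subterm : ∀ f M N, N ≠ 0 → N < M → gt f M N
  gt_compat : ∀ f M N B, M ≠ 0 → N ≠ 0 → gt f M N → gt f (M + B) (N + B)
  gt_extends : ∀ f a b, gt f {a} {b} ↔ gtC a b
  gt_nonconstant : ∀ f M c, 2 ≤ Multiset.card M → gt f M {c}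

/-! ### Rewriting -/

/-- A rewrite relation is canonical if it is terminating and locally confluent. -/
def Canonical {α : Type*} (r : α → α → Prop) : Prop :=
  (¬ ∃ t : ℕ → α, ∀ n, r (t n) (t (n + 1))) ∧
  ∀ t u₁ u₂, r t u₁ → r t u₂ → ∃ v, ReflTransGen r u₁ v ∧ ReflTransGen r u₂ v

/-- Replacement of one subterm by an instance of a pair in `E`. -/
inductive TermStep {F : Sig.{u, v}} {K : Type w} (E : Set (Term F K × Term F K)) :
    Term F K → Term F K → Prop
  | rule {l r : Term F K} : (l, r) ∈ E → TermStep E l r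
  | app (h : F.U) (a : Fin (F.ar h) → Term F K) (i : Fin (F.ar h)) {t : Term F K} :
      TermStep E (a i) t → TermStep E (.app h a) (.app h (Function.update a i t))
  | acL (f : F.A) {s s' : Term F K} (t : Term F K) :
      TermStep E s s' → TermStep E (.ac f s t) (.ac f s' t)
  | acR (f : F.A) (s : Term F K) {t t' : Term F K} :
      TermStep E t t' → TermStep E (.ac f s t) (.ac f s t')

/-- One rewriting step on flattened ground terms (ground terms modulo AC) with the pure rules `R`.
Since `f(M)` with `A ⊆ M` is equal modulo AC to a term that has `f(A)` as a subterm, a rule for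
an AC symbol applies to a part of the arguments of that symbol. -/
def ClassStep {F : Sig.{u, v}} {K : Type w} (R : Set (PureEq F K)) (x y : ACTerm F K) : Prop :=
  ∃ s t, s.cls = x ∧ t.cls = y ∧ TermStep (termEqs R) s t

/-- Neither side of a rule can be rewritten by another rule. -/
def Reduced {F : Sig.{u, v}} {K : Type w} (R : Set (PureEq F K)) : Prop :=
  ∀ e ∈ R, ∀ s t, e.Denotes s t → ∀ e' ∈ R, e' ≠ e →
    (¬ ∃ x, ClassStep {e'} s.cls x) ∧ ¬ ∃ x, ClassStep {e'} t.cls x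

/-- Every rule is oriented by the orderings. Rules between constants are listed as `con`, whence
the left side of an `ac` rule is not a constant. -/
def Oriented {F : Sig.{u, v}} {K : Type w} (O : Orderings F K) (R : Set (PureEq F K)) : Prop :=
  (∀ c d, PureEq.con c d ∈ R → O.gtC c d) ∧
  ∀ f M N, PureEq.ac f M N ∈ R → 2 ≤ Multiset.card M ∧ N ≠ 0 ∧ O.gt f M N

/-- `R` is a reduced canonical rewrite system for the orderings `O`. -/
def ReducedCanonical {F : Sig.{u, v}} {K : Type w} (O : Orderings F K)
    (R : Set (PureEq F K)) : Prop :=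
  Oriented O R ∧ Reduced R ∧ Canonical (ClassStep R)

/-- The constant rules of `R`. -/
def partC {F : Sig.{u, v}} {K : Type w} (R : Set (PureEq F K)) : Set (PureEq F K) :=
  {e ∈ R | ∃ c d, e = .con c d}

/-- The flat rules of `R` for uninterpreted symbols. -/
def partU {F : Sig.{u, v}} {K : Type w} (R : Set (PureEq F K)) : Set (PureEq F K) :=
  {e ∈ R | ∃ h a d, e = .flat h a d}

/-- The rules of `R` on `f`-monomials. -/
def partAC {F : Sig.{u, v}} {K : Type w} (R : Set (PureEq F K)) (f : F.A) : Set (PureEq F K) :=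
  {e ∈ R | ∃ M N, e = .ac f M N}

/-- An equation or rule between monomials of one AC symbol. -/
abbrev MRule (K : Type w) : Type w := Multiset K × Multiset K

/-- The equations or rules on `f`-monomials in a set of pure equations or rules. -/
def mrules {F : Sig.{u, v}} {K : Type w} (E : Set (PureEq F K)) (f : F.A) : Set (MRule K) :=
  {q | PureEq.ac f q.1 q.2 ∈ E}

/-- One rewriting step on monomials: `M` is rewritten by `A₁ → A₂` iff `A₁ ⊆ M`, to
`(M - A₁) ∪ A₂`. -/
def MStep {K : Type w} [DecidableEq K] (R : Set (MRule K)) (M M' : Multiset K) : Prop :=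
  ∃ q ∈ R, q.1 ≤ M ∧ M' = M - q.1 + q.2

/-- `N` is a normal form of `M`. -/
def IsNF {K : Type w} [DecidableEq K] (R : Set (MRule K)) (M N : Multiset K) : Prop :=
  ReflTransGen (MStep R) M N ∧ ¬ ∃ L, MStep R N L

/-- The critical pair of two rules on monomials. -/
def critPair {K : Type w} [DecidableEq K] (p q : MRule K) : MRule K :=
  (((p.1 + q.1) - (p.1 ∩ q.1)) - p.1 + p.2, ((p.1 + q.1) - (p.1 ∩ q.1)) - q.1 + q.2)

/-! ### Constants and uninterpreted symbols -/

/-- The canonical rewrite system of a set `E` of equations between constants: every constant is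
rewritten to the least constant of its class, if it is not that constant. -/
def canonC {F : Sig.{u, v}} {K : Type w} (O : Orderings F K) (E : Set (K × K)) : Set (K × K) :=
  {p | p.1 ≠ p.2 ∧ EqvGen (fun a b => (a, b) ∈ E) p.1 p.2 ∧
    ∀ e, EqvGen (fun a b => (a, b) ∈ E) p.1 e → e = p.2 ∨ O.gtC e p.2}

open Classical in
/-- The canonical form of a constant with respect to a canonical system of constant rules. -/
noncomputable def rep {K : Type w} (RC : Set (K × K)) (c : K) : K :=
  if h : ∃ d, (c, d) ∈ RC then h.choose else c

/-- A flat term `h(a₁,…,aₖ)`. -/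
abbrev FlatTerm (F : Sig.{u, v}) (K : Type w) : Type (max u w) :=
  (h : F.U) × (Fin (F.ar h) → K)

/-- Replace the constants in flat rules by their canonical forms. -/
def renameFlat {F : Sig.{u, v}} {K : Type w} (RC : Set (K × K))
    (Fl : Set (FlatTerm F K × K)) : Set (FlatTerm F K × K) :=
  (fun p => (⟨p.1.1, fun i => rep RC (p.1.2 i)⟩, rep RC p.2)) '' Fl

/-- Among the rules with the same left side keep the one with the least right side. -/
def leastFlat {F : Sig.{u, v}} {K : Type w} (O : Orderings F K)
    (Fl : Set (FlatTerm F K × K)) : Set (FlatTerm F K × K) :=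
  {p ∈ Fl | ∀ e, (p.1, e) ∈ Fl → e = p.2 ∨ O.gtC e p.2}

/-- The constant rules obtained from flat rules with the same left side. -/
def newConst {F : Sig.{u, v}} {K : Type w} (O : Orderings F K)
    (Fl : Set (FlatTerm F K × K)) : Set (K × K) :=
  {p | p.1 ≠ p.2 ∧ ∃ l, (l, p.1) ∈ Fl ∧ (l, p.2) ∈ leastFlat O Fl}

/-! ### Completion for one AC symbol -/

/-- Constant rules as rules on monomials. -/
def monoC {K : Type w} (RC : Set (K × K)) : Set (MRule K) :=
  (fun p => ({p.1}, {p.2})) '' RC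

/-- The constant rules in a set of rules on monomials. -/
def constOf {K : Type w} (R : Set (MRule K)) : Set (K × K) :=
  {p | ({p.1}, {p.2}) ∈ R}

/-- `p` is the oriented form of the equation `a = b`. -/
def IsOrient {F : Sig.{u, v}} {K : Type w} (O : Orderings F K) (f : F.A)
    (a b : Multiset K) (p : MRule K) : Prop :=
  O.gt f p.1 p.2 ∧ (p = (a, b) ∨ p = (b, a))

/-- The rules whose left side is reduced by `p`. -/
def collapsed {K : Type w} (R : Set (MRule K)) (p : MRule K) : Set (MRule K) :=
  {q ∈ R | p.1 ≤ q.1}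

/-- `R'` arises from `R` by adding the rule `p` and interreducing: rules whose left side is reduced
by `p` are removed, and a right side that is reduced by `p` is replaced by a normal form. -/
def Interreduce {K : Type w} [DecidableEq K] (R : Set (MRule K)) (p : MRule K)
    (R' : Set (MRule K)) : Prop :=
  ∃ nf : MRule K → Multiset K,
    (∀ q ∈ R \ collapsed R p,
      (p.1 ≤ q.2 → IsNF (insert p (R \ collapsed R p)) q.2 (nf q)) ∧
      (¬ p.1 ≤ q.2 → nf q = q.2)) ∧
    R' = insert p ((fun q => (q.1, nf q)) '' (R \ collapsed R p))

/-- One iteration of the completion procedure for a single AC symbol. The state is the pair of the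
current rules and the equations still to be processed; the procedure stops when the latter are used
up. The choices of the equation and of normal forms are arbitrary. -/
inductive CompStep {F : Sig.{u, v}} {K : Type w} [DecidableEq K] (O : Orderings F K) (f : F.A) :
    Set (MRule K) × Set (MRule K) → Set (MRule K) × Set (MRule K) → Prop
  | discard {R T : Set (MRule K)} {e : MRule K} {a : Multiset K} :
      e ∈ T → IsNF R e.1 a → IsNF R e.2 a → CompStep O f (R, T) (R, T \ {e})
  | add {R R' T : Set (MRule K)} {e p : MRule K} {a b : Multiset K} :
      e ∈ T → IsNF R e.1 a → IsNF R e.2 b → a ≠ b → IsOrient O f a b p → Interreduce R p R' →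
      CompStep O f (R, T) (R', (T \ {e}) ∪ critPair p '' R ∪ collapsed R p)

/-! ### Update of an AC rewrite system by constant rules -/

/-- State of the update procedure: current rules `R`, equations `S` of the current round, equations
`T` collected for the next round, new constant rules `NR`. -/
structure UState (K : Type w) where
  R : Set (MRule K)
  S : Set (MRule K)
  T : Set (MRule K)
  NR : Set (K × K)

/-- The rules of `Rf` whose left side is not in normal form with respect to `RC`. -/
def stale {K : Type w} [DecidableEq K] (RC : Set (K × K)) (Rf : Set (MRule K)) : Set (MRule K) :=
  {q ∈ Rf | ∃ L, MStep (monoC RC) q.1 L}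

/-- Initialization of the update procedure: rules with a left side that is not in normal form for
`RC` become equations to be processed; the other rules are kept, with their right sides in normal
form, and the constant rules are added to them. -/
def UInit {K : Type w} [DecidableEq K] (RC : Set (K × K)) (Rf : Set (MRule K))
    (σ : UState K) : Prop :=
  ∃ nf : MRule K → Multiset K,
    (∀ q ∈ Rf \ stale RC Rf, IsNF (monoC RC ∪ (Rf \ stale RC Rf)) q.2 (nf q)) ∧
    σ = ⟨monoC RC ∪ (fun q => (q.1, nf q)) '' (Rf \ stale RC Rf), stale RC Rf, ∅, ∅⟩

/-- One iteration of the update procedure; it stops when both `S` and `T` are empty. -/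
inductive UStep {F : Sig.{u, v}} {K : Type w} [DecidableEq K] (O : Orderings F K) (f : F.A) :
    UState K → UState K → Prop
  | discard {R S T : Set (MRule K)} {NR : Set (K × K)} {e : MRule K} {a : Multiset K} :
      e ∈ S → IsNF R e.1 a → IsNF R e.2 a → UStep O f ⟨R, S, T, NR⟩ ⟨R, S \ {e}, T, NR⟩
  | add {R R' S T : Set (MRule K)} {NR : Set (K × K)} {e p : MRule K} {a b : Multiset K}
      {nf₁ nf₂ : MRule K → Multiset K} :
      e ∈ S → IsNF R e.1 a → IsNF R e.2 b → a ≠ b → IsOrient O f a b p →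
      (∀ q ∈ R, IsNF R (critPair p q).1 (nf₁ q) ∧ IsNF R (critPair p q).2 (nf₂ q)) →
      Interreduce R p R' →
      UStep O f ⟨R, S, T, NR⟩
        ⟨R', S \ {e}, T ∪ {x | ∃ q ∈ R, nf₁ q ≠ nf₂ q ∧ x = (nf₁ q, nf₂ q)} ∪ collapsed R p,
          NR ∪ constOf {p}⟩
  | next {R T : Set (MRule K)} {NR : Set (K × K)} :
      T.Nonempty → UStep O f ⟨R, ∅, T, NR⟩ ⟨R, T, ∅, NR⟩

/-! ### The combination algorithm -/

/-- States of the combination algorithm. Throughout, `RC` and `Fl` are the constant rules and the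
flat rules of the system for constants and uninterpreted symbols, and `R f` is the system for the
AC symbol `f`. -/
inductive State (F : Sig.{u, v}) (K : Type w) : Type (max u v w)
  /-- congruence closure of the constant and uninterpreted equations -/
  | cc (RC : Set (K × K)) (Fl : Set (FlatTerm F K × K)) : State F K
  /-- first loop over the AC symbols; `todo` are the symbols still to be treated -/
  | loopComp (RC : Set (K × K)) (Fl : Set (FlatTerm F K × K)) (todo : Set F.A)
      (R : F.A → Set (MRule K)) : State F K
  /-- completion for the symbol `f` within the first loop -/
  | comp (RC : Set (K × K)) (Fl : Set (FlatTerm F K × K)) (todo : Set F.A)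
      (R : F.A → Set (MRule K)) (f : F.A) (σ : Set (MRule K) × Set (MRule K)) : State F K
  /-- update of the system for constants and uninterpreted symbols -/
  | updU (RC : Set (K × K)) (Fl : Set (FlatTerm F K × K)) (R : F.A → Set (MRule K)) : State F K
  /-- loop over the AC symbols within the main loop; `NN` are the new constant rules so far -/
  | loopUpd (RC : Set (K × K)) (Fl : Set (FlatTerm F K × K)) (todo : Set F.A)
      (R : F.A → Set (MRule K)) (NN : Set (K × K)) : State F K
  /-- update of the system for the symbol `f` within that loop -/
  | updAC (RC : Set (K × K)) (Fl : Set (FlatTerm F K × K)) (todo : Set F.A)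
      (R : F.A → Set (MRule K)) (NN : Set (K × K)) (f : F.A) (σ : UState K) : State F K
  /-- the algorithm has returned -/
  | halt (RC : Set (K × K)) (Fl : Set (FlatTerm F K × K)) (R : F.A → Set (MRule K)) : State F K

/-- Some rule of `Rf` contains a constant that is not in canonical form with respect to `RC`. -/
def NeedsUpdate {K : Type w} [DecidableEq K] (RC : Set (K × K)) (Rf : Set (MRule K)) : Prop :=
  ∃ q ∈ Rf, (∃ L, MStep (monoC RC) q.1 L) ∨ ∃ L, MStep (monoC RC) q.2 L

/-- The initial state on the input `P`. -/
def start {F : Sig.{u, v}} {K : Type w} (O : Orderings F K) (P : Set (PureEq F K)) : State F K :=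
  .cc (canonC O {p | PureEq.con p.1 p.2 ∈ P}) {p | PureEq.flat p.1.1 p.1.2 p.2 ∈ P}

/-- The steps of the combination algorithm on the input `P`. -/
inductive Step {F : Sig.{u, v}} {K : Type w} [DecidableEq K] [DecidableEq F.A]
    (O : Orderings F K) (P : Set (PureEq F K)) : State F K → State F K → Prop
  | cc_again {RC Fl} :
      (newConst O (renameFlat RC Fl)).Nonempty →
      Step O P (.cc RC Fl)
        (.cc (canonC O (RC ∪ newConst O (renameFlat RC Fl))) (leastFlat O (renameFlat RC Fl)))
  | cc_done {RC Fl} :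
      newConst O (renameFlat RC Fl) = ∅ →
      Step O P (.cc RC Fl)
        (.loopComp RC (leastFlat O (renameFlat RC Fl)) Set.univ (fun _ => ∅))
  | comp_start {RC Fl todo R f} :
      f ∈ todo →
      Step O P (.loopComp RC Fl todo R)
        (.comp RC Fl (todo \ {f}) R f
          (∅, (fun q => (q.1.map (rep RC), q.2.map (rep RC))) '' mrules P f))
  | comp_step {RC Fl todo R f σ σ'} :
      CompStep O f σ σ' →
      Step O P (.comp RC Fl todo R f σ) (.comp RC Fl todo R f σ')
  | comp_done {RC Fl todo R f Rf} :
      Step O P (.comp RC Fl todo R f (Rf, ∅)) (.loopComp RC Fl todo (Function.update R f Rf))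
  | propagate {RC Fl R} :
      canonC O (RC ∪ ⋃ f, constOf (R f)) ≠ RC →
      Step O P (.loopComp RC Fl ∅ R) (.updU (canonC O (RC ∪ ⋃ f, constOf (R f))) Fl R)
  | no_propagate {RC Fl R} :
      canonC O (RC ∪ ⋃ f, constOf (R f)) = RC →
      Step O P (.loopComp RC Fl ∅ R) (.halt RC Fl R)
  | updU_again {RC Fl R} :
      (newConst O (renameFlat RC Fl)).Nonempty →
      Step O P (.updU RC Fl R)
        (.updU (canonC O (RC ∪ newConst O (renameFlat RC Fl))) (leastFlat O (renameFlat RC Fl)) R)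
  | updU_done {RC Fl R} :
      newConst O (renameFlat RC Fl) = ∅ →
      Step O P (.updU RC Fl R) (.loopUpd RC (leastFlat O (renameFlat RC Fl)) Set.univ R ∅)
  | updAC_skip {RC Fl todo R NN f} :
      f ∈ todo → ¬ NeedsUpdate RC (R f) →
      Step O P (.loopUpd RC Fl todo R NN) (.loopUpd RC Fl (todo \ {f}) R NN)
  | updAC_start {RC Fl todo R NN f σ} :
      f ∈ todo → NeedsUpdate RC (R f) → UInit RC (R f) σ →
      Step O P (.loopUpd RC Fl todo R NN) (.updAC RC Fl (todo \ {f}) R NN f σ)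
  | updAC_step {RC Fl todo R NN f σ σ'} :
      UStep O f σ σ' →
      Step O P (.updAC RC Fl todo R NN f σ) (.updAC RC Fl todo R NN f σ')
  | updAC_done {RC Fl todo R NN f Rf NR} :
      Step O P (.updAC RC Fl todo R NN f ⟨Rf, ∅, ∅, NR⟩)
        (.loopUpd RC Fl todo (Function.update R f Rf) (NN ∪ NR))
  | again {RC Fl R NN} :
      NN.Nonempty →
      Step O P (.loopUpd RC Fl ∅ R NN) (.updU (canonC O (RC ∪ NN)) Fl R)
  | finish {RC Fl R} :
      Step O P (.loopUpd RC Fl ∅ R ∅) (.halt RC Fl R)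

/-- The returned rewrite system: the union of all constant rules, flat rules and rules on
monomials; a rule between singleton monomials is a constant rule. -/
def output {F : Sig.{u, v}} {K : Type w} (RC : Set (K × K)) (Fl : Set (FlatTerm F K × K))
    (R : F.A → Set (MRule K)) : Set (PureEq F K) :=
  {e | match e with
    | .con c d => (c, d) ∈ RC ∨ ∃ f, (c, d) ∈ constOf (R f)
    | .flat h a d => (⟨h, a⟩, d) ∈ Fl
    | .ac f M N => (M, N) ∈ R f ∧ ¬ (Multiset.card M = 1 ∧ Multiset.card N = 1)}

end ACC

open ACC

set_option linter.unusedSectionVars false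

namespace ACC

open Relation

/-! ### Terms modulo AC and their decomposition into the arguments of one AC symbol. -/

section Terms

variable {F : Sig.{u, v}} {K : Type w}

/-! Two finiteness facts carry the proof. There are finitely many constants, so an equivalence
relation on them can grow only finitely often. And multisets over a finite set are well
quasi-ordered by inclusion (Dickson's lemma, `exists_le_of_seq`), so admissible monomial orderings
are well-founded (`Orderings.mlt_wf`) and the set of reducible monomials cannot grow forever
(`reducibles_wf`).

For one AC symbol, completion is Buchberger's algorithm for commutative semigroups. Its invariant
`MSys` says that the rules are interreduced and that every critical pair is connected, by rules and
pending equations, through monomials smaller than the overlap. Connectedness, unlike joinability,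
survives interreduction: equations and rules that are discarded or rewritten can be simulated below
any bound (`RewritesRight.sim`, `MSys.discard`, `AddStep.msys`). Once nothing is pending, it implies
confluence (`CritConn.join`). Updating by constant rules starts from the same invariant
(`UInit.msys`).

For the whole algorithm, `Inv` combines these invariants with the statement that the current rules
and equations have the congruence closure of the input (`Pres`). Every step preserves it
(`Step.inv`) and decreases a lexicographic measure led by the equivalence relation on constants
(`Step.measure_lt`), because a new constant rule is never a consequence of the old ones. A state
that satisfies the invariant and has not returned always has a successor (`Inv.progress`).

A returned system is `Good`: constants in its rules are irreducible, so rules of different kinds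
overlap only trivially. Termination on terms follows from a count of nonconstant nodes and a
multiset of labels (`classStep_wf`). Confluence needs no analysis of overlaps in terms:
`Term.interp` computes a normal form bottom up, it identifies congruent terms
(`Good.interp_closure`), and every term rewrites to it (`Good.classSteps_interp`).

For fixed orderings, two reduced canonical systems with the same closure coincide
(`ReducedCanonical.unique`); this also makes the result independent of the run. Finally, replacing
the new constants by the terms that they stand for shows that purification is conservative
(`IsPurification.closure_iff`). -/

theorem Closure.bind {S X : Set (Term F K × Term F K)}
    (hS : ∀ q ∈ S, Closure X q.1 q.2) {s t : Term F K} (h : Closure S s t) : Closure X s t := by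
  induction h with
  | of h => exact hS _ h
  | refl s => exact .refl s
  | symm _ ih => exact .symm ih
  | trans _ _ ih₁ ih₂ => exact .trans ih₁ ih₂
  | app h _ ih => exact .app h ih
  | ac f _ _ ih₁ ih₂ => exact .ac f ih₁ ih₂
  | comm f s t => exact .comm f s t
  | assoc f s t r => exact .assoc f s t r

theorem ACEq.closure {X : Set (Term F K × Term F K)} {s t : Term F K} (h : ACEq s t) :
    Closure X s t :=
  Closure.bind (fun _ hq => hq.elim) h

theorem cls_eq {s t : Term F K} : s.cls = t.cls ↔ ACEq s t :=
  ⟨fun h => Quotient.exact h, fun h => Quotient.sound h⟩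

theorem exists_cls (x : ACTerm F K) : ∃ s : Term F K, s.cls = x := Quotient.exists_rep x

/-- The outermost symbol of a term, with the classes of the arguments of an uninterpreted one. -/
def Term.view : Term F K → K ⊕ (Option ((h : F.U) × (Fin (F.ar h) → ACTerm F K)))
  | .con c => .inl c
  | .app h a => .inr (some ⟨h, fun i => (a i).cls⟩)
  | .ac _ _ _ => .inr none

/-- The AC axioms have AC symbols at both roots, so constants and uninterpreted roots are rigid. The
inversion lemmas `ACEq.eq_con` and `ACEq.eq_app` are read off from this invariant. -/
theorem ACEq.view_eq {s t : Term F K} (h : ACEq s t) : s.view = t.view := by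
  induction h with
  | of h => exact h.elim
  | refl s => rfl
  | symm _ ih => exact ih.symm
  | trans _ _ ih₁ ih₂ => exact ih₁.trans ih₂
  | app h hab ih =>
    simp only [Term.view]
    congr 3
    funext i
    exact cls_eq.2 (hab i)
  | ac f _ _ ih₁ ih₂ => rfl
  | comm f s t => rfl
  | assoc f s t r => rfl

theorem ACEq.eq_con {s : Term F K} {c : K} (h : ACEq s (.con c)) : s = .con c := by
  have := h.view_eq
  cases s <;> simp_all [Term.view]

theorem ACEq.eq_app {s : Term F K} {h : F.U} {a : Fin (F.ar h) → Term F K}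
    (hs : ACEq s (.app h a)) : ∃ b, s = .app h b ∧ ∀ i, ACEq (b i) (a i) := by
  have := hs.view_eq
  cases s with
  | con c => simp [Term.view] at this
  | ac f s t => simp [Term.view] at this
  | app h' b =>
    simp only [Term.view, Sum.inr.injEq, Option.some.injEq, Sigma.mk.injEq] at this
    obtain ⟨rfl, h2⟩ := this
    exact ⟨b, rfl, fun i => cls_eq.1 (congrFun (eq_of_heq h2) i)⟩

open Classical in
/-- The constants and the other arguments of a term, read as an `f`-monomial over terms. -/
noncomputable def Term.atoms (f : F.A) : Term F K → Multiset K × Multiset (ACTerm F K)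
  | .con c => ({c}, 0)
  | .app h a => (0, {(Term.app h a).cls})
  | .ac g s t => if g = f then s.atoms f + t.atoms f else (0, {(Term.ac g s t).cls})

@[simp] theorem atoms_con (f : F.A) (c : K) : (Term.con c : Term F K).atoms f = ({c}, 0) := rfl

@[simp] theorem atoms_app (f : F.A) (h : F.U) (a : Fin (F.ar h) → Term F K) :
    (Term.app h a).atoms f = (0, {(Term.app h a).cls}) := rfl

@[simp] theorem atoms_ac_self (f : F.A) (s t : Term F K) :
    (Term.ac f s t).atoms f = s.atoms f + t.atoms f := by
  simp [Term.atoms]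

theorem atoms_ac_of_ne {f g : F.A} (h : g ≠ f) (s t : Term F K) :
    (Term.ac g s t).atoms f = (0, {(Term.ac g s t).cls}) := by
  simp [Term.atoms, h]

theorem ACEq.atoms_eq {s t : Term F K} (h : ACEq s t) (f : F.A) : s.atoms f = t.atoms f := by
  induction h with
  | of h => exact h.elim
  | refl s => rfl
  | symm _ ih => exact ih.symm
  | trans _ _ ih₁ ih₂ => exact ih₁.trans ih₂
  | app h hab ih =>
    simp only [atoms_app]
    rw [cls_eq.2 (Closure.app h hab)]
  | ac g h₁ h₂ ih₁ ih₂ =>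
    by_cases hg : g = f
    · subst hg; simp [ih₁, ih₂]
    · rw [atoms_ac_of_ne hg, atoms_ac_of_ne hg, cls_eq.2 (Closure.ac g h₁ h₂)]
  | comm g s t =>
    by_cases hg : g = f
    · subst hg; simp [add_comm]
    · rw [atoms_ac_of_ne hg, atoms_ac_of_ne hg, cls_eq.2 (Closure.comm g s t)]
  | assoc g s t r =>
    by_cases hg : g = f
    · subst hg; simp [add_assoc]
    · rw [atoms_ac_of_ne hg, atoms_ac_of_ne hg, cls_eq.2 (Closure.assoc g s t r)]

/-- Terms modulo AC as a semigroup under the operation `f`. -/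
def Block (K : Type w) (_ : F.A) : Type (max u v w) := ACTerm F K

/-- The AC axioms are the laws of a commutative semigroup. There is no zero, since no term denotes
the empty sum; `WithZero` supplies one so that sums over multisets make sense. -/
instance (f : F.A) : AddCommSemigroup (Block K f) where
  add := Quotient.map₂ (Term.ac f) (fun _ _ h _ _ h' => Closure.ac f h h')
  add_assoc a b c := by
    induction a using Quotient.inductionOn
    induction b using Quotient.inductionOn
    induction c using Quotient.inductionOn
    exact Quotient.sound (.symm (.assoc f _ _ _))
  add_comm a b := by
    induction a using Quotient.inductionOn
    induction b using Quotient.inductionOn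
    exact Quotient.sound (.comm f _ _)

/-- The inclusion of terms modulo AC into the monoid obtained from the semigroup of `f`. -/
def ACTerm.blk (f : F.A) (x : ACTerm F K) : WithZero (Block K f) :=
  WithZero.coe (α := Block K f) x

/-- The sum of given constants and terms in the semigroup of `f`. -/
noncomputable def evalAtoms (f : F.A) (p : Multiset K × Multiset (ACTerm F K)) : WithZero (Block K f) :=
  (p.1.map (fun c => (Term.con c : Term F K).cls.blk f)).sum + (p.2.map (ACTerm.blk f)).sum

theorem blk_ac (f : F.A) (s t : Term F K) :
    (Term.ac f s t).cls.blk f = s.cls.blk f + t.cls.blk f := rfl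

theorem evalAtoms_add (f : F.A) (p q : Multiset K × Multiset (ACTerm F K)) :
    evalAtoms f (p + q) = evalAtoms f p + evalAtoms f q := by
  simp only [evalAtoms, Prod.fst_add, Prod.snd_add, Multiset.map_add, Multiset.sum_add]
  exact add_add_add_comm (G := WithZero (Block K f)) _ _ _ _

theorem evalAtoms_atoms (f : F.A) (s : Term F K) :
    evalAtoms f (s.atoms f) = s.cls.blk f := by
  induction s with
  | con c =>
    simp only [evalAtoms, atoms_con, Multiset.map_singleton, Multiset.sum_singleton]
    exact add_zero (M := WithZero (Block K f)) _
  | app h a => simp [evalAtoms]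
  | ac g s t ih₁ ih₂ =>
    by_cases hg : g = f
    · subst hg
      rw [atoms_ac_self, evalAtoms_add, ih₁, ih₂, blk_ac]
    · rw [atoms_ac_of_ne hg]; simp [evalAtoms]

/-- The class of a term is the sum of its atoms in the semigroup of `f`, so it can be recovered from
them. With `ACEq.atoms_eq`, the atoms become a complete invariant modulo AC. -/
theorem aceq_of_atoms_eq {f : F.A} {s t : Term F K} (h : s.atoms f = t.atoms f) : ACEq s t := by
  have := evalAtoms_atoms f s
  rw [h, evalAtoms_atoms] at this
  exact cls_eq.1 (WithZero.coe_inj (α := Block K f).1 this).symm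

theorem atoms_ne_zero (f : F.A) (s : Term F K) : s.atoms f ≠ 0 := by
  intro h
  have := evalAtoms_atoms f s
  rw [h] at this
  simp only [evalAtoms, Prod.fst_zero, Prod.snd_zero, Multiset.map_zero, Multiset.sum_zero] at this
  exact WithZero.coe_ne_zero (α := Block K f) (this.symm.trans (add_zero _))

/-- The nonconstant atoms do not have `f` at the root, hence are their own single atom. This is the
condition under which `exists_atoms` can rebuild a term from a modified list of atoms. -/
theorem atoms_alien {f : F.A} {s : Term F K} {x : ACTerm F K} (hx : x ∈ (s.atoms f).2) :
    ∃ t : Term F K, t.atoms f = (0, {x}) := by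
  induction s with
  | con c => simp at hx
  | app h a =>
    obtain rfl : x = _ := by simpa using hx
    exact ⟨_, atoms_app f h a⟩
  | ac g s t ih₁ ih₂ =>
    by_cases hg : g = f
    · subst hg
      rw [atoms_ac_self, Prod.snd_add, Multiset.mem_add] at hx
      exact hx.elim ih₁ ih₂
    · rw [atoms_ac_of_ne hg] at hx
      obtain rfl : x = _ := by simpa using hx
      exact ⟨_, atoms_ac_of_ne hg s t⟩

theorem exists_atoms_add {f : F.A} {p q : Multiset K × Multiset (ACTerm F K)}
    (hp : p = 0 ∨ ∃ s : Term F K, s.atoms f = p) (hq : q = 0 ∨ ∃ s : Term F K, s.atoms f = q) :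
    p + q = 0 ∨ ∃ s : Term F K, s.atoms f = p + q := by
  rcases hp with rfl | ⟨s, rfl⟩
  · simpa using hq
  · rcases hq with rfl | ⟨t, rfl⟩
    · exact .inr ⟨s, by simp⟩
    · exact .inr ⟨.ac f s t, atoms_ac_self f s t⟩

theorem exists_atoms {f : F.A} (M : Multiset K) (A : Multiset (ACTerm F K))
    (hA : ∀ x ∈ A, ∃ t : Term F K, t.atoms f = (0, {x})) :
    (M, A) = 0 ∨ ∃ s : Term F K, s.atoms f = (M, A) := by
  have h₁ : ((M, 0) : Multiset K × Multiset (ACTerm F K)) = 0 ∨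
      ∃ s : Term F K, s.atoms f = (M, 0) := by
    induction M using Multiset.induction with
    | empty => exact .inl rfl
    | cons c M ih =>
      have := exists_atoms_add (.inr ⟨.con c, atoms_con f c⟩) ih
      simpa using this
  have h₂ : ((0, A) : Multiset K × Multiset (ACTerm F K)) = 0 ∨
      ∃ s : Term F K, s.atoms f = (0, A) := by
    induction A using Multiset.induction with
    | empty => exact .inl rfl
    | cons x A ih =>
      have := exists_atoms_add (.inr (hA x (by simp)))
        (ih (fun y hy => hA y (by simp [hy])))
      simpa using this
  simpa using exists_atoms_add h₁ h₂

/-- Monomials are the terms all of whose atoms are constants. Facts about monomials thereby reduce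
to equalities of pairs of multisets. -/
theorem isMono_iff {f : F.A} {M : Multiset K} {s : Term F K} :
    IsMono f M s ↔ s.atoms f = (M, 0) := by
  constructor
  · intro h
    induction h with
    | single c => rfl
    | add _ _ ih₁ ih₂ => simp [ih₁, ih₂]
  · suffices h : (s.atoms f).2 = 0 → IsMono f (s.atoms f).1 s by
      intro hs
      have := h (by rw [hs])
      rwa [hs] at this
    induction s with
    | con c => exact fun _ => .single c
    | app h a => simp
    | ac g s t ih₁ ih₂ =>
      by_cases hg : g = f
      · subst hg
        rw [atoms_ac_self]
        intro h
        rw [Prod.snd_add, add_eq_zero] at h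
        exact .add (ih₁ h.1) (ih₂ h.2)
      · simp [atoms_ac_of_ne hg]

theorem exists_isMono (f : F.A) {M : Multiset K} (hM : M ≠ 0) : ∃ s : Term F K, IsMono f M s := by
  rcases exists_atoms (F := F) (f := f) M 0 (by simp) with h | ⟨s, hs⟩
  · exact absurd (congrArg Prod.fst h) hM
  · exact ⟨s, isMono_iff.2 hs⟩

theorem IsMono.ne_zero {f : F.A} {M : Multiset K} {s : Term F K} (h : IsMono f M s) : M ≠ 0 := by
  rintro rfl
  exact atoms_ne_zero f s (isMono_iff.1 h)

theorem IsMono.aceq {f : F.A} {M : Multiset K} {s t : Term F K} (hs : IsMono f M s)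
    (ht : IsMono f M t) : ACEq s t :=
  aceq_of_atoms_eq ((isMono_iff.1 hs).trans (isMono_iff.1 ht).symm)

theorem IsMono.unique {f : F.A} {M N : Multiset K} {s t : Term F K} (hs : IsMono f M s)
    (ht : IsMono f N t) (h : ACEq s t) : M = N := by
  have := h.atoms_eq f
  rw [isMono_iff.1 hs, isMono_iff.1 ht] at this
  exact congrArg Prod.fst this

theorem IsMono.of_aceq {f : F.A} {M : Multiset K} {s t : Term F K} (hs : IsMono f M s)
    (h : ACEq s t) : IsMono f M t :=
  isMono_iff.2 ((h.atoms_eq f).symm.trans (isMono_iff.1 hs))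

theorem IsMono.eq_con {f : F.A} {c : K} {s : Term F K} (hs : IsMono f {c} s) : s = .con c :=
  (hs.aceq (.single c)).eq_con

/-- With two or more constants the root is an AC symbol, which is then determined. The bound is
needed: a constant is a monomial for every symbol. -/
theorem IsMono.eq_symbol {f g : F.A} {M N : Multiset K} {s : Term F K} (hs : IsMono f M s)
    (ht : IsMono g N s) (hM : 2 ≤ Multiset.card M) : f = g := by
  cases hs with
  | single c => simp at hM
  | add h₁ h₂ => cases ht; rfl

end Terms

/-! ### Rewriting terms modulo AC compared with rewriting monomials. -/

section Steps

variable {F : Sig.{u, v}} {K : Type w}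

/-- The constant rules in a set of pure rules, as pairs of constants. -/
def conPairs (R : Set (PureEq F K)) : Set (K × K) := {p | PureEq.con p.1 p.2 ∈ R}

/-- All rules of `R` that apply to `f`-monomials. -/
def monoRules (R : Set (PureEq F K)) (f : F.A) : Set (MRule K) := monoC (conPairs R) ∪ mrules R f

theorem classStep_cls {R : Set (PureEq F K)} {s : Term F K} {x : ACTerm F K} :
    ClassStep R s.cls x ↔ ∃ s' t, ACEq s' s ∧ t.cls = x ∧ TermStep (termEqs R) s' t := by
  simp only [ClassStep, cls_eq]

theorem TermStep.classStep {R : Set (PureEq F K)} {s t : Term F K}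
    (h : TermStep (termEqs R) s t) : ClassStep R s.cls t.cls := ⟨s, t, rfl, rfl, h⟩

theorem ClassStep.app {R : Set (PureEq F K)} (h : F.U) (a : Fin (F.ar h) → Term F K)
    (i : Fin (F.ar h)) {t : Term F K} (hs : ClassStep R (a i).cls t.cls) :
    ClassStep R (Term.app h a).cls (Term.app h (Function.update a i t)).cls := by
  obtain ⟨s', t', hs', ht', hst⟩ := hs
  refine ⟨.app h (Function.update a i s'), .app h (Function.update a i t'), ?_, ?_, ?_⟩
  · refine cls_eq.2 (.app h fun j => ?_)
    by_cases hj : j = i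
    · subst hj; rw [Function.update_self]; exact cls_eq.1 hs'
    · simpa [hj] using Closure.refl (a j)
  · refine cls_eq.2 (.app h fun j => ?_)
    by_cases hj : j = i
    · subst hj; rw [Function.update_self, Function.update_self]; exact cls_eq.1 ht'
    · simpa [hj] using Closure.refl (a j)
  · have := TermStep.app (E := termEqs R) h (Function.update a i s') i (t := t') (by simpa using hst)
    simpa using this

theorem ClassStep.acL {R : Set (PureEq F K)} (f : F.A) {s s' : Term F K} (t : Term F K)
    (hs : ClassStep R s.cls s'.cls) : ClassStep R (Term.ac f s t).cls (Term.ac f s' t).cls := by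
  obtain ⟨a, b, ha, hb, hab⟩ := hs
  exact ⟨.ac f a t, .ac f b t, cls_eq.2 (.ac f (cls_eq.1 ha) (.refl _)),
    cls_eq.2 (.ac f (cls_eq.1 hb) (.refl _)), .acL f t hab⟩

theorem ClassStep.acR {R : Set (PureEq F K)} (f : F.A) (s : Term F K) {t t' : Term F K}
    (hs : ClassStep R t.cls t'.cls) : ClassStep R (Term.ac f s t).cls (Term.ac f s t').cls := by
  obtain ⟨a, b, ha, hb, hab⟩ := hs
  exact ⟨.ac f s a, .ac f s b, cls_eq.2 (.ac f (.refl _) (cls_eq.1 ha)),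
    cls_eq.2 (.ac f (.refl _) (cls_eq.1 hb)), .acR f s hab⟩

/-- The arguments are changed one at a time, by induction on the set of positions already changed.
It serves both for rewriting sequences and for conversions. -/
theorem app_rel_of_update {ρ : Term F K → Term F K → Prop} (hrefl : ∀ s, ρ s s)
    (htrans : ∀ s t r, ρ s t → ρ t r → ρ s r) (h : F.U)
    (hupd : ∀ (a : Fin (F.ar h) → Term F K) i t, ρ (a i) t →
      ρ (.app h a) (.app h (Function.update a i t)))
    {a b : Fin (F.ar h) → Term F K} (hab : ∀ i, ρ (a i) (b i)) : ρ (.app h a) (.app h b) := by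
  classical
  have key : ∀ I : Finset (Fin (F.ar h)), ρ (.app h a) (.app h (fun i => if i ∈ I then b i else a i)) := by
    intro I
    induction I using Finset.induction with
    | empty => simpa using hrefl _
    | insert j I hj ih =>
      refine htrans _ _ _ ih ?_
      have := hupd (fun i => if i ∈ I then b i else a i) j (b j) (by simpa [hj] using hab j)
      convert this using 2
      funext i
      by_cases hij : i = j
      · subst hij; simp
      · simp [hij]
  simpa using key Finset.univ

theorem mem_monoC {RC : Set (K × K)} {q : MRule K} :
    q ∈ monoC RC ↔ ∃ c d, (c, d) ∈ RC ∧ q = ({c}, {d}) := by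
  simp only [monoC, Set.mem_image, Prod.exists]
  exact ⟨fun ⟨c, d, h, e⟩ => ⟨c, d, h, e.symm⟩, fun ⟨c, d, h, e⟩ => ⟨c, d, h, e.symm⟩⟩

variable [DecidableEq K]

/-- The form without subtraction, a rule in an additive context `Z`, makes compatibility with sums
immediate. -/
theorem mstep_iff {R : Set (MRule K)} {M N : Multiset K} :
    MStep R M N ↔ ∃ q ∈ R, ∃ Z, M = q.1 + Z ∧ N = q.2 + Z := by
  constructor
  · rintro ⟨q, hq, hle, rfl⟩
    exact ⟨q, hq, M - q.1, (add_tsub_cancel_of_le hle).symm, add_comm _ _⟩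
  · rintro ⟨q, hq, Z, rfl, rfl⟩
    exact ⟨q, hq, Multiset.le_add_right _ _, by rw [add_tsub_cancel_left, add_comm]⟩

theorem MStep.add_right {R : Set (MRule K)} {M N : Multiset K} (h : MStep R M N) (B : Multiset K) :
    MStep R (M + B) (N + B) := by
  obtain ⟨q, hq, Z, rfl, rfl⟩ := mstep_iff.1 h
  exact mstep_iff.2 ⟨q, hq, Z + B, add_assoc _ _ _, add_assoc _ _ _⟩

theorem MStep.mono {R R' : Set (MRule K)} (hR : R ⊆ R') {M N : Multiset K} (h : MStep R M N) :
    MStep R' M N := by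
  obtain ⟨q, hq, h⟩ := h
  exact ⟨q, hR hq, h⟩

theorem msteps_add_right {R : Set (MRule K)} {M N : Multiset K} (h : ReflTransGen (MStep R) M N)
    (B : Multiset K) : ReflTransGen (MStep R) (M + B) (N + B) :=
  h.lift (· + B) fun _ _ h => h.add_right B

theorem msteps_mono {R R' : Set (MRule K)} (hR : R ⊆ R') {M N : Multiset K}
    (h : ReflTransGen (MStep R) M N) : ReflTransGen (MStep R') M N :=
  h.lift id fun _ _ h => h.mono hR

/-- Subterms of an `f`-monomial are `f`-monomials, so only constant rules and rules for `f` can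
apply. The bound on left sides excludes rules of another AC symbol that would rewrite a single
constant. -/
theorem TermStep.isMono {R : Set (PureEq F K)}
    (hR : ∀ f M N, PureEq.ac f M N ∈ R → 2 ≤ Multiset.card M) {f : F.A} {M : Multiset K}
    {s t : Term F K} (h : TermStep (termEqs R) s t) (hs : IsMono f M s) :
    ∃ M', IsMono f M' t ∧ MStep (monoRules R f) M M' := by
  induction h generalizing M with
  | rule h =>
    obtain ⟨e, he, hd⟩ := h
    cases hd with
    | con c d =>
      cases hs
      exact ⟨{d}, .single d, mstep_iff.2 ⟨({c}, {d}), .inl (mem_monoC.2 ⟨c, d, he, rfl⟩), 0, by simp,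
        by simp⟩⟩
    | flat h a d => cases hs
    | ac g hA hB =>
      rename_i A B
      obtain rfl : g = f := hA.eq_symbol hs (hR _ _ _ he)
      obtain rfl := hA.unique hs (.refl _)
      exact ⟨B, hB, mstep_iff.2 ⟨(A, B), .inr he, 0, by simp, by simp⟩⟩
  | app h a i _ ih => cases hs
  | acL g t _ ih =>
    cases hs with
    | add h₁ h₂ =>
      obtain ⟨M', hM', hst⟩ := ih h₁
      exact ⟨_, .add hM' h₂, hst.add_right _⟩
  | acR g s _ ih =>
    cases hs with
    | add h₁ h₂ =>
      obtain ⟨M', hM', hst⟩ := ih h₂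
      refine ⟨_, .add h₁ hM', ?_⟩
      rw [add_comm, add_comm _ M']
      exact hst.add_right _

theorem ClassStep.isMono {R : Set (PureEq F K)}
    (hR : ∀ f M N, PureEq.ac f M N ∈ R → 2 ≤ Multiset.card M) {f : F.A} {M : Multiset K}
    {s : Term F K} {x : ACTerm F K} (h : ClassStep R s.cls x) (hs : IsMono f M s) :
    ∃ M' t, x = t.cls ∧ IsMono f M' t ∧ MStep (monoRules R f) M M' := by
  obtain ⟨s', t, h₁, rfl, hst⟩ := classStep_cls.1 h
  obtain ⟨M', h₂, h₃⟩ := TermStep.isMono hR hst (hs.of_aceq (Closure.symm h₁))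
  exact ⟨M', t, rfl, h₂, h₃⟩

theorem ClassStep.con {R : Set (PureEq F K)}
    (hR : ∀ f M N, PureEq.ac f M N ∈ R → 2 ≤ Multiset.card M) {c : K} {x : ACTerm F K}
    (h : ClassStep R (Term.con c).cls x) : ∃ d, PureEq.con c d ∈ R ∧ x = (Term.con d).cls := by
  obtain ⟨s', t, h₁, rfl, hst⟩ := classStep_cls.1 h
  obtain rfl := h₁.eq_con
  cases hst with
  | rule h =>
    obtain ⟨e, he, hd⟩ := h
    generalize hs : (Term.con c : Term F K) = s at hd
    dsimp only at hd
    cases hd with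
    | con c' d => cases hs; exact ⟨d, he, rfl⟩
    | flat h a d => cases hs
    | ac f hA hB =>
      subst hs
      cases hA
      simpa using hR _ _ _ he

theorem ClassStep.flat {R : Set (PureEq F K)}
    (hR : ∀ f M N, PureEq.ac f M N ∈ R → 2 ≤ Multiset.card M) {h : F.U} {a : Fin (F.ar h) → K}
    {x : ACTerm F K} (hx : ClassStep R (Term.app h fun i => .con (a i)).cls x) :
    (∃ d, PureEq.flat h a d ∈ R ∧ x = (Term.con d).cls) ∨ ∃ i d, PureEq.con (a i) d ∈ R := by
  obtain ⟨s', t, h₁, rfl, hst⟩ := classStep_cls.1 hx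
  obtain ⟨b, rfl, hb⟩ := h₁.eq_app
  obtain rfl : b = fun i => .con (a i) := funext fun i => (hb i).eq_con
  generalize hs : (Term.app h fun i => .con (a i) : Term F K) = s at hst
  cases hst with
  | rule hl =>
    obtain ⟨e, he, hd⟩ := hl
    dsimp only at hd
    cases hd with
    | con c' d => cases hs
    | flat h' a' d =>
      injection hs with h₁ h₂
      subst h₁
      have : a = a' := by
        funext i
        have := congrFun (eq_of_heq h₂) i
        injection this
      subst this
      exact .inl ⟨d, he, rfl⟩
    | ac f hA hB =>
      subst hs
      cases hA
  | app h' a' i ht =>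
    injection hs with h₁ h₂
    subst h₁
    obtain rfl := eq_of_heq h₂
    obtain ⟨d, hd, _⟩ := (TermStep.classStep ht).con hR
    exact .inr ⟨i, d, hd⟩
  | acL f t _ => cases hs
  | acR f s _ => cases hs

/-- The alien arguments `A` just ride along in the context. When the rest of the monomial and `A`
are both empty there is no term for the context, and the rule applies at the root. -/
theorem ClassStep.of_mstep {R : Set (PureEq F K)}
    (hR : ∀ f M N, PureEq.ac f M N ∈ R → M ≠ 0 ∧ N ≠ 0) {f : F.A} {M M' : Multiset K}
    {A : Multiset (ACTerm F K)} {s : Term F K} (h : MStep (monoRules R f) M M')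
    (hs : s.atoms f = (M, A)) : ∃ t : Term F K, t.atoms f = (M', A) ∧ ClassStep R s.cls t.cls := by
  obtain ⟨q, hq, Z, rfl, rfl⟩ := mstep_iff.1 h
  obtain ⟨l, r, hl, hr, hlr⟩ : ∃ l r : Term F K, IsMono f q.1 l ∧ IsMono f q.2 r ∧
      (l, r) ∈ termEqs R := by
    rcases hq with hq | hq
    · obtain ⟨c, d, hcd, rfl⟩ := mem_monoC.1 hq
      exact ⟨.con c, .con d, .single c, .single d, _, hcd, .con c d⟩
    · obtain ⟨h₁, h₂⟩ := hR _ _ _ hq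
      obtain ⟨l, hl⟩ := exists_isMono (F := F) f h₁
      obtain ⟨r, hr⟩ := exists_isMono (F := F) f h₂
      exact ⟨l, r, hl, hr, _, hq, .ac f hl hr⟩
  rcases exists_atoms (f := f) Z A (fun x hx => atoms_alien (s := s) (f := f) (by rw [hs]; exact hx))
    with h0 | ⟨z, hz⟩
  · obtain ⟨rfl, rfl⟩ : Z = 0 ∧ A = 0 := by simpa [Prod.ext_iff] using h0
    refine ⟨r, by simpa using isMono_iff.1 hr, l, r, cls_eq.2 (hl.aceq (isMono_iff.2 ?_)), rfl,
      .rule hlr⟩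
    simpa using hs
  · refine ⟨.ac f r z, by simp [isMono_iff.1 hr, hz], .ac f l z, .ac f r z, cls_eq.2 ?_, rfl,
      .acL f z (.rule hlr)⟩
    exact aceq_of_atoms_eq (f := f) (by simp [isMono_iff.1 hl, hz, hs])

theorem classSteps_of_msteps {R : Set (PureEq F K)}
    (hR : ∀ f M N, PureEq.ac f M N ∈ R → M ≠ 0 ∧ N ≠ 0) {f : F.A} {M M' : Multiset K}
    {A : Multiset (ACTerm F K)} {s t : Term F K} (h : ReflTransGen (MStep (monoRules R f)) M M')
    (hs : s.atoms f = (M, A)) (ht : t.atoms f = (M', A)) :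
    ReflTransGen (ClassStep R) s.cls t.cls := by
  induction h using ReflTransGen.head_induction_on generalizing s with
  | refl => rw [cls_eq.2 (aceq_of_atoms_eq (hs.trans ht.symm))]
  | head h _ ih =>
    obtain ⟨r, hr, hsr⟩ := ClassStep.of_mstep hR h hs
    exact .head hsr (ih hr)

end Steps

/-! ### Well-foundedness -/

theorem not_exists_chain {α : Type*} {r : α → α → Prop} (h : WellFounded (flip r)) :
    ¬ ∃ t : ℕ → α, ∀ n, r (t n) (t (n + 1)) := by
  rintro ⟨t, ht⟩
  exact (wellFounded_iff_isEmpty_descending_chain.1 h).false ⟨t, ht⟩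

theorem wellFounded_of_not_chain {α : Type*} {r : α → α → Prop}
    (h : ¬ ∃ t : ℕ → α, ∀ n, r (t n) (t (n + 1))) : WellFounded (flip r) :=
  wellFounded_iff_isEmpty_descending_chain.2 ⟨fun t => h ⟨t.1, t.2⟩⟩

/-- Dickson's lemma, transported from functions with values in `ℕ` to multisets. -/
theorem exists_le_of_seq {K : Type*} [Finite K] (t : ℕ → Multiset K) :
    ∃ i j, i < j ∧ t i ≤ t j := by
  classical
  obtain ⟨i, j, h, h'⟩ := wellQuasiOrdered_le (α := K →₀ ℕ)
    (fun n => (Finsupp.orderIsoMultiset (ι := K)).symm (t n))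
  exact ⟨i, j, h, (Finsupp.orderIsoMultiset (ι := K)).symm.le_iff_le.1 h'⟩

/-- Newman's lemma. -/
theorem join_of_locallyConfluent {α : Type*} {r : α → α → Prop} (hwf : WellFounded (flip r))
    (hloc : ∀ t u₁ u₂, r t u₁ → r t u₂ → ∃ v, ReflTransGen r u₁ v ∧ ReflTransGen r u₂ v)
    {t u₁ u₂ : α} (h₁ : ReflTransGen r t u₁) (h₂ : ReflTransGen r t u₂) :
    ∃ v, ReflTransGen r u₁ v ∧ ReflTransGen r u₂ v := by
  induction t using hwf.induction generalizing u₁ u₂ with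
  | _ t ih =>
    rcases h₁.cases_head with rfl | ⟨a, ha, hau⟩
    · exact ⟨u₂, h₂, .refl⟩
    rcases h₂.cases_head with rfl | ⟨b, hb, hbu⟩
    · exact ⟨u₁, .refl, .trans (.single ha) hau⟩
    obtain ⟨v, hav, hbv⟩ := hloc t a b ha hb
    obtain ⟨p, hp₁, hp₂⟩ := ih a ha hau hav
    obtain ⟨q, hq₁, hq₂⟩ := ih b hb (hbv.trans hp₂) hbu
    exact ⟨q, hp₁.trans hq₁, hq₂⟩

theorem join_of_eqvGen {α : Type*} {r : α → α → Prop}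
    (hconf : ∀ t u₁ u₂, ReflTransGen r t u₁ → ReflTransGen r t u₂ →
      ∃ v, ReflTransGen r u₁ v ∧ ReflTransGen r u₂ v) {a b : α} (h : EqvGen r a b) :
    ∃ v, ReflTransGen r a v ∧ ReflTransGen r b v := by
  induction h with
  | rel a b h => exact ⟨b, .single h, .refl⟩
  | refl a => exact ⟨a, .refl, .refl⟩
  | symm a b _ ih => obtain ⟨v, h₁, h₂⟩ := ih; exact ⟨v, h₂, h₁⟩
  | trans a b c _ _ ih₁ ih₂ =>
    obtain ⟨v, h₁, h₂⟩ := ih₁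
    obtain ⟨w, h₃, h₄⟩ := ih₂
    obtain ⟨z, h₅, h₆⟩ := hconf b v w h₂ h₃
    exact ⟨z, h₁.trans h₅, h₄.trans h₆⟩

theorem exists_normalForm {α : Type*} {r : α → α → Prop} (hwf : WellFounded (flip r)) (a : α) :
    ∃ b, ReflTransGen r a b ∧ ¬ ∃ c, r b c := by
  induction a using hwf.induction with
  | _ a ih =>
    by_cases h : ∃ c, r a c
    · obtain ⟨c, hc⟩ := h
      obtain ⟨b, hb, hn⟩ := ih c hc
      exact ⟨b, .head hc hb, hn⟩
    · exact ⟨a, .refl, h⟩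

/-! ### Admissible orderings and termination of oriented rules on monomials. -/

section Orders

variable {F : Sig.{u, v}} {K : Type w} (O : Orderings F K)

/-- The ordering on nonempty `f`-monomials, read upwards. -/
def Orderings.mlt (f : F.A) (N M : Multiset K) : Prop := N ≠ 0 ∧ M ≠ 0 ∧ O.gt f M N

variable {O}

theorem Orderings.mlt.trans {f : F.A} {L M N : Multiset K} (h₁ : O.mlt f L M) (h₂ : O.mlt f M N) :
    O.mlt f L N :=
  ⟨h₁.1, h₂.2.1, O.gt_trans f _ _ _ h₂.2.1 h₁.2.1 h₁.1 h₂.2.2 h₁.2.2⟩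

theorem Orderings.mlt.irrefl {f : F.A} {M : Multiset K} (h : O.mlt f M M) : False :=
  O.gt_irrefl f M h.1 h.2.2

theorem Orderings.mlt.add_right {f : F.A} {M N : Multiset K} (h : O.mlt f M N) (B : Multiset K) :
    O.mlt f (M + B) (N + B) :=
  ⟨fun e => h.1 (add_eq_zero.1 e).1, fun e => h.2.1 (add_eq_zero.1 e).1,
    O.gt_compat f _ _ _ h.2.1 h.1 h.2.2⟩

theorem Orderings.mlt_of_lt {f : F.A} {M N : Multiset K} (h : M < N) (hM : M ≠ 0) : O.mlt f M N :=
  ⟨hM, by rintro rfl; exact absurd h (by simp), O.gt_subterm f _ _ hM h⟩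

/-- An admissible ordering extends proper inclusion of nonempty multisets. -/
theorem Orderings.mlt.not_le {f : F.A} {M N : Multiset K} (h : O.mlt f M N) : ¬ N ≤ M := by
  intro hle
  rcases hle.eq_or_lt with rfl | hlt
  · exact h.irrefl
  · exact (h.trans (Orderings.mlt_of_lt hlt h.2.1)).irrefl

theorem Orderings.mlt_singleton {f : F.A} {c d : K} : O.mlt f {d} {c} ↔ O.gtC c d := by
  simp [Orderings.mlt, O.gt_extends]

/-- Nonconstant monomials lie above all constants. Hence a rule with a constant left side is a
constant rule. -/
theorem Orderings.mlt.eq_singleton {f : F.A} {M : Multiset K} {c : K} (h : O.mlt f M {c}) :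
    ∃ d, M = {d} := by
  rw [← Multiset.card_eq_one]
  by_contra hne
  have h2 : 2 ≤ Multiset.card M := by
    have := Multiset.card_pos.2 h.1
    omega
  exact (h.trans ⟨h.2.1, h.1, O.gt_nonconstant f M c h2⟩).irrefl

/-- In a descending sequence Dickson's lemma gives an earlier member included in a later one, which
contradicts `Orderings.mlt.not_le`. -/
theorem Orderings.mlt_wf [Finite K] (f : F.A) : WellFounded (O.mlt f) := by
  rw [wellFounded_iff_isEmpty_descending_chain]
  refine ⟨fun ⟨t, ht⟩ => ?_⟩
  obtain ⟨i, j, hij, hle⟩ := exists_le_of_seq t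
  have key : ∀ k, O.mlt f (t (i + k + 1)) (t i) := by
    intro k
    induction k with
    | zero => exact ht i
    | succ k ih => exact (ht _).trans ih
  obtain ⟨k, rfl⟩ := Nat.exists_eq_add_of_lt hij
  exact (key k).not_le hle

theorem Orderings.gtC_wf [Finite K] : WellFounded (flip O.gtC) :=
  have : IsTrans K (flip O.gtC) := ⟨fun _ _ _ h h' => O.gtC_trans _ _ _ h' h⟩
  have : Std.Irrefl (flip O.gtC) := ⟨O.gtC_irrefl⟩
  Finite.wellFounded_of_trans_of_irrefl _

variable (O) in
/-- Every rule on monomials has nonempty sides and decreases. -/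
def MOriented (f : F.A) (R : Set (MRule K)) : Prop := ∀ q ∈ R, O.mlt f q.2 q.1

variable [DecidableEq K]

theorem MStep.mlt {f : F.A} {R : Set (MRule K)} (hR : MOriented O f R) {M N : Multiset K}
    (h : MStep R M N) : O.mlt f N M := by
  obtain ⟨q, hq, Z, rfl, rfl⟩ := mstep_iff.1 h
  exact (hR q hq).add_right Z

theorem msteps_mlt {f : F.A} {R : Set (MRule K)} (hR : MOriented O f R) {M N : Multiset K}
    (h : ReflTransGen (MStep R) M N) : N = M ∨ O.mlt f N M := by
  induction h with
  | refl => exact .inl rfl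
  | tail _ h ih =>
    rcases ih with rfl | ih
    · exact .inr (h.mlt hR)
    · exact .inr ((h.mlt hR).trans ih)

theorem mstep_wf [Finite K] {f : F.A} {R : Set (MRule K)} (hR : MOriented O f R) :
    WellFounded (flip (MStep R)) :=
  Subrelation.wf (fun h => MStep.mlt hR h) (O.mlt_wf f)

theorem exists_isNF [Finite K] {f : F.A} {R : Set (MRule K)} (hR : MOriented O f R)
    (M : Multiset K) : ∃ N, IsNF R M N :=
  exists_normalForm (mstep_wf hR) M

theorem monoC_oriented {f : F.A} {RC : Set (K × K)} (h : ∀ p ∈ RC, O.gtC p.1 p.2) :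
    MOriented O f (monoC RC) := by
  intro q hq
  obtain ⟨c, d, hcd, rfl⟩ := mem_monoC.1 hq
  exact Orderings.mlt_singleton.2 (h _ hcd)

theorem Oriented.mrules {R : Set (PureEq F K)} (h : Oriented O R) (f : F.A) :
    MOriented O f (mrules R f) := by
  intro q hq
  obtain ⟨h₁, h₂, h₃⟩ := h.2 _ _ _ hq
  exact ⟨h₂, by rintro h; simp [h] at h₁, h₃⟩

theorem Oriented.monoRules {R : Set (PureEq F K)} (h : Oriented O R) (f : F.A) :
    MOriented O f (monoRules R f) := by
  rintro q (hq | hq)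
  · exact monoC_oriented (fun p hp => h.1 _ _ hp) q hq
  · exact h.mrules f q hq

end Orders

/-! ### Termination of rewriting with oriented rules -/

section Termination

variable {F : Sig.{u, v}} {K : Type w} {O : Orderings F K}

variable (O) in
/-- The ordering on the labels of a flattened term: constants and the constant parts of
monomials. -/
inductive LabelLT : K ⊕ (F.A × Multiset K) → K ⊕ (F.A × Multiset K) → Prop
  | con {c d : K} : O.gtC c d → LabelLT (.inl d) (.inl c)
  | mono {f : F.A} {M N : Multiset K} : O.mlt f N M → LabelLT (.inr (f, N)) (.inr (f, M))

theorem labelLT_wf [Finite K] : WellFounded (LabelLT O) := by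
  refine ⟨fun l => ?_⟩
  rcases l with c | ⟨f, M⟩
  · induction c using O.gtC_wf.induction with
    | _ c ih =>
      refine ⟨_, fun l hl => ?_⟩
      cases hl with
      | con h => exact ih _ h
  · induction M using (O.mlt_wf f).induction with
    | _ M ih =>
      refine ⟨_, fun l hl => ?_⟩
      cases hl with
      | mono h => exact ih _ h

/-- What is known about a flattened term in some context: the constants that it contributes to the
surrounding monomial, the other labels, and the number of its nonconstant nodes. -/
abbrev Info (F : Sig.{u, v}) (K : Type w) : Type (max v w) :=
  Multiset K × Multiset (K ⊕ (F.A × Multiset K)) × ℕ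

/-- The information on a complete `f`-monomial. -/
def Info.close (f : F.A) (x : Info F K) : Info F K := (0, {.inr (f, x.1)} + x.2.1, x.2.2 + 1)

open Classical in
/-- The information on a term in the context of an AC symbol or (`none`) another context. -/
noncomputable def Term.info : Term F K → Option F.A → Info F K
  | .con c, some _ => ({c}, 0, 0)
  | .con c, none => (0, {.inl c}, 0)
  | .app _ a, _ => (0, (∑ i, (a i).info none).2.1, (∑ i, (a i).info none).2.2 + 1)
  | .ac f s t, o =>
    if o = some f then s.info (some f) + t.info (some f)
    else (s.info (some f) + t.info (some f)).close f

/-- Inside nested occurrences of one AC symbol the information is merely added, so the AC laws of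
addition suffice. -/
theorem ACEq.info_eq {s t : Term F K} (h : ACEq s t) : s.info = t.info := by
  induction h with
  | of h => exact h.elim
  | refl s => rfl
  | symm _ ih => exact ih.symm
  | trans _ _ ih₁ ih₂ => exact ih₁.trans ih₂
  | app h hab ih => funext o; simp [Term.info, ih]
  | ac g h₁ h₂ ih₁ ih₂ => funext o; simp [Term.info, ih₁, ih₂]
  | comm g s t => funext o; simp [Term.info, add_comm]
  | assoc g s t r => funext o; simp [Term.info, add_assoc]

variable (O) in
/-- The decrease of the information on a term in a context. -/
def InfoLT (o : Option F.A) (y x : Info F K) : Prop :=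
  y.2.2 < x.2.2 ∨ (y.2.2 = x.2.2 ∧ ((∃ f, o = some f ∧ O.mlt f y.1 x.1 ∧ y.2.1 = x.2.1) ∨
    (y.1 = x.1 ∧ CutExpand (LabelLT O) y.2.1 x.2.1)))

theorem InfoLT.add_right {o : Option F.A} {y x : Info F K} (h : InfoLT O o y x) (z : Info F K) :
    InfoLT O o (y + z) (x + z) := by
  rcases h with h | ⟨h, ⟨f, rfl, hm, hl⟩ | ⟨hm, hl⟩⟩
  · exact .inl (Nat.add_lt_add_right h _)
  · exact .inr ⟨congrArg (· + z.2.2) h, .inl ⟨f, rfl, hm.add_right _, congrArg (· + z.2.1) hl⟩⟩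
  · refine .inr ⟨congrArg (· + z.2.2) h, .inr ⟨congrArg (· + z.1) hm, ?_⟩⟩
    change CutExpand _ (y.2.1 + z.2.1) (x.2.1 + z.2.1)
    rw [add_comm, add_comm x.2.1]
    exact (cutExpand_add_left _).2 hl

theorem InfoLT.close {f : F.A} {y x : Info F K} (h : InfoLT O (some f) y x) (o : Option F.A) :
    InfoLT O o (y.close f) (x.close f) := by
  rcases h with h | ⟨h, ⟨f, hf, hm, hl⟩ | ⟨hm, hl⟩⟩
  · exact .inl (Nat.add_lt_add_right h _)
  · obtain rfl := Option.some.inj hf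
    refine .inr ⟨congrArg (· + 1) h, .inr ⟨rfl, ?_⟩⟩
    simp only [Info.close, hl]
    exact cutExpand_single_add (.mono hm) _
  · refine .inr ⟨congrArg (· + 1) h, .inr ⟨rfl, ?_⟩⟩
    simp only [Info.close, hm]
    exact (cutExpand_add_left _).2 hl

theorem IsMono.info {f : F.A} {M : Multiset K} {s : Term F K} (h : IsMono f M s) :
    s.info (some f) = (M, 0, 0) := by
  induction h with
  | single c => rfl
  | add _ _ ih₁ ih₂ => simp [Term.info, ih₁, ih₂]

theorem IsMono.info_of_ne {f : F.A} {M : Multiset K} {s : Term F K} (h : IsMono f M s)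
    {o : Option F.A} (ho : o ≠ some f) :
    (s.info o).2.2 = 0 ∧ Multiset.card M = 1 ∨
      s.info o = Info.close f ((M, 0, 0) : Info F K) := by
  cases h with
  | single c => left; cases o <;> simp [Term.info]
  | add h₁ h₂ => right; simp [Term.info, ho, h₁.info, h₂.info]

/-- Flat rules remove a nonconstant node, as do AC rules with constant right side outside their own
symbol. Other AC rules lower either the constant part given to the surrounding monomial or, in a
foreign context, one label. Constant rules do the same. -/
theorem infoLT_of_rule {R : Set (PureEq F K)} (hR : Oriented O R) {s t : Term F K}
    (h : (s, t) ∈ termEqs R) (o : Option F.A) : InfoLT O o (t.info o) (s.info o) := by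
  obtain ⟨e, he, hd⟩ := h
  dsimp only at hd
  cases hd with
  | con c d =>
    have hcd := hR.1 _ _ he
    cases o with
    | none =>
      exact .inr ⟨rfl, .inr ⟨rfl, cutExpand_singleton_singleton (.con hcd)⟩⟩
    | some f => exact .inr ⟨rfl, .inl ⟨f, rfl, Orderings.mlt_singleton.2 hcd, rfl⟩⟩
  | flat h a d =>
    left
    cases o <;> simp [Term.info]
  | ac f hM hN =>
    rename_i M N
    obtain ⟨h2, hN0, hgt⟩ := hR.2 _ _ _ he
    have hlt : O.mlt f N M := ⟨hN0, hM.ne_zero, hgt⟩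
    by_cases ho : o = some f
    · subst ho
      rw [hM.info, hN.info]
      exact .inr ⟨rfl, .inl ⟨f, rfl, hlt, rfl⟩⟩
    · rcases hM.info_of_ne ho with ⟨_, h⟩ | hMi
      · omega
      rw [hMi]
      rcases hN.info_of_ne ho with ⟨h, _⟩ | hNi
      · left; rw [h]; exact Nat.succ_pos _
      · rw [hNi]
        exact InfoLT.close (y := (N, 0, 0)) (x := (M, 0, 0)) (.inr ⟨rfl, .inl ⟨f, rfl, hlt, rfl⟩⟩) o

/-- The decrease at the redex passes upwards because it is stable under adding siblings and under
closing a monomial. -/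
theorem TermStep.infoLT {R : Set (PureEq F K)} (hR : Oriented O R) {s t : Term F K}
    (h : TermStep (termEqs R) s t) (o : Option F.A) : InfoLT O o (t.info o) (s.info o) := by
  induction h generalizing o with
  | rule h => exact infoLT_of_rule hR h o
  | app h a i hst ih =>
    rename_i t
    have hsum : InfoLT O none (∑ j, (Function.update a i t j).info none) (∑ j, (a j).info none) := by
      rw [← Finset.add_sum_erase _ _ (Finset.mem_univ i),
        ← Finset.add_sum_erase (a := i) _ (fun j => (a j).info none) (Finset.mem_univ i),
        Function.update_self]
      rw [Finset.sum_congr (g := fun j => (a j).info none) rfl]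
      · exact (ih none).add_right _
      · intro j hj
        rw [Function.update_of_ne (Finset.ne_of_mem_erase hj)]
    simp only [Term.info]
    -- Below an uninterpreted symbol the context is `none`, so a decrease of the part contributed to
    -- a surrounding monomial is impossible.
    rcases hsum with h | ⟨h, ⟨f, hf, _⟩ | ⟨_, hl⟩⟩
    · exact .inl (Nat.add_lt_add_right h _)
    · cases hf
    · exact .inr ⟨congrArg (· + 1) h, .inr ⟨rfl, hl⟩⟩
  | acL f r _ ih =>
    have := (ih (some f)).add_right (r.info (some f))
    by_cases ho : o = some f
    · subst ho; simpa [Term.info] using this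
    · simpa [Term.info, ho] using this.close o
  | acR f r _ ih =>
    have := (ih (some f)).add_right (r.info (some f))
    rw [add_comm, add_comm _ (r.info (some f))] at this
    by_cases ho : o = some f
    · subst ho; simpa [Term.info] using this
    · simpa [Term.info, ho] using this.close o

/-- The number of nonconstant nodes comes first; it bounds how often labels can be rearranged. At
equal number the multiset of labels decreases in `CutExpand` of the well-founded `LabelLT`. -/
theorem classStep_wf [Finite K] {R : Set (PureEq F K)} (hR : Oriented O R) :
    WellFounded (flip (ClassStep R)) := by
  let m : ACTerm F K → ℕ × Multiset (K ⊕ (F.A × Multiset K)) :=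
    Quotient.lift (fun s => ((s.info none).2.2, (s.info none).2.1))
      fun s t (h : ACEq s t) => by simp only [h.info_eq]
  refine Subrelation.wf (r := InvImage (Prod.Lex (· < ·) (CutExpand (LabelLT O))) m) ?_
    (InvImage.wf m (wellFounded_lt.prod_lex labelLT_wf.cutExpand))
  rintro y x ⟨s, t, rfl, rfl, h⟩
  change Prod.Lex _ _ ((t.info none).2.2, (t.info none).2.1) ((s.info none).2.2, (s.info none).2.1)
  rcases h.infoLT hR none with h | ⟨h, ⟨f, hf, _⟩ | ⟨_, hl⟩⟩
  · exact .left _ _ h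
  · cases hf
  · rw [h]; exact .right _ hl

theorem Oriented.mono {R R' : Set (PureEq F K)} (h : Oriented O R') (hR : R ⊆ R') :
    Oriented O R :=
  ⟨fun c d hcd => h.1 c d (hR hcd), fun f M N hM => h.2 f M N (hR hM)⟩

end Termination

/-! ### Completion of rules on the monomials of one AC symbol. -/

section Monomials

variable {F : Sig.{u, v}} {K : Type w} {O : Orderings F K} {f : F.A} [DecidableEq K]

theorem irreducible_iff {R : Set (MRule K)} {M : Multiset K} :
    (¬ ∃ N, MStep R M N) ↔ ∀ q ∈ R, ¬ q.1 ≤ M :=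
  ⟨fun h q hq hle => h ⟨_, q, hq, hle, rfl⟩, fun h ⟨_, q, hq, hle, _⟩ => h q hq hle⟩

theorem IsNF.not_le {R : Set (MRule K)} {M N : Multiset K} (h : IsNF R M N) :
    ∀ q ∈ R, ¬ q.1 ≤ N := irreducible_iff.1 h.2

theorem overlap_eq (A B : Multiset K) : A + B - A ∩ B = A ∪ B := by
  ext c
  simp only [Multiset.count_sub, Multiset.count_add, Multiset.count_inter, Multiset.count_union]
  omega

theorem critPair_eq (p q : MRule K) :
    critPair p q = ((p.1 ∪ q.1) - p.1 + p.2, (p.1 ∪ q.1) - q.1 + q.2) := by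
  simp only [critPair, overlap_eq]

theorem critPair_swap (p q : MRule K) : (critPair q p) = (critPair p q).swap := by
  simp only [critPair_eq, Prod.swap, Multiset.union_comm q.1 p.1]

/-! ### Congruence generated by equations on monomials -/

/-- The additive congruence generated by a set of equations on monomials. -/
def mcon (E : Set (MRule K)) : AddCon (Multiset K) := addConGen fun M N => (M, N) ∈ E

theorem mcon_of_mem {E : Set (MRule K)} {q : MRule K} (h : q ∈ E) : mcon E q.1 q.2 :=
  AddConGen.Rel.of _ _ h

theorem mcon_le {E : Set (MRule K)} {c : AddCon (Multiset K)} (h : ∀ q ∈ E, c q.1 q.2) :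
    mcon E ≤ c :=
  AddCon.addConGen_le.2 fun M N hMN => h (M, N) hMN

theorem mcon_mono {E E' : Set (MRule K)} (h : E ⊆ E') : mcon E ≤ mcon E' :=
  mcon_le fun _ hq => mcon_of_mem (h hq)

theorem MStep.mcon {E : Set (MRule K)} {M N : Multiset K} (h : MStep E M N) : mcon E M N := by
  obtain ⟨q, hq, Z, rfl, rfl⟩ := mstep_iff.1 h
  exact (ACC.mcon E).add (mcon_of_mem hq) ((ACC.mcon E).refl Z)

theorem msteps_mcon {E : Set (MRule K)} {M N : Multiset K} (h : ReflTransGen (MStep E) M N) :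
    mcon E M N := by
  induction h with
  | refl => exact (mcon E).refl _
  | tail _ h ih => exact (mcon E).trans ih h.mcon

theorem critPair_mcon {E : Set (MRule K)} {p q : MRule K} (hp : p ∈ E) (hq : q ∈ E) :
    mcon E (critPair p q).1 (critPair p q).2 := by
  rw [critPair_eq]
  have h₁ : MStep E (p.1 ∪ q.1) ((p.1 ∪ q.1) - p.1 + p.2) :=
    ⟨p, hp, Multiset.le_union_left, rfl⟩
  have h₂ : MStep E (p.1 ∪ q.1) ((p.1 ∪ q.1) - q.1 + q.2) :=
    ⟨q, hq, Multiset.le_union_right, rfl⟩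
  exact (mcon E).trans ((mcon E).symm h₁.mcon) h₂.mcon

/-! ### Connectedness below a monomial -/

variable (O f) in
/-- `M` and `N` are connected by steps with the equations `E` through monomials smaller
than `L`. -/
def Conn (E : Set (MRule K)) (L : Multiset K) : Multiset K → Multiset K → Prop :=
  EqvGen fun M N => MStep E M N ∧ O.mlt f M L ∧ O.mlt f N L

theorem Conn.mono {E E' : Set (MRule K)} (hE : E ⊆ E') {L M N : Multiset K}
    (h : Conn O f E L M N) : Conn O f E' L M N :=
  EqvGen.mono (fun _ _ h => ⟨h.1.mono hE, h.2⟩) _ _ h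

theorem Conn.add_right {E : Set (MRule K)} {L M N : Multiset K} (h : Conn O f E L M N)
    (Z : Multiset K) : Conn O f E (L + Z) (M + Z) (N + Z) := by
  induction h with
  | rel M N h => exact .rel _ _ ⟨h.1.add_right Z, h.2.1.add_right Z, h.2.2.add_right Z⟩
  | refl M => exact .refl _
  | symm M N _ ih => exact .symm _ _ ih
  | trans M N P _ _ ih₁ ih₂ => exact .trans _ _ _ ih₁ ih₂

theorem Conn.mcon {E : Set (MRule K)} {L M N : Multiset K} (h : Conn O f E L M N) :
    mcon E M N := by
  induction h with
  | rel M N h => exact h.1.mcon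
  | refl M => exact (ACC.mcon E).refl _
  | symm M N _ ih => exact (ACC.mcon E).symm ih
  | trans M N P _ _ ih₁ ih₂ => exact (ACC.mcon E).trans ih₁ ih₂

/-- A trivial chain carries no bound, whence the first alternative. -/
theorem Conn.bound {E : Set (MRule K)} {L M N : Multiset K} (h : Conn O f E L M N) :
    M = N ∨ (O.mlt f M L ∧ O.mlt f N L) := by
  induction h with
  | rel M N h => exact .inr h.2
  | refl M => exact .inl rfl
  | symm M N _ ih => exact ih.imp Eq.symm And.symm
  | trans M N P _ _ ih₁ ih₂ =>
    rcases ih₁ with rfl | ⟨h₁, _⟩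
    · exact ih₂
    · rcases ih₂ with rfl | ⟨_, h₂⟩
      · exact .inr ⟨h₁, by assumption⟩
      · exact .inr ⟨h₁, h₂⟩

theorem conn_of_msteps {R E : Set (MRule K)} (hR : MOriented O f R) (hE : R ⊆ E)
    {L M N : Multiset K} (h : ReflTransGen (MStep R) M N) (hM : O.mlt f M L) :
    Conn O f E L M N := by
  induction h using ReflTransGen.head_induction_on with
  | refl => exact .refl _
  | head h _ ih =>
    have := (h.mlt hR).trans hM
    exact .trans _ _ _ (.rel _ _ ⟨h.mono hE, hM, this⟩) (ih this)

variable (O f) in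
/-- Every step with an equation of `E` can be replaced by steps with equations of `E'` through
monomials below any bound of the two sides. -/
def Sim (E E' : Set (MRule K)) : Prop :=
  ∀ q ∈ E, ∀ L Z, O.mlt f (q.1 + Z) L → O.mlt f (q.2 + Z) L →
    Conn O f E' L (q.1 + Z) (q.2 + Z)

theorem Sim.of_subset {E E' : Set (MRule K)} (h : E ⊆ E') : Sim O f E E' :=
  fun q hq _ Z h₁ h₂ => .rel _ _ ⟨mstep_iff.2 ⟨q, h hq, Z, rfl, rfl⟩, h₁, h₂⟩

theorem Sim.union {E₁ E₂ E' : Set (MRule K)} (h₁ : Sim O f E₁ E') (h₂ : Sim O f E₂ E') :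
    Sim O f (E₁ ∪ E₂) E' := by
  rintro q (hq | hq)
  · exact h₁ q hq
  · exact h₂ q hq

theorem Conn.sim {E E' : Set (MRule K)} (hE : Sim O f E E') {L M N : Multiset K}
    (h : Conn O f E L M N) : Conn O f E' L M N := by
  induction h with
  | rel M N h =>
    obtain ⟨q, hq, Z, rfl, rfl⟩ := mstep_iff.1 h.1
    exact hE q hq _ _ h.2.1 h.2.2
  | refl M => exact .refl _
  | symm M N _ ih => exact .symm _ _ ih
  | trans M N P _ _ ih₁ ih₂ => exact .trans _ _ _ ih₁ ih₂

theorem Sim.mono_right {E E' E'' : Set (MRule K)} (h : Sim O f E E') (hE : E' ⊆ E'') :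
    Sim O f E E'' := fun q hq L Z h₁ h₂ => (h q hq L Z h₁ h₂).mono hE

theorem Sim.trans {E E' E'' : Set (MRule K)} (h : Sim O f E E') (h' : Sim O f E' E'') :
    Sim O f E E'' := fun q hq L Z h₁ h₂ => (h q hq L Z h₁ h₂).sim h'

theorem Sim.mcon {E E' : Set (MRule K)} (h : Sim O f E E') {q : MRule K} (hq : q ∈ E)
    (h₁ : q.1 ≠ 0) (h₂ : q.2 ≠ 0) : mcon E' q.1 q.2 := by
  -- The sum of two nonempty monomials properly includes both, so it is a bound that is always
  -- available.
  have := (h q hq (q.1 + q.2) 0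
    (by rw [add_zero]; exact Orderings.mlt_of_lt (lt_add_of_pos_right _ (pos_iff_ne_zero.2 h₂)) h₁)
    (by rw [add_zero]; exact Orderings.mlt_of_lt (lt_add_of_pos_left _ (pos_iff_ne_zero.2 h₁)) h₂)).mcon
  simpa using this

/-! ### Confluence from critical pairs -/

variable (O f) in
/-- All critical pairs of `R` are connected with `E` below their overlaps. -/
def CritConn (R E : Set (MRule K)) : Prop :=
  ∀ p ∈ R, ∀ q ∈ R, Conn O f E (p.1 ∪ q.1) (critPair p q).1 (critPair p q).2

/-- The overlap is the union, the least multiset that includes both left sides; every peak is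
therefore a critical peak in an additive context. -/
theorem peak_eq {p q : MRule K} {M : Multiset K} (hp : p.1 ≤ M) (hq : q.1 ≤ M) :
    ∃ Z, M = (p.1 ∪ q.1) + Z ∧ M - p.1 + p.2 = (critPair p q).1 + Z ∧
      M - q.1 + q.2 = (critPair p q).2 + Z := by
  have hL : p.1 ∪ q.1 ≤ M := Multiset.union_le hp hq
  refine ⟨M - (p.1 ∪ q.1), (add_tsub_cancel_of_le hL).symm, ?_, ?_⟩
  · nth_rw 1 [← add_tsub_cancel_of_le hL]
    rw [critPair_eq, ← tsub_add_eq_add_tsub (Multiset.le_union_left : p.1 ≤ p.1 ∪ q.1),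
      add_right_comm]
  · nth_rw 1 [← add_tsub_cancel_of_le hL]
    rw [critPair_eq, ← tsub_add_eq_add_tsub (Multiset.le_union_right : q.1 ≤ p.1 ∪ q.1),
      add_right_comm]

/-- Newman's argument with the connectedness criterion. The ends of a peak at `t` are linked by a
chain below `t`, and the induction hypothesis gives confluence at its intermediate monomials. -/
theorem CritConn.join [Finite K] {R : Set (MRule K)} (hR : MOriented O f R)
    (h : CritConn O f R R) {t u₁ u₂ : Multiset K} (h₁ : ReflTransGen (MStep R) t u₁)
    (h₂ : ReflTransGen (MStep R) t u₂) :
    ∃ v, ReflTransGen (MStep R) u₁ v ∧ ReflTransGen (MStep R) u₂ v := by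
  induction t using (O.mlt_wf f).induction generalizing u₁ u₂ with
  | _ t ih =>
    -- Joins of consecutive pieces of the chain are glued at the common monomial, which lies below
    -- `t` unless a piece is trivial.
    have hconn : ∀ a b, Conn O f R t a b →
        ∃ v, ReflTransGen (MStep R) a v ∧ ReflTransGen (MStep R) b v := by
      intro a b hab
      induction hab with
      | rel a b h => exact ⟨b, .single h.1, .refl⟩
      | refl a => exact ⟨a, .refl, .refl⟩
      | symm a b _ ih => obtain ⟨v, h₁, h₂⟩ := ih; exact ⟨v, h₂, h₁⟩
      | trans a b c hab _ ih₁ ih₂ =>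
        rcases Conn.bound hab with rfl | ⟨_, hb⟩
        · exact ih₂
        obtain ⟨v, h₁, h₂⟩ := ih₁
        obtain ⟨w, h₃, h₄⟩ := ih₂
        obtain ⟨z, h₅, h₆⟩ := ih b hb h₂ h₃
        exact ⟨z, h₁.trans h₅, h₄.trans h₆⟩
    rcases h₁.cases_head with rfl | ⟨a, ha, hau⟩
    · exact ⟨u₂, h₂, .refl⟩
    rcases h₂.cases_head with rfl | ⟨b, hb, hbu⟩
    · exact ⟨u₁, .refl, .trans (.single ha) hau⟩
    obtain ⟨v, hav, hbv⟩ : ∃ v, ReflTransGen (MStep R) a v ∧ ReflTransGen (MStep R) b v := by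
      obtain ⟨p, hp, hple, rfl⟩ := ha
      obtain ⟨q, hq, hqle, rfl⟩ := hb
      obtain ⟨Z, hZ, e₁, e₂⟩ := peak_eq hple hqle
      apply hconn
      rw [e₁, e₂, hZ]
      exact (h p hp q hq).add_right Z
    obtain ⟨p, hp₁, hp₂⟩ := ih a (ha.mlt hR) hau hav
    obtain ⟨q, hq₁, hq₂⟩ := ih b (hb.mlt hR) (hbv.trans hp₂) hbu
    exact ⟨q, hp₁.trans hq₁, hq₂⟩

theorem union_eq_add_left {p q : MRule K} : (p.1 ∪ q.1) - p.1 + p.1 = p.1 ∪ q.1 :=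
  tsub_add_cancel_of_le Multiset.le_union_left

theorem critPair_mlt_left {p q : MRule K} (hp : O.mlt f p.2 p.1) :
    O.mlt f (critPair p q).1 (p.1 ∪ q.1) := by
  have := hp.add_right ((p.1 ∪ q.1) - p.1)
  rw [add_comm, add_comm p.1, union_eq_add_left] at this
  rwa [critPair_eq]

theorem critPair_mlt_right {p q : MRule K} (hq : O.mlt f q.2 q.1) :
    O.mlt f (critPair p q).2 (p.1 ∪ q.1) := by
  have := critPair_mlt_left (q := p) hq
  rwa [critPair_swap p q, Multiset.union_comm] at this

theorem Conn.crit_self {E : Set (MRule K)} {L : Multiset K} (p : MRule K) :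
    Conn O f E L (critPair p p).1 (critPair p p).2 := .refl _

theorem Conn.crit_swap {E : Set (MRule K)} {p q : MRule K}
    (h : Conn O f E (p.1 ∪ q.1) (critPair p q).1 (critPair p q).2) :
    Conn O f E (q.1 ∪ p.1) (critPair q p).1 (critPair q p).2 := by
  rw [critPair_swap p q, Multiset.union_comm]
  exact .symm _ _ h

/-- Buchberger's first criterion: disjoint left sides can be replaced in either order, and both
orders end in `p.2 + q.2`. -/
theorem conn_of_disjoint {R E : Set (MRule K)} (hR : MOriented O f R) (hE : R ⊆ E) {p q : MRule K}
    (hp : p ∈ R) (hq : q ∈ R) (h : p.1 ∪ q.1 = p.1 + q.1) :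
    Conn O f E (p.1 ∪ q.1) (critPair p q).1 (critPair p q).2 := by
  have e₁ : (critPair p q).1 = q.1 + p.2 := by rw [critPair_eq, h, add_tsub_cancel_left]
  have e₂ : (critPair p q).2 = p.1 + q.2 := by rw [critPair_eq, h, add_tsub_cancel_right]
  have h₁ := critPair_mlt_left (q := q) (hR p hp)
  have h₂ := critPair_mlt_right (p := p) (hR q hq)
  rw [e₁] at h₁ ⊢
  rw [e₂] at h₂ ⊢
  refine .trans _ (p.2 + q.2) _ (conn_of_msteps hR hE (.single ?_) h₁)
    (.symm _ _ (conn_of_msteps hR hE (.single ?_) h₂))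
  · exact mstep_iff.2 ⟨q, hq, p.2, rfl, add_comm _ _⟩
  · exact mstep_iff.2 ⟨p, hp, q.2, rfl, rfl⟩

theorem singleton_union_eq_add {c : K} {M : Multiset K} (h : c ∉ M) : {c} ∪ M = {c} + M := by
  ext d
  simp only [Multiset.count_union, Multiset.count_add, Multiset.count_singleton]
  by_cases hd : d = c
  · subst hd; simp [Multiset.count_eq_zero_of_notMem h]
  · simp [hd]

/-! ### Rewriting right sides -/

/-- `R₁` arises from `R₀` by rewriting right sides with `R₀`. -/
structure RewritesRight (R₀ R₁ : Set (MRule K)) : Prop where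
  forth : ∀ q ∈ R₀, ∃ m, (q.1, m) ∈ R₁ ∧ ReflTransGen (MStep R₀) q.2 m
  back : ∀ r ∈ R₁, ∃ q ∈ R₀, q.1 = r.1 ∧ ReflTransGen (MStep R₀) q.2 r.2

theorem RewritesRight.oriented {R₀ R₁ : Set (MRule K)} (h : RewritesRight R₀ R₁)
    (hR : MOriented O f R₀) : MOriented O f R₁ := by
  intro r hr
  obtain ⟨q, hq, e, hst⟩ := h.back r hr
  rw [← e]
  rcases msteps_mlt hR hst with e' | h'
  · rw [e']; exact hR q hq
  · exact h'.trans (hR q hq)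

/-- The new rule leads to the rewritten right side. The old right side reaches it by old steps from
monomials smaller than `M`, and these are simulated by induction on `M`. -/
theorem RewritesRight.sim [Finite K] {R₀ R₁ : Set (MRule K)} (h : RewritesRight R₀ R₁)
    (hR : MOriented O f R₀) : Sim O f R₀ R₁ := by
  suffices key : ∀ M N, MStep R₀ M N → ∀ L, O.mlt f M L → Conn O f R₁ L M N from
    fun q hq L Z h₁ _ => key _ _ (mstep_iff.2 ⟨q, hq, Z, rfl, rfl⟩) L h₁
  intro M
  induction M using (O.mlt_wf f).induction with
  | _ M ih =>
    intro N hMN L hL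
    obtain ⟨q, hq, Z, rfl, rfl⟩ := mstep_iff.1 hMN
    obtain ⟨m, hm, hst⟩ := h.forth q hq
    have hR₁ := h.oriented hR
    refine .trans _ (m + Z) _ (conn_of_msteps hR₁ subset_rfl
      (.single (mstep_iff.2 ⟨_, hm, Z, rfl, rfl⟩)) hL) (.symm _ _ ?_)
    have hlt : O.mlt f (q.2 + Z) (q.1 + Z) := hMN.mlt hR
    have hst' := msteps_add_right hst Z
    clear hst hMN
    generalize q.2 + Z = X at hst' hlt
    induction hst' using ReflTransGen.head_induction_on with
    | refl => exact .refl _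
    | head hab _ ihs =>
      exact .trans _ _ _ (ih _ hlt _ hab L (hlt.trans hL)) (ihs ((hab.mlt hR).trans hlt))

/-- Overlaps depend on left sides only. The new components are reached from the old ones by
rewriting, hence below the overlap. -/
theorem RewritesRight.critConn {R₀ R₁ E : Set (MRule K)} (h : RewritesRight R₀ R₁)
    (hR : MOriented O f R₀) (hc : CritConn O f R₀ E) (hE : Sim O f R₀ E) : CritConn O f R₁ E := by
  intro r hr s hs
  obtain ⟨p, hp, e₁, h₁⟩ := h.back r hr
  obtain ⟨q, hq, e₂, h₂⟩ := h.back s hs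
  have hcp := hc p hp q hq
  have hl := critPair_mlt_left (q := q) (hR p hp)
  have hr := critPair_mlt_right (p := p) (hR q hq)
  simp only [critPair_eq, ← e₁, ← e₂] at hcp hl hr ⊢
  refine .trans _ _ _ (.symm _ _ (Conn.sim hE ?_)) (.trans _ _ _ hcp (Conn.sim hE ?_))
  · refine conn_of_msteps hR subset_rfl ?_ hl
    rw [add_comm, add_comm _ r.2]
    exact msteps_add_right h₁ _
  · refine conn_of_msteps hR subset_rfl ?_ hr
    rw [add_comm, add_comm _ s.2]
    exact msteps_add_right h₂ _

theorem RewritesRight.mcon {R₀ R₁ : Set (MRule K)} (h : RewritesRight R₀ R₁) {r : MRule K}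
    (hr : r ∈ R₁) : mcon R₀ r.1 r.2 := by
  obtain ⟨q, hq, e, hst⟩ := h.back r hr
  rw [← e]
  exact (ACC.mcon R₀).trans (mcon_of_mem hq) (msteps_mcon hst)

/-! ### The invariant of completion -/

variable (O f) in
/-- The invariant of completion and update: `R` is a reduced set of rules whose critical pairs are
connected if one may use the pending equations `E`. -/
structure MSys (R E : Set (MRule K)) : Prop where
  finR : R.Finite
  finE : E.Finite
  oriented : MOriented O f R
  neE : ∀ q ∈ E, q.1 ≠ 0 ∧ q.2 ≠ 0
  left : ∀ p ∈ R, ∀ q ∈ R, p.1 ≤ q.1 → p = q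
  right : ∀ p ∈ R, ∀ q ∈ R, ¬ p.1 ≤ q.2
  crit : CritConn O f R (R ∪ E)

theorem MSys.empty {E : Set (MRule K)} (hE : E.Finite) (h : ∀ q ∈ E, q.1 ≠ 0 ∧ q.2 ≠ 0) :
    MSys O f ∅ E :=
  ⟨Set.finite_empty, hE, fun _ h => h.elim, h, fun _ h => h.elim, fun _ h => h.elim,
    fun _ h => h.elim⟩

theorem IsNF.ne_zero {R : Set (MRule K)} (hR : MOriented O f R) {M N : Multiset K}
    (h : IsNF R M N) (hM : M ≠ 0) : N ≠ 0 := by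
  rcases msteps_mlt hR h.1 with rfl | h
  · exact hM
  · exact h.1

theorem sim_of_joinable {R E : Set (MRule K)} (hR : MOriented O f R) (hE : R ⊆ E)
    {M N M' N' : Multiset K} (hM : ReflTransGen (MStep R) M M') (hN : ReflTransGen (MStep R) N N')
    (h : ∀ L Z, O.mlt f (M' + Z) L → O.mlt f (N' + Z) L → Conn O f E L (M' + Z) (N' + Z)) :
    ∀ L Z, O.mlt f (M + Z) L → O.mlt f (N + Z) L → Conn O f E L (M + Z) (N + Z) := by
  intro L Z h₁ h₂
  have hM' := msteps_add_right hM Z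
  have hN' := msteps_add_right hN Z
  refine .trans _ _ _ (conn_of_msteps hR hE hM' h₁)
    (.trans _ _ _ (h L Z ?_ ?_) (.symm _ _ (conn_of_msteps hR hE hN' h₂)))
  · rcases msteps_mlt hR hM' with e | h
    · rwa [e]
    · exact h.trans h₁
  · rcases msteps_mlt hR hN' with e | h
    · rwa [e]
    · exact h.trans h₂

/-- Reducing both sides of the discarded equation to the common normal form replaces any use of it,
below the same bound. -/
theorem MSys.discard {R E E' : Set (MRule K)} (h : MSys O f R E) {e : MRule K} {a : Multiset K}
    (h₁ : IsNF R e.1 a) (h₂ : IsNF R e.2 a) (hsub : E' ⊆ E) (hE : E ⊆ insert e E') :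
    MSys O f R E' ∧ ∀ q ∈ R ∪ E, mcon (R ∪ E') q.1 q.2 := by
  have hsim : Sim O f (R ∪ E) (R ∪ E') := by
    refine .union (.of_subset Set.subset_union_left) ?_
    intro q hq
    rcases hE hq with rfl | hq
    · exact sim_of_joinable h.oriented Set.subset_union_left h₁.1 h₂.1 fun _ _ _ _ => .refl _
    · exact Sim.of_subset Set.subset_union_right q hq
  refine ⟨⟨h.finR, h.finE.subset hsub, h.oriented, fun q hq => h.neE q (hsub hq), h.left, h.right,
    fun p hp q hq => (h.crit p hp q hq).sim hsim⟩, ?_⟩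
  rintro q (hq | hq)
  · exact mcon_of_mem (.inl hq)
  · exact hsim.mcon (.inr hq) (h.neE q hq).1 (h.neE q hq).2

theorem Interreduce.rewritesRight {R R' : Set (MRule K)} {p : MRule K} (h : Interreduce R p R') :
    RewritesRight (insert p (R \ collapsed R p)) R' := by
  obtain ⟨nf, hnf, rfl⟩ := h
  have key : ∀ q ∈ R \ collapsed R p,
      ReflTransGen (MStep (insert p (R \ collapsed R p))) q.2 (nf q) := by
    intro q hq
    by_cases hle : p.1 ≤ q.2
    · exact ((hnf q hq).1 hle).1
    · rw [(hnf q hq).2 hle]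
  constructor
  · rintro q (rfl | hq)
    · exact ⟨_, .inl rfl, .refl⟩
    · exact ⟨nf q, .inr ⟨q, hq, rfl⟩, key q hq⟩
  · rintro r (rfl | ⟨q, hq, rfl⟩)
    · exact ⟨_, .inl rfl, rfl, .refl⟩
    · exact ⟨q, .inr hq, rfl, key q hq⟩

theorem Interreduce.finite {R R' : Set (MRule K)} {p : MRule K} (h : Interreduce R p R')
    (hR : R.Finite) : R'.Finite := by
  obtain ⟨nf, _, rfl⟩ := h
  exact ((hR.subset Set.sdiff_subset).image _).insert _

theorem IsOrient.mlt {a b : Multiset K} {p : MRule K} (h : IsOrient O f a b p) (ha : a ≠ 0)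
    (hb : b ≠ 0) : O.mlt f p.2 p.1 := by
  obtain ⟨h, rfl | rfl⟩ := h
  · exact ⟨hb, ha, h⟩
  · exact ⟨ha, hb, h⟩

theorem exists_isOrient {a b : Multiset K} (ha : a ≠ 0) (hb : b ≠ 0) (h : a ≠ b) :
    ∃ p, IsOrient O f a b p := by
  rcases O.gt_total f a b ha hb h with h | h
  · exact ⟨(a, b), h, .inl rfl⟩
  · exact ⟨(b, a), h, .inr rfl⟩

theorem exists_interreduce [Finite K] {R : Set (MRule K)} (hR : MOriented O f R) {p : MRule K}
    (hp : O.mlt f p.2 p.1) : ∃ R', Interreduce R p R' := by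
  classical
  have hR₀ : MOriented O f (insert p (R \ collapsed R p)) := by
    rintro q (rfl | hq)
    · exact hp
    · exact hR q hq.1
  choose nf hnf using exists_isNF hR₀
  refine ⟨_, fun q => if p.1 ≤ q.2 then nf q.2 else q.2, fun q _ => ⟨fun h => ?_, fun h => ?_⟩, rfl⟩
  · dsimp only; rw [if_pos h]; exact hnf q.2
  · dsimp only; rw [if_neg h]

/-- The data of a step that adds the new rule `p` obtained from the equation `e`. -/
structure AddStep (O : Orderings F K) (f : F.A) (R E : Set (MRule K)) (e p : MRule K)
    (a b : Multiset K) (R' : Set (MRule K)) : Prop where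
  mem : e ∈ E
  nfl : IsNF R e.1 a
  nfr : IsNF R e.2 b
  ne : a ≠ b
  orient : IsOrient O f a b p
  inter : Interreduce R p R'

section AddStep

variable {R E R' : Set (MRule K)} {e p : MRule K} {a b : Multiset K}

theorem AddStep.mlt (hs : AddStep O f R E e p a b R') (h : MSys O f R E) : O.mlt f p.2 p.1 :=
  hs.orient.mlt (hs.nfl.ne_zero h.oriented (h.neE e hs.mem).1)
    (hs.nfr.ne_zero h.oriented (h.neE e hs.mem).2)

/-- Both sides of the new rule were normalized before orientation. -/
theorem AddStep.not_le (hs : AddStep O f R E e p a b R') :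
    ∀ q ∈ R, ¬ q.1 ≤ p.1 ∧ ¬ q.1 ≤ p.2 := by
  intro q hq
  obtain ⟨_, rfl | rfl⟩ := hs.orient
  · exact ⟨hs.nfl.not_le q hq, hs.nfr.not_le q hq⟩
  · exact ⟨hs.nfr.not_le q hq, hs.nfl.not_le q hq⟩

theorem AddStep.oriented₀ (hs : AddStep O f R E e p a b R') (h : MSys O f R E) :
    MOriented O f (insert p (R \ collapsed R p)) := by
  rintro q (rfl | hq)
  · exact hs.mlt h
  · exact h.oriented q hq.1

theorem AddStep.mcon_rule (hs : AddStep O f R E e p a b R') : mcon (R ∪ E) p.1 p.2 := by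
  have h₁ := msteps_mcon (msteps_mono (Set.subset_union_left (t := E)) hs.nfl.1)
  have h₂ := msteps_mcon (msteps_mono (Set.subset_union_left (t := E)) hs.nfr.1)
  have h₃ : mcon (R ∪ E) e.1 e.2 := mcon_of_mem (.inr hs.mem)
  have h₄ := (mcon (R ∪ E)).trans ((mcon (R ∪ E)).symm h₁) ((mcon (R ∪ E)).trans h₃ h₂)
  obtain ⟨_, rfl | rfl⟩ := hs.orient
  · exact h₄
  · exact (mcon (R ∪ E)).symm h₄

theorem AddStep.mcon_new (hs : AddStep O f R E e p a b R') :
    ∀ q ∈ R', mcon (R ∪ E) q.1 q.2 := by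
  intro q hq
  refine mcon_le ?_ (hs.inter.rewritesRight.mcon hq)
  rintro q (rfl | hq)
  · exact hs.mcon_rule
  · exact mcon_of_mem (.inl hq.1)

theorem AddStep.sim [Finite K] (hs : AddStep O f R E e p a b R') (h : MSys O f R E)
    {E' : Set (MRule K)} (hcol : collapsed R p ⊆ E') : Sim O f (insert p R ∪ E') (R' ∪ E') := by
  have hs₀ := (hs.inter.rewritesRight.sim (hs.oriented₀ h)).mono_right
    (Set.subset_union_left (t := E'))
  refine .union ?_ (.of_subset Set.subset_union_right)
  intro q hq
  by_cases hc : q ∈ collapsed R p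
  · exact Sim.of_subset Set.subset_union_right q (hcol hc)
  · refine hs₀ q ?_
    rcases hq with rfl | hq
    · exact .inl rfl
    · exact .inr ⟨hq, hc⟩

theorem AddStep.sim_old [Finite K] (hs : AddStep O f R E e p a b R') (h : MSys O f R E)
    {E' : Set (MRule K)} (hE : E ⊆ insert e E') : Sim O f (R ∪ E) (insert p R ∪ E') := by
  have hR : R ⊆ insert p R ∪ E' := fun q hq => .inl (.inr hq)
  have hp : Sim O f {p} (insert p R ∪ E') := .of_subset (by rintro _ rfl; exact .inl (.inl rfl))
  refine .union (.of_subset hR) ?_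
  intro q hq
  rcases hE hq with rfl | hq
  · refine sim_of_joinable h.oriented hR hs.nfl.1 hs.nfr.1 ?_
    obtain ⟨_, rfl | rfl⟩ := hs.orient
    · exact hp _ rfl
    · exact fun L Z h₁ h₂ => .symm _ _ (hp _ rfl L Z h₂ h₁)
  · exact Sim.of_subset Set.subset_union_right q hq

theorem AddStep.left_right (hs : AddStep O f R E e p a b R') (h : MSys O f R E) :
    (∀ r ∈ R', ∀ s ∈ R', r.1 ≤ s.1 → r = s) ∧ ∀ r ∈ R', ∀ s ∈ R', ¬ r.1 ≤ s.2 := by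
  have hp := hs.mlt h
  have hpl := hs.not_le
  obtain ⟨nf, hnf, rfl⟩ := hs.inter
  constructor
  · rintro r (rfl | ⟨r, hr, rfl⟩) s (rfl | ⟨s, hs, rfl⟩) hle
    · rfl
    · exact absurd ⟨hs.1, hle⟩ hs.2
    · exact absurd hle (hpl r hr.1).1
    · rw [h.left r hr.1 s hs.1 hle]
  · rintro r hr s (rfl | ⟨s, hs, rfl⟩)
    · rcases hr with rfl | ⟨r, hr, rfl⟩
      · exact hp.not_le
      · exact (hpl r hr.1).2
    · by_cases hle : p.1 ≤ s.2
      · have := ((hnf s hs).1 hle).not_le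
        rcases hr with rfl | ⟨r, hr, rfl⟩
        · exact this _ (.inl rfl)
        · exact this r (.inr hr)
      · simp only [(hnf s hs).2 hle]
        rcases hr with rfl | ⟨r, hr, rfl⟩
        · exact hle
        · exact h.right r hr.1 s hs.1

/-- Only overlaps of `p` with old rules are new, and `hcrit` treats them. Those between old rules
are transferred by simulating the old rules and equations: collapsed rules are still pending, and
`e` is subsumed by `p`. Completion and update differ only in how they provide `hcrit`. -/
theorem AddStep.msys [Finite K] (hs : AddStep O f R E e p a b R') (h : MSys O f R E)
    {E' : Set (MRule K)} (hfin : E'.Finite) (hne : ∀ q ∈ E', q.1 ≠ 0 ∧ q.2 ≠ 0)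
    (hcol : collapsed R p ⊆ E') (hE : E ⊆ insert e E')
    (hcrit : ∀ q ∈ R, Conn O f (insert p R ∪ E') (p.1 ∪ q.1) (critPair p q).1 (critPair p q).2) :
    MSys O f R' E' ∧ ∀ q ∈ R ∪ E, mcon (R' ∪ E') q.1 q.2 := by
  have hsim := hs.sim h hcol
  have hsim' := (hs.sim_old h hE).trans hsim
  have hright := hs.inter.rewritesRight
  have hR₀ := hs.oriented₀ h
  refine ⟨⟨hs.inter.finite h.finR, hfin, hright.oriented hR₀, hne, (hs.left_right h).1,
    (hs.left_right h).2, ?_⟩, ?_⟩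
  · refine hright.critConn hR₀ ?_ (hright.sim hR₀ |>.mono_right Set.subset_union_left)
    rintro r (rfl | hr) q (rfl | hq)
    · exact .crit_self _
    · exact (hcrit q hq.1).sim hsim
    · exact ((hcrit r hr.1).sim hsim).crit_swap
    · exact (h.crit r hr.1 q hq.1).sim hsim'
  · rintro q (hq | hq)
    · have := h.oriented q hq
      exact hsim'.mcon (.inl hq) this.2.1 this.1
    · exact hsim'.mcon (.inr hq) (h.neE q hq).1 (h.neE q hq).2

/-! ### The measure -/

/-- The monomials reducible by `R`. -/
def reducibles (R : Set (MRule K)) : Set (Multiset K) := {M | ∃ q ∈ R, q.1 ≤ M}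

/-- A collapsed left side is still reducible by `p`, so nothing is lost; `p.1` itself was
irreducible and is gained. -/
theorem AddStep.reducibles (hs : AddStep O f R E e p a b R') :
    reducibles R ⊂ reducibles R' := by
  have hpl := hs.not_le
  obtain ⟨nf, _, rfl⟩ := hs.inter
  refine ⟨?_, fun hsub => ?_⟩
  · rintro M ⟨q, hq, hle⟩
    by_cases hc : p.1 ≤ q.1
    · exact ⟨p, .inl rfl, hc.trans hle⟩
    · exact ⟨_, .inr ⟨q, ⟨hq, fun h => hc h.2⟩, rfl⟩, hle⟩
  · obtain ⟨q, hq, hle⟩ := hsub ⟨p, .inl rfl, le_rfl⟩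
    exact (hpl q hq).1 hle

end AddStep

/-- Pick a monomial that becomes reducible at each stage. By Dickson's lemma an earlier one is
included in a later one, which was then already reducible before its stage. This is the ascending
chain condition for monomial ideals. -/
theorem reducibles_wf [Finite K] :
    WellFounded fun R' R : Set (MRule K) => reducibles R ⊂ reducibles R' := by
  rw [wellFounded_iff_isEmpty_descending_chain]
  refine ⟨fun ⟨t, ht⟩ => ?_⟩
  have hex : ∀ n, ∃ M, M ∈ reducibles (t (n + 1)) ∧ M ∉ reducibles (t n) :=
    fun n => Set.exists_of_ssubset (ht n)
  choose m hm hm' using hex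
  obtain ⟨i, j, hij, hle⟩ := exists_le_of_seq m
  have hmono : Monotone fun n => reducibles (t n) := monotone_nat_of_le_succ fun n => (ht n).subset
  obtain ⟨q, hq, hqle⟩ := hmono (Nat.succ_le_of_lt hij) (hm i)
  exact hm' j ⟨q, hq, hqle.trans hle⟩

end Monomials

/-! ### Canonicity of good systems through an interpretation by normal forms. -/

section Interpretation

variable {F : Sig.{u, v}} {K : Type w} {O : Orderings F K}

theorem TermStep.closure {E : Set (Term F K × Term F K)} {s t : Term F K} (h : TermStep E s t) :
    Closure E s t := by
  induction h with
  | rule h => exact .of h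
  | app h a i _ ih =>
    refine .app h fun j => ?_
    by_cases hj : j = i
    · subst hj; rw [Function.update_self]; exact ih
    · rw [Function.update_of_ne hj]; exact .refl _
  | acL f t _ ih => exact .ac f ih (.refl _)
  | acR f s _ ih => exact .ac f (.refl _) ih

theorem ClassStep.closure {R : Set (PureEq F K)} {s t : Term F K} (h : ClassStep R s.cls t.cls) :
    Closure (termEqs R) s t := by
  obtain ⟨s', t', hs, ht, h⟩ := h
  exact .trans (.symm (cls_eq.1 hs).closure) (.trans h.closure (cls_eq.1 ht).closure)

theorem classSteps_lift {R : Set (PureEq F K)} (g : Term F K → Term F K)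
    (hg : ∀ s t, ClassStep R s.cls t.cls → ClassStep R (g s).cls (g t).cls)
    (hg' : ∀ s t, ACEq s t → ACEq (g s) (g t)) {s t : Term F K}
    (h : ReflTransGen (ClassStep R) s.cls t.cls) :
    ReflTransGen (ClassStep R) (g s).cls (g t).cls := by
  generalize hx : s.cls = x at h
  generalize hy : t.cls = y at h
  induction h generalizing t with
  | refl => rw [cls_eq.2 (hg' s t (cls_eq.1 (hx.trans hy.symm)))]
  | @tail b c _ h ih =>
    obtain ⟨r, rfl⟩ := exists_cls b
    subst hy
    exact .tail (ih rfl) (hg r t h)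

theorem classSteps_app {R : Set (PureEq F K)} (h : F.U) {a b : Fin (F.ar h) → Term F K}
    (hab : ∀ i, ReflTransGen (ClassStep R) (a i).cls (b i).cls) :
    ReflTransGen (ClassStep R) (Term.app h a).cls (Term.app h b).cls := by
  refine app_rel_of_update (ρ := fun s t => ReflTransGen (ClassStep R) s.cls t.cls)
    (fun _ => .refl) (fun _ _ _ => .trans) h (fun a i t hst => ?_) hab
  have := classSteps_lift (fun t => .app h (Function.update a i t)) (fun s t hst => ?_)
    (fun s t hst' => Closure.app h fun j => ?_) hst
  · simpa using this
  · have := ClassStep.app (R := R) h (Function.update a i s) i (t := t) (by simpa using hst)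
    simpa using this
  · by_cases hj : j = i
    · subst hj; rw [Function.update_self, Function.update_self]; exact hst'
    · rw [Function.update_of_ne hj, Function.update_of_ne hj]; exact .refl _

theorem classSteps_ac {R : Set (PureEq F K)} (f : F.A) {s s' t t' : Term F K}
    (hs : ReflTransGen (ClassStep R) s.cls s'.cls) (ht : ReflTransGen (ClassStep R) t.cls t'.cls) :
    ReflTransGen (ClassStep R) (Term.ac f s t).cls (Term.ac f s' t').cls :=
  .trans
    (classSteps_lift (fun s => .ac f s t) (fun _ _ h => h.acL f t)
      (fun _ _ h => .ac f h (.refl _)) hs)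
    (classSteps_lift (fun t => .ac f s' t) (fun _ _ h => h.acR f s')
      (fun _ _ h => .ac f (.refl _) h) ht)

theorem rep_of_mem {RC : Set (K × K)} (hdet : ∀ {c d d'}, (c, d) ∈ RC → (c, d') ∈ RC → d = d')
    {c d : K} (h : (c, d) ∈ RC) : rep RC c = d := by
  have hex : ∃ d, (c, d) ∈ RC := ⟨d, h⟩
  rw [rep, dif_pos hex]
  exact hdet hex.choose_spec h

theorem rep_of_not_mem {RC : Set (K × K)} {c : K} (h : ∀ d, (c, d) ∉ RC) : rep RC c = c := by
  rw [rep, dif_neg]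
  rintro ⟨d, hd⟩
  exact h d hd

theorem rep_mem_or {RC : Set (K × K)} (c : K) :
    (c, rep RC c) ∈ RC ∨ (rep RC c = c ∧ ∀ d, (c, d) ∉ RC) := by
  by_cases h : ∃ d, (c, d) ∈ RC
  · left; rw [rep, dif_pos h]; exact h.choose_spec
  · right
    have h' : ∀ d, (c, d) ∉ RC := fun d hd => h ⟨d, hd⟩
    exact ⟨rep_of_not_mem h', h'⟩

variable [DecidableEq K]

variable (O) in
/-- A concrete form of the property of being reduced and canonical. -/
structure Good (R : Set (PureEq F K)) : Prop where
  oriented : Oriented O R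
  con_det : ∀ {c d d'}, PureEq.con c d ∈ R → PureEq.con c d' ∈ R → d = d'
  con_irr : ∀ {c d e}, PureEq.con c d ∈ R → PureEq.con d e ∉ R
  flat_arg : ∀ {h a d}, PureEq.flat h a d ∈ R → ∀ i e, PureEq.con (a i) e ∉ R
  flat_rhs : ∀ {h a d}, PureEq.flat h a d ∈ R → ∀ e, PureEq.con d e ∉ R
  flat_det : ∀ {h a d d'}, PureEq.flat h a d ∈ R → PureEq.flat h a d' ∈ R → d = d'
  ac_irr : ∀ {f M N}, PureEq.ac f M N ∈ R → ∀ c, c ∈ M ∨ c ∈ N → ∀ e, PureEq.con c e ∉ R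
  crit : ∀ f, ∀ p ∈ mrules R f, ∀ q ∈ mrules R f,
    ∃ v, ReflTransGen (MStep (mrules R f)) (critPair p q).1 v ∧
      ReflTransGen (MStep (mrules R f)) (critPair p q).2 v
  left : ∀ f, ∀ p ∈ mrules R f, ∀ q ∈ mrules R f, p.1 ≤ q.1 → p = q
  right : ∀ f, ∀ p ∈ mrules R f, ∀ q ∈ mrules R f, ¬ p.1 ≤ q.2

theorem Good.sub {R R' : Set (PureEq F K)} (h : Good O R) (hsub : R' ⊆ R)
    (hm : ∀ f, mrules R' f = mrules R f ∨ mrules R' f = ∅) : Good O R' where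
  oriented := h.oriented.mono hsub
  con_det h₁ h₂ := h.con_det (hsub h₁) (hsub h₂)
  con_irr h₁ h₂ := h.con_irr (hsub h₁) (hsub h₂)
  flat_arg h₁ i e h₂ := h.flat_arg (hsub h₁) i e (hsub h₂)
  flat_rhs h₁ e h₂ := h.flat_rhs (hsub h₁) e (hsub h₂)
  flat_det h₁ h₂ := h.flat_det (hsub h₁) (hsub h₂)
  ac_irr h₁ c hc e h₂ := h.ac_irr (hsub h₁) c hc e (hsub h₂)
  crit f p hp q hq := by
    rcases hm f with e | e <;> rw [e] at hp hq ⊢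
    · exact h.crit f p hp q hq
    · exact hp.elim
  left f p hp q hq := h.left f p (hsub hp) q (hsub hq)
  right f p hp q hq := h.right f p (hsub hp) q (hsub hq)

theorem critConn_of_join {f : F.A} {R : Set (MRule K)} (hR : MOriented O f R)
    (h : ∀ p ∈ R, ∀ q ∈ R, ∃ v, ReflTransGen (MStep R) (critPair p q).1 v ∧
      ReflTransGen (MStep R) (critPair p q).2 v) : CritConn O f R R := by
  intro p hp q hq
  obtain ⟨v, h₁, h₂⟩ := h p hp q hq
  exact .trans _ _ _ (conn_of_msteps hR subset_rfl h₁ (critPair_mlt_left (hR p hp)))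
    (.symm _ _ (conn_of_msteps hR subset_rfl h₂ (critPair_mlt_right (hR q hq))))

/-- Constants in AC rules are irreducible, so overlaps with constant rules are disjoint; two
constant rules with the same left side are equal. Only overlaps of AC rules remain. -/
theorem Good.critConn {R : Set (PureEq F K)} (h : Good O R) (f : F.A) :
    CritConn O f (monoRules R f) (monoRules R f) := by
  have hR := h.oriented.monoRules f
  have hcm : ∀ c d, PureEq.con c d ∈ R → ∀ q ∈ mrules R f,
      Conn O f (monoRules R f) ({c} ∪ q.1) (critPair ({c}, {d}) q).1 (critPair ({c}, {d}) q).2 := by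
    intro c d hcd q hq
    refine conn_of_disjoint hR subset_rfl (.inl (mem_monoC.2 ⟨c, d, hcd, rfl⟩)) (.inr hq) ?_
    exact singleton_union_eq_add fun hc => h.ac_irr hq c (.inl hc) d hcd
  rintro p (hp | hp) q (hq | hq)
  · obtain ⟨c, d, hcd, rfl⟩ := mem_monoC.1 hp
    obtain ⟨c', d', hcd', rfl⟩ := mem_monoC.1 hq
    by_cases hc : c = c'
    · subst hc
      obtain rfl := h.con_det hcd hcd'
      exact .crit_self _
    · exact conn_of_disjoint hR subset_rfl (.inl hp) (.inl hq)
        (singleton_union_eq_add (by simpa using hc))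
  · obtain ⟨c, d, hcd, rfl⟩ := mem_monoC.1 hp
    exact hcm c d hcd q hq
  · obtain ⟨c, d, hcd, rfl⟩ := mem_monoC.1 hq
    exact (hcm c d hcd p hp).crit_swap
  · exact (critConn_of_join (h.oriented.mrules f) (h.crit f) p hp q hq).mono
      Set.subset_union_right

/-- A choice of normal forms of monomials. -/
def NFChoice (R : Set (PureEq F K)) (nf : F.A → Multiset K → Multiset K) : Prop :=
  ∀ f M, IsNF (monoRules R f) M (nf f M)

theorem Good.nf_eq [Finite K] {R : Set (PureEq F K)} (h : Good O R)
    {nf : F.A → Multiset K → Multiset K} (hnf : NFChoice R nf) {f : F.A} {M N L : Multiset K}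
    (h₁ : ReflTransGen (MStep (monoRules R f)) M L)
    (h₂ : ReflTransGen (MStep (monoRules R f)) N L) : nf f M = nf f N := by
  have hR := h.oriented.monoRules f
  have hirr : ∀ {P Q}, (¬ ∃ L, MStep (monoRules R f) P L) →
      ReflTransGen (MStep (monoRules R f)) P Q → P = Q := by
    intro P Q hP hPQ
    rcases hPQ.cases_head with e | ⟨c, hc, _⟩
    · exact e
    · exact absurd ⟨c, hc⟩ hP
  have key : ∀ {P Q}, ReflTransGen (MStep (monoRules R f)) P Q → nf f P = nf f Q := by
    intro P Q hPQ
    obtain ⟨v, hv₁, hv₂⟩ := (h.critConn f).join hR (hnf f P).1 (hPQ.trans (hnf f Q).1)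
    rw [hirr (hnf f P).2 hv₁, hirr (hnf f Q).2 hv₂]
  rw [key h₁, key h₂]

/-- This makes "add, then normalize" an associative operation, which is what the interpretation of
an AC symbol needs. -/
theorem Good.nf_add [Finite K] {R : Set (PureEq F K)} (h : Good O R)
    {nf : F.A → Multiset K → Multiset K} (hnf : NFChoice R nf) (f : F.A) (M N : Multiset K) :
    nf f (M + nf f N) = nf f (M + N) := by
  refine h.nf_eq hnf .refl ?_
  rw [add_comm M N, add_comm M]
  exact msteps_add_right (hnf f N).1 M

theorem Good.rep_irr {R : Set (PureEq F K)} (h : Good O R) (c e : K) :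
    PureEq.con (rep (conPairs R) c) e ∉ R := by
  rcases rep_mem_or (RC := conPairs R) c with h' | ⟨h', h''⟩
  · exact h.con_irr h'
  · rw [h']; exact h'' e

theorem Good.rep_con {R : Set (PureEq F K)} (h : Good O R) {c d : K} (hcd : PureEq.con c d ∈ R) :
    rep (conPairs R) c = d :=
  rep_of_mem (fun h₁ h₂ => h.con_det h₁ h₂) hcd

theorem rep_eq_self {R : Set (PureEq F K)} {c : K} (h : ∀ e, PureEq.con c e ∉ R) :
    rep (conPairs R) c = c := rep_of_not_mem h

theorem Good.nf_singleton [Finite K] {R : Set (PureEq F K)} (h : Good O R)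
    {nf : F.A → Multiset K → Multiset K} (hnf : NFChoice R nf) (f : F.A) (c : K) :
    nf f {c} = {rep (conPairs R) c} := by
  have h₁ : ReflTransGen (MStep (monoRules R f)) {c} {rep (conPairs R) c} := by
    rcases rep_mem_or (RC := conPairs R) c with h' | ⟨h', _⟩
    · exact .single (mstep_iff.2
        ⟨_, .inl (mem_monoC.2 ⟨_, _, h', rfl⟩), 0, by simp, by simp⟩)
    · rw [h']
  rw [h.nf_eq hnf h₁ .refl]
  rcases (hnf f {rep (conPairs R) c}).1.cases_head with e | ⟨M, hM, _⟩
  · exact e.symm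
  · exfalso
    obtain ⟨q, hq | hq, hle, _⟩ := hM
    · obtain ⟨d, e, hde, rfl⟩ := mem_monoC.1 hq
      obtain rfl : rep (conPairs R) c = d := by simpa [eq_comm] using hle
      exact h.rep_irr _ _ hde
    · have h2 := (h.oriented.2 _ _ _ hq).1
      have := Multiset.card_le_card hle
      rw [Multiset.card_singleton] at this
      omega

open Classical in
/-- Normalize the constant part of an `f`-monomial over terms. -/
noncomputable def Term.normBlk (nf : F.A → Multiset K → Multiset K) (f : F.A) (u : Term F K) :
    Term F K :=
  if h : ∃ v : Term F K, v.atoms f = (nf f (u.atoms f).1, (u.atoms f).2) then h.choose else u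

open Classical in
/-- The normal form of a term. -/
noncomputable def Term.interp (R : Set (PureEq F K)) (nf : F.A → Multiset K → Multiset K) :
    Term F K → Term F K
  | .con c => .con (rep (conPairs R) c)
  | .app h a =>
    if hx : ∃ d b, PureEq.flat h b d ∈ R ∧ ∀ i, (a i).interp R nf = .con (b i) then .con hx.choose
    else .app h fun i => (a i).interp R nf
  | .ac f s t => Term.normBlk nf f (.ac f (s.interp R nf) (t.interp R nf))

theorem nf_ne_zero {R : Set (PureEq F K)} (h : Oriented O R)
    {nf : F.A → Multiset K → Multiset K} (hnf : NFChoice R nf) {f : F.A} {M : Multiset K}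
    (hM : M ≠ 0) : nf f M ≠ 0 := (hnf f M).ne_zero (h.monoRules f) hM

/-- The default value in `Term.normBlk` is never used: normalization keeps a nonempty constant part
nonempty, so the normalized atoms do belong to a term. -/
theorem normBlk_atoms {R : Set (PureEq F K)} (h : Oriented O R)
    {nf : F.A → Multiset K → Multiset K} (hnf : NFChoice R nf) (f : F.A) (u : Term F K) :
    (u.normBlk nf f).atoms f = (nf f (u.atoms f).1, (u.atoms f).2) := by
  have hex : ∃ v : Term F K, v.atoms f = (nf f (u.atoms f).1, (u.atoms f).2) := by
    rcases exists_atoms (f := f) (nf f (u.atoms f).1) (u.atoms f).2 (fun x hx => atoms_alien hx)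
      with h0 | h1
    · exfalso
      obtain ⟨h₁, h₂⟩ : nf f (u.atoms f).1 = 0 ∧ (u.atoms f).2 = 0 := by
        simpa [Prod.ext_iff] using h0
      refine atoms_ne_zero f u (Prod.ext ?_ h₂)
      by_contra hne
      exact nf_ne_zero h hnf hne h₁
    · exact h1
  rw [Term.normBlk, dif_pos hex]
  exact hex.choose_spec

theorem interp_ac_atoms {R : Set (PureEq F K)} (h : Oriented O R)
    {nf : F.A → Multiset K → Multiset K} (hnf : NFChoice R nf) (f : F.A) (s t : Term F K) :
    ((Term.ac f s t).interp R nf).atoms f =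
      (nf f (((s.interp R nf).atoms f).1 + ((t.interp R nf).atoms f).1),
        ((s.interp R nf).atoms f).2 + ((t.interp R nf).atoms f).2) := by
  rw [Term.interp, normBlk_atoms h hnf, atoms_ac_self]
  rfl

theorem Good.interp_mono [Finite K] {R : Set (PureEq F K)} (h : Good O R)
    {nf : F.A → Multiset K → Multiset K} (hnf : NFChoice R nf) {f : F.A} {M : Multiset K}
    {s : Term F K} (hs : IsMono f M s) : (s.interp R nf).atoms f = (nf f M, 0) := by
  induction hs with
  | single c => rw [Term.interp, atoms_con, h.nf_singleton hnf]
  | add _ _ ih₁ ih₂ =>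
    rw [interp_ac_atoms h.oriented hnf, ih₁, ih₂, h.nf_add hnf, add_comm, h.nf_add hnf, add_comm]
    rfl

theorem Good.interp_app {R : Set (PureEq F K)} (h : Good O R)
    {nf : F.A → Multiset K → Multiset K} {k : F.U} {a : Fin (F.ar k) → Term F K}
    {b : Fin (F.ar k) → K} {d : K} (hd : PureEq.flat k b d ∈ R)
    (ha : ∀ i, (a i).interp R nf = .con (b i)) : (Term.app k a).interp R nf = .con d := by
  have hex : ∃ d b, PureEq.flat k b d ∈ R ∧ ∀ i, (a i).interp R nf = .con (b i) := ⟨d, b, hd, ha⟩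
  rw [Term.interp, dif_pos hex]
  obtain ⟨b', hb', ha'⟩ := hex.choose_spec
  have : b' = b := by
    funext i
    have := (ha' i).symm.trans (ha i)
    injection this
  subst this
  rw [h.flat_det hb' hd]

theorem interp_app_of_not {R : Set (PureEq F K)}
    {nf : F.A → Multiset K → Multiset K} {k : F.U} {a : Fin (F.ar k) → Term F K}
    (ha : ¬ ∃ d b, PureEq.flat k b d ∈ R ∧ ∀ i, (a i).interp R nf = .con (b i)) :
    (Term.app k a).interp R nf = .app k fun i => (a i).interp R nf := by
  rw [Term.interp, dif_neg ha]

/-- The interpretation is a model of the rules and of the AC axioms. Rules hold because the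
constants in flat rules are already canonical and both sides of an AC rule have the same normal
form; the AC axioms hold by `Good.nf_add`. -/
theorem Good.interp_closure [Finite K] {R : Set (PureEq F K)} (h : Good O R)
    {nf : F.A → Multiset K → Multiset K} (hnf : NFChoice R nf) {s t : Term F K}
    (hst : Closure (termEqs R) s t) : ACEq (s.interp R nf) (t.interp R nf) := by
  induction hst with
  | of hst =>
    obtain ⟨e, he, hd⟩ := hst
    dsimp only at hd
    cases hd with
    | con c d =>
      rw [Term.interp, Term.interp, h.rep_con he, rep_eq_self fun e => h.con_irr he]
      exact .refl _
    | flat k a d =>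
      rw [h.interp_app he fun i => ?_, Term.interp, rep_eq_self (h.flat_rhs he)]
      · exact .refl _
      · rw [Term.interp, rep_eq_self (h.flat_arg he i)]
    | ac f hM hN =>
      rename_i M N
      refine aceq_of_atoms_eq (f := f) ?_
      rw [h.interp_mono hnf hM, h.interp_mono hnf hN]
      rw [h.nf_eq hnf (.single (mstep_iff.2 ⟨(M, N), .inr he, 0, (add_zero _).symm, rfl⟩)) .refl]
      simp
  | refl s => exact .refl _
  | symm _ ih => exact .symm ih
  | trans _ _ ih₁ ih₂ => exact .trans ih₁ ih₂
  | app k _ ih =>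
    rename_i a b _
    -- A constant is AC-equal only to itself, so a flat rule fits both tuples of interpreted
    -- arguments or neither.
    have hiff : ∀ (i : Fin (F.ar k)) (c : K), (a i).interp R nf = .con c → (b i).interp R nf = .con c := by
      intro i c hc
      have := ih i
      rw [hc] at this
      exact ACEq.eq_con (Closure.symm this)
    have hiff' : ∀ (i : Fin (F.ar k)) (c : K), (b i).interp R nf = .con c → (a i).interp R nf = .con c := by
      intro i c hc
      have := ih i
      rw [hc] at this
      exact ACEq.eq_con this
    by_cases hx : ∃ d c, PureEq.flat k c d ∈ R ∧ ∀ i, (a i).interp R nf = .con (c i)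
    · obtain ⟨d, c, hd, hc⟩ := hx
      rw [h.interp_app hd hc, h.interp_app hd fun i => hiff i _ (hc i)]
      exact .refl _
    · rw [interp_app_of_not hx, interp_app_of_not]
      · exact .app k ih
      · rintro ⟨d, c, hd, hc⟩
        exact hx ⟨d, c, hd, fun i => hiff' i _ (hc i)⟩
  | ac f _ _ ih₁ ih₂ =>
    refine aceq_of_atoms_eq (f := f) ?_
    rw [interp_ac_atoms h.oriented hnf, interp_ac_atoms h.oriented hnf, ih₁.atoms_eq f,
      ih₂.atoms_eq f]
  | comm f s t =>
    refine aceq_of_atoms_eq (f := f) ?_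
    rw [interp_ac_atoms h.oriented hnf, interp_ac_atoms h.oriented hnf, add_comm,
      add_comm ((s.interp R nf).atoms f).2]
  | assoc f s t r =>
    refine aceq_of_atoms_eq (f := f) ?_
    rw [interp_ac_atoms h.oriented hnf, interp_ac_atoms h.oriented hnf,
      interp_ac_atoms h.oriented hnf, interp_ac_atoms h.oriented hnf]
    dsimp only
    rw [h.nf_add hnf, add_comm (nf f _), h.nf_add hnf, add_comm (((r.interp R nf).atoms f).1),
      add_assoc, add_assoc]

theorem Good.classSteps_interp [Finite K] {R : Set (PureEq F K)} (h : Good O R)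
    {nf : F.A → Multiset K → Multiset K} (hnf : NFChoice R nf) (s : Term F K) :
    ReflTransGen (ClassStep R) s.cls (s.interp R nf).cls := by
  induction s with
  | con c =>
    rcases rep_mem_or (RC := conPairs R) c with h' | ⟨h', _⟩
    · exact .single (TermStep.classStep (.rule ⟨_, h', .con _ _⟩))
    · rw [Term.interp, h']
  | app k a ih =>
    refine .trans (classSteps_app k ih) ?_
    by_cases hx : ∃ d c, PureEq.flat k c d ∈ R ∧ ∀ i, (a i).interp R nf = .con (c i)
    · obtain ⟨d, c, hd, hc⟩ := hx
      rw [h.interp_app hd hc, funext hc]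
      exact .single (TermStep.classStep (.rule ⟨_, hd, .flat _ _ _⟩))
    · rw [interp_app_of_not hx]
  | ac f s t ih₁ ih₂ =>
    refine .trans (classSteps_ac f ih₁ ih₂) ?_
    rw [Term.interp]
    refine classSteps_of_msteps (f := f) (fun f M N hMN => ?_) (hnf f _).1 rfl
      (normBlk_atoms h.oriented hnf f _)
    obtain ⟨h₁, h₂, _⟩ := h.oriented.2 _ _ _ hMN
    exact ⟨by rintro rfl; simp at h₁, h₂⟩

/-- Two reducts of a term are congruent, hence have the same interpretation modulo AC, and both
rewrite to it. -/
theorem Good.canonical [Finite K] {R : Set (PureEq F K)} (h : Good O R) :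
    Canonical (ClassStep R) := by
  choose nf hnf using fun f => exists_isNF (h.oriented.monoRules f)
  refine ⟨not_exists_chain (classStep_wf h.oriented), fun x y z hy hz => ?_⟩
  obtain ⟨s, rfl⟩ := exists_cls x
  obtain ⟨t, rfl⟩ := exists_cls y
  obtain ⟨r, rfl⟩ := exists_cls z
  refine ⟨_, h.classSteps_interp hnf t, ?_⟩
  rw [cls_eq.2 (h.interp_closure hnf (.trans (.symm hy.closure) hz.closure))]
  exact h.classSteps_interp hnf r

theorem Good.canonical_mrules [Finite K] {R : Set (PureEq F K)} (h : Good O R) (f : F.A) :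
    Canonical (MStep (mrules R f)) :=
  ⟨not_exists_chain (mstep_wf (h.oriented.mrules f)), fun _ _ _ hy hz =>
    (critConn_of_join (h.oriented.mrules f) (h.crit f)).join (h.oriented.mrules f) (.single hy)
      (.single hz)⟩

theorem Oriented.two_le {R : Set (PureEq F K)} (h : Oriented O R) :
    ∀ f M N, PureEq.ac f M N ∈ R → 2 ≤ Multiset.card M :=
  fun f M N hMN => (h.2 f M N hMN).1

theorem Good.reduced {R : Set (PureEq F K)} (h : Good O R) : Reduced R := by
  intro e he s t hd e' he' hne
  have hor : Oriented O {e'} := h.oriented.mono (by rintro _ rfl; exact he')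
  have hcon : ∀ c, (∀ d, PureEq.con c d ≠ e') → ¬ ∃ x, ClassStep {e'} (Term.con c).cls x := by
    rintro c hc ⟨x, hx⟩
    obtain ⟨d, hd, _⟩ := hx.con hor.two_le
    exact hc d hd
  cases hd with
  | con c d =>
    refine ⟨hcon c ?_, hcon d ?_⟩
    · rintro d' rfl
      exact hne (by rw [h.con_det he he'])
    · rintro d' rfl
      exact h.con_irr he he'
  | flat k a d =>
    refine ⟨?_, hcon d ?_⟩
    · rintro ⟨x, hx⟩
      rcases hx.flat hor.two_le with ⟨d', rfl, _⟩ | ⟨i, d', rfl⟩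
      · exact hne (by rw [h.flat_det he he'])
      · exact h.flat_arg he i _ he'
    · rintro d' rfl
      exact h.flat_rhs he _ he'
  | ac f hM hN =>
    rename_i M N
    constructor
    · rintro ⟨x, hx⟩
      obtain ⟨M', _, _, _, q, hq | hq, hle, _⟩ := hx.isMono hor.two_le hM
      · obtain ⟨c, d, rfl, rfl⟩ := mem_monoC.1 hq
        exact h.ac_irr he c (.inl (Multiset.singleton_le.1 hle)) d he'
      · obtain rfl := Set.mem_singleton_iff.1 hq
        have := h.left f q he' (M, N) he hle
        rw [this] at hne
        exact hne rfl
    · rintro ⟨x, hx⟩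
      obtain ⟨M', _, _, _, q, hq | hq, hle, _⟩ := hx.isMono hor.two_le hN
      · obtain ⟨c, d, rfl, rfl⟩ := mem_monoC.1 hq
        exact h.ac_irr he c (.inr (Multiset.singleton_le.1 hle)) d he'
      · obtain rfl := Set.mem_singleton_iff.1 hq
        exact h.right f q he' (M, N) he hle

theorem Good.reducedCanonical [Finite K] {R : Set (PureEq F K)} (h : Good O R) :
    ReducedCanonical O R := ⟨h.oriented, h.reduced, h.canonical⟩

theorem Good.partC {R : Set (PureEq F K)} (h : Good O R) : Good O (partC R) :=
  h.sub (fun _ he => he.1) fun f => .inr (Set.eq_empty_of_forall_notMem fun q hq => by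
    obtain ⟨_, c, d, he⟩ := hq
    cases he)

theorem Good.partU {R : Set (PureEq F K)} (h : Good O R) : Good O (partU R) :=
  h.sub (fun _ he => he.1) fun f => .inr (Set.eq_empty_of_forall_notMem fun q hq => by
    obtain ⟨_, c, d, e, he⟩ := hq
    cases he)

theorem Good.partAC {R : Set (PureEq F K)} (h : Good O R) (f : F.A) : Good O (partAC R f) := by
  refine h.sub (fun _ he => he.1) fun g => ?_
  by_cases hg : g = f
  · subst hg
    exact .inl (Set.ext fun q => ⟨fun hq => hq.1, fun hq => ⟨hq, _, _, rfl⟩⟩)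
  · refine .inr (Set.eq_empty_of_forall_notMem fun q hq => ?_)
    obtain ⟨_, c, d, he⟩ := hq
    cases he
    exact hg rfl

end Interpretation

/-! ### Uniqueness of reduced canonical systems. -/

section Uniqueness

variable {F : Sig.{u, v}} {K : Type w} {O : Orderings F K} [DecidableEq K]

theorem eqvGen_lift {R : Set (PureEq F K)} (g : Term F K → Term F K)
    (hg : ∀ s t, ClassStep R s.cls t.cls → ClassStep R (g s).cls (g t).cls)
    (hg' : ∀ s t, ACEq s t → ACEq (g s) (g t)) {s t : Term F K}
    (h : EqvGen (ClassStep R) s.cls t.cls) : EqvGen (ClassStep R) (g s).cls (g t).cls := by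
  generalize hx : s.cls = x at h
  generalize hy : t.cls = y at h
  induction h generalizing s t with
  | rel x y h => subst hx hy; exact .rel _ _ (hg _ _ h)
  | refl x => rw [cls_eq.2 (hg' s t (cls_eq.1 (hx.trans hy.symm)))]; exact .refl _
  | symm x y _ ih => exact .symm _ _ (ih hy hx)
  | trans x y z _ _ ih₁ ih₂ =>
    obtain ⟨r, hr⟩ := exists_cls y
    exact .trans _ _ _ (ih₁ hx hr) (ih₂ hr hy)

/-- Congruence closure is conversion by rewriting, so for a canonical system congruent terms are
joinable. -/
theorem eqvGen_of_closure {R : Set (PureEq F K)} {s t : Term F K} (h : Closure (termEqs R) s t) :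
    EqvGen (ClassStep R) s.cls t.cls := by
  induction h with
  | of h => exact .rel _ _ (TermStep.classStep (.rule h))
  | refl s => exact .refl _
  | symm _ ih => exact .symm _ _ ih
  | trans _ _ ih₁ ih₂ => exact .trans _ _ _ ih₁ ih₂
  | app h _ ih =>
    refine app_rel_of_update (ρ := fun s t => EqvGen (ClassStep R) s.cls t.cls)
      (fun _ => .refl _) (fun _ _ _ => .trans _ _ _) h (fun a i t hst => ?_) ih
    have := eqvGen_lift (fun t => .app h (Function.update a i t)) (fun s t hst => ?_)
      (fun s t hst' => Closure.app h fun j => ?_) hst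
    · simpa using this
    · have := ClassStep.app (R := R) h (Function.update a i s) i (t := t) (by simpa using hst)
      simpa using this
    · by_cases hj : j = i
      · subst hj; rw [Function.update_self, Function.update_self]; exact hst'
      · rw [Function.update_of_ne hj, Function.update_of_ne hj]; exact .refl _
  | ac f _ _ ih₁ ih₂ =>
    rename_i s s' t t' _ _
    exact .trans _ _ _
      (eqvGen_lift (fun s => .ac f s t) (fun _ _ h => h.acL f t)
        (fun _ _ h => .ac f h (.refl _)) ih₁)
      (eqvGen_lift (fun t => .ac f s' t) (fun _ _ h => h.acR f s')
        (fun _ _ h => .ac f (.refl _) h) ih₂)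
  | comm f s t => rw [cls_eq.2 (.comm f s t)]; exact .refl _
  | assoc f s t r => rw [cls_eq.2 (.assoc f s t r)]; exact .refl _

theorem Canonical.join {R : Set (PureEq F K)} (h : Canonical (ClassStep R)) {s t : Term F K}
    (hst : Closure (termEqs R) s t) :
    ∃ v, ReflTransGen (ClassStep R) s.cls v ∧ ReflTransGen (ClassStep R) t.cls v :=
  join_of_eqvGen (fun _ _ _ => join_of_locallyConfluent (wellFounded_of_not_chain h.1) h.2)
    (eqvGen_of_closure hst)

theorem eq_of_steps_of_irreducible {α : Type*} {r : α → α → Prop} {a b : α}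
    (h : ReflTransGen r a b) (ha : ¬ ∃ c, r a c) : b = a := by
  rcases h.cases_head with e | ⟨c, hc, _⟩
  · exact e.symm
  · exact absurd ⟨c, hc⟩ ha

theorem con_cls_inj {c d : K} (h : (Term.con c : Term F K).cls = (Term.con d).cls) : c = d := by
  have := ACEq.eq_con (cls_eq.1 h)
  injection this

theorem con_steps {R : Set (PureEq F K)} (hR : Oriented O R) {c : K} {x : ACTerm F K}
    (h : ReflTransGen (ClassStep R) (Term.con c).cls x) :
    ∃ d, x = (Term.con d).cls ∧ (d = c ∨ O.gtC c d) := by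
  induction h with
  | refl => exact ⟨c, rfl, .inl rfl⟩
  | tail _ h ih =>
    obtain ⟨d, rfl, hd⟩ := ih
    obtain ⟨e, he, rfl⟩ := h.con hR.two_le
    have := hR.1 _ _ he
    refine ⟨e, rfl, .inr ?_⟩
    rcases hd with rfl | hd
    · exact this
    · exact O.gtC_trans _ _ _ hd this

theorem con_irreducible {R : Set (PureEq F K)} (hR : Oriented O R) {c : K}
    (h : ∀ e, PureEq.con c e ∉ R) : ¬ ∃ x, ClassStep R (Term.con c).cls x := by
  rintro ⟨x, hx⟩
  obtain ⟨d, hd, _⟩ := hx.con hR.two_le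
  exact h d hd

theorem ReducedCanonical.con_rhs {R : Set (PureEq F K)} (hR : ReducedCanonical O R)
    {e : PureEq F K} (he : e ∈ R) {s : Term F K} {d : K} (hd : e.Denotes s (.con d)) (b : K) :
    PureEq.con d b ∉ R := by
  intro hb
  -- Being reduced only excludes other rules. A rule that reduces its own right side would here be
  -- `d → d`, which is not oriented.
  by_cases h : PureEq.con d b = e
  · subst h
    cases hd
    exact O.gtC_irrefl _ (hR.1.1 _ _ hb)
  · exact (hR.2.1 e he _ _ hd _ hb h).2 ⟨_, TermStep.classStep (.rule ⟨_, rfl, .con _ _⟩)⟩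

section Compare

variable {R R' : Set (PureEq F K)}

/-- Given `d → e` in `R'`, the constants `d` and `e` are joinable in `R`. As `d` is irreducible
there, `e` rewrites to `d`, against `d` being the larger one. -/
theorem ReducedCanonical.con_irr_of (hR : ReducedCanonical O R) (hR' : ReducedCanonical O R')
    (hcl : ∀ s t, Closure (termEqs R') s t → Closure (termEqs R) s t) {d : K}
    (hd : ∀ e, PureEq.con d e ∉ R) (e : K) : PureEq.con d e ∉ R' := by
  intro he
  have hgt := hR'.1.1 _ _ he
  obtain ⟨v, h₁, h₂⟩ := hR.2.2.join (hcl _ _ (.of ⟨_, he, .con d e⟩))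
  obtain rfl := eq_of_steps_of_irreducible h₁ (con_irreducible hR.1 hd)
  obtain ⟨b, hb, hb'⟩ := con_steps hR.1 h₂
  obtain rfl := con_cls_inj hb
  rcases hb' with rfl | h
  · exact O.gtC_irrefl _ hgt
  · exact O.gtC_irrefl _ (O.gtC_trans _ _ _ hgt h)

theorem ReducedCanonical.con_sub (hR : ReducedCanonical O R) (hR' : ReducedCanonical O R')
    (hcl : ∀ s t, Closure (termEqs R) s t ↔ Closure (termEqs R') s t) {c d : K}
    (h : PureEq.con c d ∈ R) : PureEq.con c d ∈ R' := by
  have hd := hR.con_irr_of hR' (fun s t => (hcl s t).2) (hR.con_rhs h (.con c d))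
  obtain ⟨v, h₁, h₂⟩ := hR'.2.2.join ((hcl _ _).1 (.of ⟨_, h, .con c d⟩))
  obtain rfl := eq_of_steps_of_irreducible h₂ (con_irreducible hR'.1 hd)
  rcases h₁.cases_head with e | ⟨x, hx, hx'⟩
  · obtain rfl := con_cls_inj e
    exact absurd (hR.1.1 _ _ h) (O.gtC_irrefl _)
  · obtain ⟨b, hb, rfl⟩ := hx.con hR'.1.two_le
    have := eq_of_steps_of_irreducible hx' (con_irreducible hR'.1 (hR'.con_rhs hb (.con c b)))
    rwa [con_cls_inj this]

theorem ReducedCanonical.flat_arg (hR : ReducedCanonical O R) {h : F.U} {a : Fin (F.ar h) → K}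
    {d : K} (he : PureEq.flat h a d ∈ R) (i : Fin (F.ar h)) (b : K) :
    PureEq.con (a i) b ∉ R := by
  intro hb
  refine (hR.2.1 _ he _ _ (.flat h a d) _ hb (by simp)).1 ⟨_, TermStep.classStep
    (.app h _ i (t := .con b) (.rule ⟨_, rfl, .con _ _⟩))⟩

theorem ReducedCanonical.flat_sub (hR : ReducedCanonical O R) (hR' : ReducedCanonical O R')
    (hcl : ∀ s t, Closure (termEqs R) s t ↔ Closure (termEqs R') s t) {h : F.U}
    {a : Fin (F.ar h) → K} {d : K} (he : PureEq.flat h a d ∈ R) : PureEq.flat h a d ∈ R' := by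
  have hd := hR.con_irr_of hR' (fun s t => (hcl s t).2) (hR.con_rhs he (.flat h a d))
  have ha := fun i => hR.con_irr_of hR' (fun s t => (hcl s t).2) (hR.flat_arg he i)
  obtain ⟨v, h₁, h₂⟩ := hR'.2.2.join ((hcl _ _).1 (.of ⟨_, he, .flat h a d⟩))
  obtain rfl := eq_of_steps_of_irreducible h₂ (con_irreducible hR'.1 hd)
  rcases h₁.cases_head with e | ⟨x, hx, hx'⟩
  · cases ACEq.eq_con (cls_eq.1 e)
  · rcases hx.flat hR'.1.two_le with ⟨b, hb, rfl⟩ | ⟨i, b, hb⟩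
    · have := eq_of_steps_of_irreducible hx'
        (con_irreducible hR'.1 (hR'.con_rhs hb (.flat h a b)))
      rwa [con_cls_inj this]
    · exact absurd hb (ha i b)

theorem mono_steps (hR : Oriented O R) {f : F.A} {M : Multiset K} {s : Term F K} {x : ACTerm F K}
    (hs : IsMono f M s) (h : ReflTransGen (ClassStep R) s.cls x) :
    ∃ N t, x = t.cls ∧ IsMono f N t ∧ (N = M ∨ O.mlt f N M) := by
  induction h with
  | refl => exact ⟨M, s, rfl, hs, .inl rfl⟩
  | tail _ h ih =>
    obtain ⟨N, t, rfl, ht, hN⟩ := ih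
    obtain ⟨L, r, rfl, hr, hst⟩ := h.isMono hR.two_le ht
    have := hst.mlt (hR.monoRules f)
    refine ⟨L, r, rfl, hr, .inr ?_⟩
    rcases hN with rfl | hN
    · exact this
    · exact this.trans hN

theorem mono_irreducible (hR : Oriented O R) {f : F.A} {M : Multiset K} {s : Term F K}
    (hs : IsMono f M s) (hc : ∀ c ∈ M, ∀ e, PureEq.con c e ∉ R)
    (hq : ∀ q ∈ mrules R f, ¬ q.1 ≤ M) : ¬ ∃ x, ClassStep R s.cls x := by
  rintro ⟨x, hx⟩
  obtain ⟨M', _, _, _, q, hq' | hq', hle, _⟩ := hx.isMono hR.two_le hs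
  · obtain ⟨c, d, hcd, rfl⟩ := mem_monoC.1 hq'
    exact hc c (Multiset.singleton_le.1 hle) d hcd
  · exact hq q hq' hle

theorem exists_classStep_of_le {f : F.A} (hR : Oriented O R) {q : MRule K}
    (hq : q ∈ monoRules R f) {M : Multiset K} {s : Term F K} (hs : IsMono f M s) (hle : q.1 ≤ M) :
    ∃ x, ClassStep R s.cls x := by
  have hne : ∀ f M N, PureEq.ac f M N ∈ R → M ≠ 0 ∧ N ≠ 0 := fun f M N hMN => by
    obtain ⟨h₁, h₂, _⟩ := hR.2 _ _ _ hMN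
    exact ⟨by rintro rfl; simp at h₁, h₂⟩
  obtain ⟨t, _, ht⟩ := ClassStep.of_mstep hne ⟨q, hq, hle, rfl⟩ (isMono_iff.1 hs)
  exact ⟨_, ht⟩

theorem ReducedCanonical.ac_facts (hR : ReducedCanonical O R) {f : F.A} {M N : Multiset K}
    (he : PureEq.ac f M N ∈ R) :
    (∀ c ∈ M, ∀ e, PureEq.con c e ∉ R) ∧ (∀ c ∈ N, ∀ e, PureEq.con c e ∉ R) ∧
      (∀ q ∈ mrules R f, q.1 ≤ M → q = (M, N)) ∧ ∀ q ∈ mrules R f, ¬ q.1 ≤ N := by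
  obtain ⟨h₂, hN, hgt⟩ := hR.1.2 _ _ _ he
  have hM : M ≠ 0 := by rintro rfl; simp at h₂
  obtain ⟨s, hs⟩ := exists_isMono (F := F) f hM
  obtain ⟨t, ht⟩ := exists_isMono (F := F) f hN
  have hred := hR.2.1 _ he s t (.ac f hs ht)
  have hsub : ∀ e' ∈ R, Oriented O {e'} := fun e' he' => hR.1.mono (by rintro _ rfl; exact he')
  have hcon : ∀ c e, PureEq.con c e ∈ R → (({c}, {e}) : MRule K) ∈ monoRules {PureEq.con c e} f :=
    fun c e _ => .inl (mem_monoC.2 ⟨c, e, rfl, rfl⟩)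
  refine ⟨fun c hc e hce => ?_, fun c hc e hce => ?_, fun q hq hle => ?_, fun q hq hle => ?_⟩
  · exact (hred _ hce (by simp)).1 (exists_classStep_of_le (hsub _ hce) (hcon c e hce) hs
      (Multiset.singleton_le.2 hc))
  · exact (hred _ hce (by simp)).2 (exists_classStep_of_le (hsub _ hce) (hcon c e hce) ht
      (Multiset.singleton_le.2 hc))
  · by_contra hne
    exact (hred _ hq (by simpa [Prod.ext_iff] using hne)).1
      (exists_classStep_of_le (hsub _ hq) (.inr rfl) hs hle)
  · by_cases hqe : q = (M, N)
    · subst hqe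
      exact Orderings.mlt.not_le ⟨hN, hM, hgt⟩ hle
    · exact (hred _ hq (by simpa [Prod.ext_iff] using hqe)).2
        (exists_classStep_of_le (hsub _ hq) (.inr rfl) ht hle)

/-- Otherwise `M` would be irreducible in `R'`, and the smaller monomial `N` would have to rewrite
to it. -/
theorem ReducedCanonical.ac_reducible (hR : ReducedCanonical O R) (hR' : ReducedCanonical O R')
    (hcl : ∀ s t, Closure (termEqs R) s t ↔ Closure (termEqs R') s t) {f : F.A}
    {M N : Multiset K} (he : PureEq.ac f M N ∈ R) : ∃ q ∈ mrules R' f, q.1 ≤ M := by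
  by_contra hno
  have hno : ∀ q ∈ mrules R' f, ¬ q.1 ≤ M := fun q hq hle => hno ⟨q, hq, hle⟩
  obtain ⟨h₂, hN, hgt⟩ := hR.1.2 _ _ _ he
  have hM : M ≠ 0 := by rintro rfl; simp at h₂
  obtain ⟨s, hs⟩ := exists_isMono (F := F) f hM
  obtain ⟨t, ht⟩ := exists_isMono (F := F) f hN
  obtain ⟨v, h₁, h₂⟩ := hR'.2.2.join ((hcl _ _).1 (.of ⟨_, he, .ac f hs ht⟩))
  have hc : ∀ c ∈ M, ∀ e, PureEq.con c e ∉ R' := fun c hc =>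
    hR.con_irr_of hR' (fun s t => (hcl s t).2) ((hR.ac_facts he).1 c hc)
  obtain rfl := eq_of_steps_of_irreducible h₁ (mono_irreducible hR'.1 hs hc hno)
  obtain ⟨L, r, hr, hrL, hL⟩ := mono_steps hR'.1 ht h₂
  obtain rfl := hs.unique hrL (cls_eq.1 hr)
  have hlt : O.mlt f N M := ⟨hN, hM, hgt⟩
  rcases hL with rfl | hL
  · exact hlt.irrefl
  · exact (hlt.trans hL).irrefl

/-- Left sides are minimal reducible monomials: passing from `R` to `R'` and back yields a left side
of `R` inside `M`, which must be `M`. The right sides are congruent and both irreducible in `R'`,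
hence equal. -/
theorem ReducedCanonical.ac_sub (hR : ReducedCanonical O R) (hR' : ReducedCanonical O R')
    (hcl : ∀ s t, Closure (termEqs R) s t ↔ Closure (termEqs R') s t) {f : F.A}
    {M N : Multiset K} (he : PureEq.ac f M N ∈ R) : PureEq.ac f M N ∈ R' := by
  obtain ⟨⟨M₁, N₁⟩, hq, hle⟩ := hR.ac_reducible hR' hcl he
  obtain ⟨_, hcN, hM, hN⟩ := hR.ac_facts he
  obtain ⟨q, hq', hle'⟩ := hR'.ac_reducible hR (fun s t => (hcl s t).symm) hq
  obtain rfl := hM q hq' (hle'.trans hle)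
  obtain rfl : M₁ = M := le_antisymm hle hle'
  obtain ⟨_, hcN₁, _, hN₁⟩ := hR'.ac_facts hq
  obtain ⟨h₂, hN0, hgt⟩ := hR.1.2 _ _ _ he
  obtain ⟨s, hs⟩ := exists_isMono (F := F) f (M := M₁) (by rintro rfl; simp at h₂)
  obtain ⟨t, ht⟩ := exists_isMono (F := F) f hN0
  obtain ⟨r, hr⟩ := exists_isMono (F := F) f (hR'.1.2 _ _ _ hq).2.1
  have hcl' : Closure (termEqs R') t r :=
    .trans (.symm ((hcl _ _).1 (.of ⟨_, he, .ac f hs ht⟩))) (.of ⟨_, hq, .ac f hs hr⟩)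
  obtain ⟨v, h₁, h₂⟩ := hR'.2.2.join hcl'
  -- A left side of `R'` inside `N` would contain a left side of `R`, but `N` is irreducible in `R`.
  have e₁ := eq_of_steps_of_irreducible h₁ (mono_irreducible hR'.1 ht
    (fun c hc => hR.con_irr_of hR' (fun s t => (hcl s t).2) (hcN c hc)) fun q hq hle => ?_)
  · have e₂ := eq_of_steps_of_irreducible h₂ (mono_irreducible hR'.1 hr hcN₁ hN₁)
    rw [ht.unique hr (cls_eq.1 (e₁.symm.trans e₂))]
    exact hq
  · obtain ⟨q', hq', hle'⟩ := hR'.ac_reducible hR (fun s t => (hcl s t).symm) hq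
    exact hN q' hq' (hle'.trans hle)

theorem ReducedCanonical.subset (hR : ReducedCanonical O R) (hR' : ReducedCanonical O R')
    (hcl : ∀ s t, Closure (termEqs R) s t ↔ Closure (termEqs R') s t) : R ⊆ R' := by
  rintro (⟨c, d⟩ | ⟨h, a, d⟩ | ⟨f, M, N⟩) he
  · exact hR.con_sub hR' hcl he
  · exact hR.flat_sub hR' hcl he
  · exact hR.ac_sub hR' hcl he

theorem ReducedCanonical.unique (hR : ReducedCanonical O R) (hR' : ReducedCanonical O R')
    (hcl : ∀ s t, Closure (termEqs R) s t ↔ Closure (termEqs R') s t) : R = R' :=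
  (hR.subset hR' hcl).antisymm (hR'.subset hR fun s t => (hcl s t).symm)

end Compare

end Uniqueness

/-! ### Purifications exist and are conservative. -/

section Purification

variable {F : Sig.{u, v}} {C : Type w} {N : Type x}

theorem Closure.subst {K : Type*} {L : Type*} {S : Set (Term F K × Term F K)}
    {X : Set (Term F L × Term F L)} (g : K → Term F L)
    (hS : ∀ q ∈ S, Closure X (q.1.subst g) (q.2.subst g)) {s t : Term F K} (h : Closure S s t) :
    Closure X (s.subst g) (t.subst g) := by
  induction h with
  | of h => exact hS _ h
  | refl s => exact .refl _
  | symm _ ih => exact .symm ih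
  | trans _ _ ih₁ ih₂ => exact .trans ih₁ ih₂
  | app h _ ih => exact .app h ih
  | ac f _ _ ih₁ ih₂ => exact .ac f ih₁ ih₂
  | comm f s t => exact .comm f _ _
  | assoc f s t r => exact .assoc f _ _ _

theorem ACEq.subst {K : Type*} {L : Type*} (g : K → Term F L) {s t : Term F K} (h : ACEq s t) :
    ACEq (s.subst g) (t.subst g) :=
  Closure.subst g (fun _ h => h.elim) h

/-- The number of symbols of a term other than the AC symbols. -/
def Term.size {K : Type*} : Term F K → ℕ
  | .con _ => 1
  | .app _ a => 1 + ∑ i, (a i).size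
  | .ac _ s t => s.size + t.size

theorem Term.size_pos {K : Type*} (s : Term F K) : 0 < s.size := by
  induction s with
  | con c => exact Nat.one_pos
  | app h a _ => exact Nat.add_pos_left Nat.one_pos _
  | ac f s t ih _ => exact Nat.add_pos_left ih _

theorem ACEq.size_eq {K : Type*} {s t : Term F K} (h : ACEq s t) : s.size = t.size := by
  induction h with
  | of h => exact h.elim
  | refl s => rfl
  | symm _ ih => exact ih.symm
  | trans _ _ ih₁ ih₂ => exact ih₁.trans ih₂
  | app h _ ih => simp [Term.size, ih]
  | ac f _ _ ih₁ ih₂ => simp [Term.size, ih₁, ih₂]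
  | comm f s t => simp [Term.size, add_comm]
  | assoc f s t r => simp [Term.size, add_assoc]

/-- The inclusion of terms over the original constants. -/
abbrev Term.incl (N : Type x) (s : Term F C) : Term F (C ⊕ N) :=
  s.subst fun c => .con (Sum.inl c)

/-- The term that a term over the extended set of constants stands for. -/
abbrev Term.expand (δ : N → Term F C) (s : Term F (C ⊕ N)) : Term F C :=
  s.subst (Sum.elim .con δ)

theorem expand_incl (δ : N → Term F C) (s : Term F C) : (s.incl N).expand δ = s := by
  induction s with
  | con c => rfl
  | app h a ih => exact congrArg (Term.app h) (funext ih)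
  | ac f s t ih₁ ih₂ => exact congrArg₂ (Term.ac f) ih₁ ih₂

variable {S : Set (Term F C × Term F C)} {δ : N → Term F C} {P : Set (PureEq F (C ⊕ N))}

theorem IsPurification.closure_expand (h : IsPurification S δ P) {s t : Term F (C ⊕ N)}
    (hst : Closure (termEqs P) s t) : Closure S (s.expand δ) (t.expand δ) := by
  refine Closure.subst _ (fun q hq => ?_) hst
  rcases h.sound q.1 q.2 hq with h | ⟨r, hr, ⟨h₁, h₂⟩ | ⟨h₁, h₂⟩⟩
  · exact h.closure
  · exact .trans h₁.closure (.trans (.of hr) (.symm h₂.closure))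
  · exact .trans h₁.closure (.trans (.symm (.of hr)) (.symm h₂.closure))

/-- Definitions of new constants are unfolded by induction on the size of the expansion, which is
invariant under AC. Definitions cannot be circular because the arguments of a nonconstant term have
smaller expansions. -/
theorem IsPurification.closure_incl_expand (h : IsPurification S δ P) (s : Term F (C ⊕ N)) :
    Closure (termEqs P) s ((s.expand δ).incl N) := by
  generalize hn : (s.expand δ).size = n
  induction n using Nat.strong_induction_on generalizing s with
  | _ n ih =>
    -- Replacing a new constant by its definition leaves the size unchanged, so the nonconstant
    -- terms of the same size are treated first.
    have key : ∀ s : Term F (C ⊕ N), (s.expand δ).size = n → (∀ c, s ≠ .con c) →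
        Closure (termEqs P) s ((s.expand δ).incl N) := by
      intro s hs hc
      cases s with
      | con c => exact absurd rfl (hc c)
      | app k a =>
        refine .app k fun i => ih _ ?_ (a i) rfl
        rw [← hs]
        simp only [Term.expand, Term.subst, Term.size]
        have := Finset.single_le_sum (f := fun i => ((a i).subst (Sum.elim Term.con δ)).size)
          (fun _ _ => Nat.zero_le _) (Finset.mem_univ i)
        omega
      | ac f s t =>
        have h₁ := (s.expand δ).size_pos
        have h₂ := (t.expand δ).size_pos
        have h₃ : (s.expand δ).size + (t.expand δ).size = n := hs
        exact .ac f (ih _ (by omega) s rfl) (ih _ (by omega) t rfl)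
    by_cases hc : ∀ c, s ≠ .con c
    · exact key s hn hc
    · push Not at hc
      obtain ⟨c | u, rfl⟩ := hc
      · exact .refl _
      · obtain ⟨t, ht, htc, hte⟩ := h.defined u
        have h₁ := key t (hte.size_eq.trans hn) htc
        exact .trans (.symm (.of ht)) (.trans h₁ (hte.subst _).closure)

theorem IsPurification.closure_incl (h : IsPurification S δ P) {s : Term F (C ⊕ N)} {q : Term F C}
    (hs : ACEq (s.expand δ) q) : Closure (termEqs P) s (q.incl N) :=
  .trans (h.closure_incl_expand s) (hs.subst _).closure

theorem IsPurification.closure_iff (h : IsPurification S δ P) (s t : Term F C) :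
    Closure (termEqs P) (s.incl N) (t.incl N) ↔ Closure S s t := by
  constructor
  · intro hst
    have := h.closure_expand hst
    rwa [expand_incl, expand_incl] at this
  · refine Closure.subst _ fun q hq => ?_
    rcases h.complete q hq with hq | ⟨s, t, hst, ⟨h₁, h₂⟩ | ⟨h₁, h₂⟩⟩
    · exact (hq.subst _).closure
    · exact .trans (.symm (h.closure_incl h₁)) (.trans (.of hst) (h.closure_incl h₂))
    · exact .trans (.symm (h.closure_incl h₂)) (.trans (.symm (.of hst)) (h.closure_incl h₁))

/-! ### Existence of purifications -/

/-- The subterms of a term. -/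
def Term.subterms : Term F C → Set (Term F C)
  | .con c => {.con c}
  | .app h a => insert (.app h a) (⋃ i, (a i).subterms)
  | .ac f s t => insert (.ac f s t) (s.subterms ∪ t.subterms)

theorem Term.mem_subterms (s : Term F C) : s ∈ s.subterms := by
  cases s with
  | con c => exact rfl
  | app h a => exact .inl rfl
  | ac f s t => exact .inl rfl

theorem Term.finite_subterms (s : Term F C) : s.subterms.Finite := by
  induction s with
  | con c => exact Set.finite_singleton _
  | app h a ih => exact (Set.finite_iUnion ih).insert _
  | ac f s t ih₁ ih₂ => exact (ih₁.union ih₂).insert _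

theorem Term.subterms_app {s : Term F C} {h : F.U} {a : Fin (F.ar h) → Term F C}
    (hs : Term.app h a ∈ s.subterms) (i : Fin (F.ar h)) : a i ∈ s.subterms := by
  induction s with
  | con c => cases hs
  | app k b ih =>
    rcases hs with hs | hs
    · cases hs
      exact .inr (Set.mem_iUnion.2 ⟨i, (a i).mem_subterms⟩)
    · obtain ⟨j, hj⟩ := Set.mem_iUnion.1 hs
      exact .inr (Set.mem_iUnion.2 ⟨j, ih j hj⟩)
  | ac f s t ih₁ ih₂ =>
    rcases hs with hs | hs | hs
    · cases hs
    · exact .inr (.inl (ih₁ hs))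
    · exact .inr (.inr (ih₂ hs))

theorem Term.subterms_ac {s : Term F C} {f : F.A} {l r : Term F C}
    (hs : Term.ac f l r ∈ s.subterms) : l ∈ s.subterms ∧ r ∈ s.subterms := by
  induction s with
  | con c => cases hs
  | app k b ih =>
    rcases hs with hs | hs
    · cases hs
    · obtain ⟨j, hj⟩ := Set.mem_iUnion.1 hs
      exact ⟨.inr (Set.mem_iUnion.2 ⟨j, (ih j hj).1⟩), .inr (Set.mem_iUnion.2 ⟨j, (ih j hj).2⟩)⟩
  | ac g s t ih₁ ih₂ =>
    rcases hs with hs | hs | hs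
    · cases hs
      exact ⟨.inr (.inl l.mem_subterms), .inr (.inr r.mem_subterms)⟩
    · exact ⟨.inr (.inl (ih₁ hs).1), .inr (.inl (ih₁ hs).2)⟩
    · exact ⟨.inr (.inr (ih₂ hs).1), .inr (.inr (ih₂ hs).2)⟩

/-- The equations that define the new constant `u` as a name of the term `δ u`. -/
def nameEqs (δ : N → Term F C) (u : N) : Set (PureEq F (C ⊕ N)) :=
  {e | (∃ h a b, δ u = .app h a ∧ (∀ i, ACEq (Sum.elim .con δ (b i)) (a i)) ∧
      e = .flat h b (.inr u)) ∨
    ∃ f s t k l, δ u = .ac f s t ∧ ACEq (Sum.elim .con δ k) s ∧ ACEq (Sum.elim .con δ l) t ∧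
      e = .ac f ({k} + {l}) {.inr u}}

theorem nameEqs_finite [Finite C] [Finite N] (δ : N → Term F C) (u : N) :
    (nameEqs δ u).Finite := by
  cases hu : δ u with
  | con c =>
    refine Set.finite_empty.subset ?_
    rintro e (⟨h, a, b, h₁, _⟩ | ⟨f, s, t, k, l, h₁, _⟩) <;> rw [hu] at h₁ <;> cases h₁
  | app h a =>
    refine (Set.finite_range fun b : Fin (F.ar h) → C ⊕ N => PureEq.flat h b (.inr u)).subset ?_
    rintro e (⟨h', a', b, h₁, _, rfl⟩ | ⟨f, s, t, k, l, h₁, _⟩) <;> rw [hu] at h₁ <;> cases h₁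
    exact ⟨b, rfl⟩
  | ac f s t =>
    refine (Set.finite_range fun b : (C ⊕ N) × (C ⊕ N) =>
      (PureEq.ac f ({b.1} + {b.2}) {.inr u} : PureEq F (C ⊕ N))).subset ?_
    rintro e (⟨h', a', b, h₁, _, rfl⟩ | ⟨f', s, t, k, l, h₁, _, _, rfl⟩) <;> rw [hu] at h₁ <;>
      cases h₁
    exact ⟨(k, l), rfl⟩

theorem isPurification_names [Finite C] [Finite N] {S : Set (Term F C × Term F C)}
    (δ : N → Term F C) (hc : ∀ u c, δ u ≠ .con c) (hd : ∀ u u', ACEq (δ u) (δ u') → u = u')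
    (hname : ∀ q ∈ S, (∃ k, ACEq (Sum.elim .con δ k) q.1) ∧ ∃ k, ACEq (Sum.elim .con δ k) q.2)
    (happ : ∀ u h a, δ u = .app h a → ∀ i, ∃ k, ACEq (Sum.elim .con δ k) (a i))
    (hac : ∀ u f s t, δ u = .ac f s t →
      (∃ k, ACEq (Sum.elim .con δ k) s) ∧ ∃ k, ACEq (Sum.elim .con δ k) t) :
    IsPurification S δ ({e | ∃ q ∈ S, ∃ k l, ACEq (Sum.elim .con δ k) q.1 ∧
      ACEq (Sum.elim .con δ l) q.2 ∧ e = .con k l} ∪ ⋃ u, nameEqs δ u) where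
  finite := by
    refine .union ?_ (Set.finite_iUnion (nameEqs_finite δ))
    refine (Set.finite_range fun b : (C ⊕ N) × (C ⊕ N) =>
      (PureEq.con b.1 b.2 : PureEq F (C ⊕ N))).subset ?_
    rintro e ⟨_, _, k, l, _, _, rfl⟩
    exact ⟨(k, l), rfl⟩
  nonempty := by
    rintro f M M' (⟨_, _, k, l, _, _, h⟩ | h)
    · cases h
    · obtain ⟨u, ⟨_, _, _, _, _, h⟩ | ⟨_, _, _, _, _, _, _, _, h⟩⟩ := Set.mem_iUnion.1 h
      · cases h
      · cases h
        simp
  nonconstant := hc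
  distinct := hd
  defined := by
    intro u
    cases hu : δ u with
    | con c => exact absurd hu (hc u c)
    | app h a =>
      choose b hb using happ u h a hu
      refine ⟨.app h fun i => .con (b i), ⟨_, .inr (Set.mem_iUnion.2 ⟨u, .inl ⟨h, a, b, hu, hb, rfl⟩⟩),
        .flat _ _ _⟩, fun c => by simp, .app h hb⟩
    | ac f s t =>
      obtain ⟨⟨k, hk⟩, l, hl⟩ := hac u f s t hu
      refine ⟨.ac f (.con k) (.con l), ⟨_, .inr (Set.mem_iUnion.2 ⟨u, .inr ⟨f, s, t, k, l, hu, hk, hl,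
        rfl⟩⟩), .ac f (.add (.single k) (.single l)) (.single _)⟩, fun c => by simp,
        .ac f hk hl⟩
  sound := by
    rintro s t ⟨e, ⟨q, hq, k, l, hk, hl, rfl⟩ | he, hd⟩
    · cases hd
      exact .inr ⟨q, hq, .inl ⟨hk, hl⟩⟩
    · left
      obtain ⟨u, ⟨h, a, b, hu, hb, rfl⟩ | ⟨f, l, r, k, k', hu, hk, hk', rfl⟩⟩ := Set.mem_iUnion.1 he
      · cases hd
        change ACEq _ (δ u)
        rw [hu]
        exact .app h hb
      · cases hd with
        | ac _ hM hN =>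
          obtain rfl := hN.eq_con
          change ACEq _ (δ u)
          rw [hu]
          exact .trans (ACEq.subst _ (hM.aceq (.add (.single k) (.single k')))) (.ac f hk hk')
  complete := by
    intro q hq
    obtain ⟨⟨k, hk⟩, l, hl⟩ := hname q hq
    exact .inr ⟨.con k, .con l, ⟨_, .inl ⟨q, hq, k, l, hk, hl, rfl⟩, .con k l⟩, .inl ⟨hk, hl⟩⟩

/-- Every nonconstant subterm gets a name. Equations of `S` become equations between names, and
names are defined by their immediate arguments, with AC symbols read as binary. -/
theorem exists_isPurification [Finite C] {S : Set (Term F C × Term F C)} (hS : S.Finite) :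
    ∃ (n : ℕ) (δ : Fin n → Term F C) (P : Set (PureEq F (C ⊕ Fin n))), IsPurification S δ P := by
  let T : Set (Term F C) := ⋃ q ∈ S, (q.1.subterms ∪ q.2.subterms)
  have hT : T.Finite := hS.biUnion fun q _ => q.1.finite_subterms.union q.2.finite_subterms
  -- One name for each class modulo AC, so that different names stand for AC-different terms.
  let Q : Set (ACTerm F C) := Term.cls '' {t ∈ T | ∀ c, t ≠ .con c}
  have hQ : Q.Finite := (hT.subset fun _ h => h.1).image _
  have : Finite Q := hQ
  obtain ⟨n, ⟨e⟩⟩ := Finite.exists_equiv_fin Q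
  choose δ hδ using fun i : Fin n => (e.symm i).2
  have happ : ∀ h a, Term.app h a ∈ T → ∀ i, a i ∈ T := by
    intro h a ha i
    simp only [T, Set.mem_iUnion] at ha ⊢
    obtain ⟨q, hq, ha | ha⟩ := ha
    · exact ⟨q, hq, .inl (Term.subterms_app ha i)⟩
    · exact ⟨q, hq, .inr (Term.subterms_app ha i)⟩
  have hac : ∀ f s t, Term.ac f s t ∈ T → s ∈ T ∧ t ∈ T := by
    intro f s t ha
    simp only [T, Set.mem_iUnion] at ha ⊢
    obtain ⟨q, hq, ha | ha⟩ := ha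
    · exact ⟨⟨q, hq, .inl (Term.subterms_ac ha).1⟩, q, hq, .inl (Term.subterms_ac ha).2⟩
    · exact ⟨⟨q, hq, .inr (Term.subterms_ac ha).1⟩, q, hq, .inr (Term.subterms_ac ha).2⟩
  have hname : ∀ s ∈ T, ∃ k : C ⊕ Fin n, ACEq (Sum.elim .con δ k) s := by
    intro s hs
    by_cases hc : ∀ c, s ≠ .con c
    · refine ⟨.inr (e ⟨s.cls, s, ⟨hs, hc⟩, rfl⟩), cls_eq.1 ?_⟩
      rw [Sum.elim_inr, (hδ _).2, Equiv.symm_apply_apply]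
    · push Not at hc
      obtain ⟨c, rfl⟩ := hc
      exact ⟨.inl c, .refl _⟩
  refine ⟨n, δ, _, isPurification_names δ (fun u => (hδ u).1.2) (fun u u' h => ?_) (fun q hq => ?_)
    (fun u h a hu i => hname _ (happ h a (hu ▸ (hδ u).1.1) i)) (fun u f s t hu => ?_)⟩
  · have := cls_eq.2 h
    rw [(hδ u).2, (hδ u').2] at this
    exact e.symm.injective (Subtype.ext this)
  · refine ⟨hname _ ?_, hname _ ?_⟩ <;> simp only [T, Set.mem_iUnion]
    · exact ⟨q, hq, .inl q.1.mem_subterms⟩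
    · exact ⟨q, hq, .inr q.2.mem_subterms⟩
  · have := hac f s t (hu ▸ (hδ u).1.1)
    exact ⟨hname _ this.1, hname _ this.2⟩

end Purification

/-! ### Canonical systems of constant rules and the uninterpreted part. -/

section Constants

variable {F : Sig.{u, v}} {K : Type w} {O : Orderings F K}

/-- The equivalence relation generated by a set of equations between constants. -/
def eqvSet (E : Set (K × K)) : Set (K × K) := {p | EqvGen (fun a b => (a, b) ∈ E) p.1 p.2}

theorem subset_eqvSet (E : Set (K × K)) : E ⊆ eqvSet E := fun _ hp => .rel _ _ hp

theorem eqvSet_refl {E : Set (K × K)} (c : K) : (c, c) ∈ eqvSet E := EqvGen.refl c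

theorem eqvSet_symm {E : Set (K × K)} {c d : K} (h : (c, d) ∈ eqvSet E) : (d, c) ∈ eqvSet E :=
  EqvGen.symm _ _ h

theorem eqvSet_trans {E : Set (K × K)} {c d e : K} (h : (c, d) ∈ eqvSet E)
    (h' : (d, e) ∈ eqvSet E) : (c, e) ∈ eqvSet E :=
  EqvGen.trans _ _ _ h h'

theorem eqvSet_induction {E : Set (K × K)} {ρ : K → K → Prop} (hρ : Equivalence ρ)
    (h : ∀ p ∈ E, ρ p.1 p.2) {p : K × K} (hp : p ∈ eqvSet E) : ρ p.1 p.2 := by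
  obtain ⟨c, d⟩ := p
  induction (show EqvGen _ c d from hp) with
  | rel c d hcd => exact h (c, d) hcd
  | refl c => exact hρ.refl c
  | symm c d h ih => exact hρ.symm (ih h)
  | trans c d e h₁ h₂ ih₁ ih₂ => exact hρ.trans (ih₁ h₁) (ih₂ h₂)

theorem eqvSet_equivalence (E : Set (K × K)) : Equivalence fun c d => (c, d) ∈ eqvSet E :=
  ⟨eqvSet_refl, eqvSet_symm, eqvSet_trans⟩

theorem eqvSet_le {E E' : Set (K × K)} (h : E ⊆ eqvSet E') : eqvSet E ⊆ eqvSet E' :=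
  fun _ hp => eqvSet_induction (eqvSet_equivalence E') h hp

theorem eqvSet_mono {E E' : Set (K × K)} (h : E ⊆ E') : eqvSet E ⊆ eqvSet E' :=
  eqvSet_le (h.trans (subset_eqvSet E'))

variable (O) in
theorem canonC_congr {E E' : Set (K × K)} (h : eqvSet E = eqvSet E') : canonC O E = canonC O E' := by
  have h' : ∀ c d, EqvGen (fun a b => (a, b) ∈ E) c d ↔ EqvGen (fun a b => (a, b) ∈ E') c d :=
    fun c d => Set.ext_iff.1 h (c, d)
  simp only [canonC, h']

theorem exists_least_of_class [Finite K] (E : Set (K × K)) (c : K) :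
    ∃ d, (c, d) ∈ eqvSet E ∧ ∀ e, (c, e) ∈ eqvSet E → e = d ∨ O.gtC e d := by
  obtain ⟨d, hd, hmin⟩ := O.gtC_wf.has_min {d | (c, d) ∈ eqvSet E} ⟨c, eqvSet_refl c⟩
  refine ⟨d, hd, fun e he => ?_⟩
  by_contra h
  push Not at h
  rcases O.gtC_total e d h.1 with h' | h'
  · exact h.2 h'
  · exact hmin e he h'

variable (O) in
theorem eqvSet_canonC [Finite K] (E : Set (K × K)) : eqvSet (canonC O E) = eqvSet E := by
  refine (eqvSet_le fun p hp => hp.2.1).antisymm (eqvSet_le fun p hp => ?_)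
  have key : ∀ c d, (c, d) ∈ eqvSet E → (∀ e, (c, e) ∈ eqvSet E → e = d ∨ O.gtC e d) →
      (c, d) ∈ eqvSet (canonC O E) := by
    intro c d hcd hd
    by_cases h : c = d
    · subst h; exact eqvSet_refl c
    · exact subset_eqvSet _ ⟨h, hcd, hd⟩
  obtain ⟨d, hd, hmin⟩ := exists_least_of_class (O := O) E p.1
  have hp' : (p.1, p.2) ∈ eqvSet E := subset_eqvSet E hp
  exact eqvSet_trans (key _ _ hd hmin) (eqvSet_symm (key _ _ (eqvSet_trans (eqvSet_symm hp') hd)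
    fun e he => hmin e (eqvSet_trans hp' he)))

variable (O) in
/-- A canonical system of constant rules. -/
def CanonSys (RC : Set (K × K)) : Prop := canonC O RC = RC

theorem canonSys_canonC [Finite K] (E : Set (K × K)) : CanonSys O (canonC O E) :=
  canonC_congr O (eqvSet_canonC O E)

/-- The constant `c` is irreducible. -/
def IrrC (RC : Set (K × K)) (c : K) : Prop := ∀ e, (c, e) ∉ RC

section

variable {RC : Set (K × K)}

theorem CanonSys.gtC (h : CanonSys O RC) {c d : K} (hcd : (c, d) ∈ RC) : O.gtC c d := by
  rw [← h] at hcd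
  exact (hcd.2.2 c (.refl c)).resolve_left hcd.1

theorem CanonSys.irr (h : CanonSys O RC) {c d : K} (hcd : (c, d) ∈ RC) : IrrC RC d := by
  intro e he
  have hde := h.gtC he
  have he' : (c, e) ∈ eqvSet RC :=
    eqvSet_trans (subset_eqvSet _ hcd) (subset_eqvSet _ he)
  rw [← h] at hcd
  rcases hcd.2.2 e he' with h' | h'
  · subst h'; exact O.gtC_irrefl _ hde
  · exact O.gtC_irrefl _ (O.gtC_trans _ _ _ hde h')

/-- Every element of a class other than the least one is the left side of a rule. -/
theorem CanonSys.eq_of_irr [Finite K] (h : CanonSys O RC) {c d : K} (hcd : (c, d) ∈ eqvSet RC)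
    (hc : IrrC RC c) (hd : IrrC RC d) : c = d := by
  obtain ⟨e, he, hmin⟩ := exists_least_of_class (O := O) RC c
  have key : ∀ b, (c, b) ∈ eqvSet RC → IrrC RC b → b = e := by
    intro b hb hirr
    by_contra hne
    refine hirr e ?_
    rw [← h]
    exact ⟨hne, eqvSet_trans (eqvSet_symm hb) he, fun x hx => hmin x (eqvSet_trans hb hx)⟩
  rw [key c (eqvSet_refl c) hc, key d hcd hd]

theorem CanonSys.rep_irr (h : CanonSys O RC) (c : K) : IrrC RC (rep RC c) := by
  rcases rep_mem_or (RC := RC) c with h' | ⟨h', h''⟩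
  · exact h.irr h'
  · rw [h']; exact h''

theorem rep_mem_eqvSet (RC : Set (K × K)) (c : K) : (c, rep RC c) ∈ eqvSet RC := by
  rcases rep_mem_or (RC := RC) c with h' | ⟨h', _⟩
  · exact subset_eqvSet _ h'
  · rw [h']; exact eqvSet_refl c

theorem CanonSys.mem_of_eqvSet [Finite K] (h : CanonSys O RC) {c d : K}
    (hcd : (c, d) ∈ eqvSet RC) (hd : IrrC RC d) (hne : c ≠ d) : (c, d) ∈ RC := by
  have hrep : rep RC c = d :=
    h.eq_of_irr (eqvSet_trans (eqvSet_symm (rep_mem_eqvSet RC c)) hcd) (h.rep_irr c) hd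
  rcases rep_mem_or (RC := RC) c with h' | ⟨h', _⟩
  · rwa [hrep] at h'
  · exact absurd (h'.symm.trans hrep) hne

theorem CanonSys.det [Finite K] (h : CanonSys O RC) {c d d' : K} (h₁ : (c, d) ∈ RC)
    (h₂ : (c, d') ∈ RC) : d = d' :=
  h.eq_of_irr (eqvSet_trans (eqvSet_symm (subset_eqvSet _ h₁)) (subset_eqvSet _ h₂)) (h.irr h₁)
    (h.irr h₂)

/-- The leading component of the termination measure: one new constant equation that is no
consequence enlarges the equivalence strictly. -/
theorem eqvSet_ssubset [Finite K] {X : Set (K × K)} {p : K × K} (hp : p ∈ X)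
    (hp' : p ∉ eqvSet RC) : eqvSet RC ⊂ eqvSet (canonC O (RC ∪ X)) := by
  rw [eqvSet_canonC]
  exact ⟨eqvSet_mono Set.subset_union_left, fun hsub => hp' (hsub (subset_eqvSet _ (.inr hp)))⟩

theorem CanonSys.eqvSet_ssubset_of_ne [Finite K] (h : CanonSys O RC) {X : Set (K × K)}
    (hne : canonC O (RC ∪ X) ≠ RC) : eqvSet RC ⊂ eqvSet (canonC O (RC ∪ X)) := by
  rw [eqvSet_canonC]
  have hsub : eqvSet RC ⊆ eqvSet (RC ∪ X) := eqvSet_mono Set.subset_union_left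
  refine hsub.ssubset_of_ne fun e => hne ?_
  rw [canonC_congr O e.symm]
  exact h

theorem CanonSys.canonC_union_empty (h : CanonSys O RC) : canonC O (RC ∪ ∅) = RC := by
  rw [Set.union_empty]; exact h

end

/-! ### Flat rules -/

variable (O) in
/-- The flat rules `Fl` are deterministic and irreducible by `RC`. -/
def FlatOK (RC : Set (K × K)) (Fl : Set (FlatTerm F K × K)) : Prop :=
  (∀ p ∈ Fl, (∀ i, IrrC RC (p.1.2 i)) ∧ IrrC RC p.2) ∧
    ∀ l d d', (l, d) ∈ Fl → (l, d') ∈ Fl → d = d'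

theorem exists_leastFlat [Finite K] {Fl : Set (FlatTerm F K × K)} {l : FlatTerm F K} {e : K}
    (h : (l, e) ∈ Fl) : ∃ d, (l, d) ∈ leastFlat O Fl := by
  obtain ⟨d, hd, hmin⟩ := O.gtC_wf.has_min {d | (l, d) ∈ Fl} ⟨e, h⟩
  refine ⟨d, hd, fun e he => ?_⟩
  by_contra h
  push Not at h
  rcases O.gtC_total e d h.1 with h' | h'
  · exact h.2 h'
  · exact hmin e he h'

variable {RC : Set (K × K)} {Fl : Set (FlatTerm F K × K)}

theorem renameFlat_irr (h : CanonSys O RC) :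
    ∀ p ∈ renameFlat RC Fl, (∀ i, IrrC RC (p.1.2 i)) ∧ IrrC RC p.2 := by
  rintro p ⟨q, _, rfl⟩
  exact ⟨fun i => h.rep_irr _, h.rep_irr _⟩

/-- Renaming made both constants irreducible, and distinct irreducible constants lie in different
classes. -/
theorem newConst_not_mem [Finite K] (h : CanonSys O RC) :
    ∀ p ∈ newConst O (renameFlat RC Fl), p ∉ eqvSet RC := by
  rintro p ⟨hne, l, h₁, h₂⟩ hp
  exact hne (h.eq_of_irr hp (renameFlat_irr h _ h₁).2 (renameFlat_irr h _ h₂.1).2)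

theorem flatOK_leastFlat (h : CanonSys O RC) : FlatOK RC (leastFlat O (renameFlat RC Fl)) := by
  refine ⟨fun p hp => renameFlat_irr h p hp.1, fun l d d' h₁ h₂ => ?_⟩
  rcases h₁.2 d' h₂.1 with e | h₃
  · exact e.symm
  · rcases h₂.2 d h₁.1 with e | h₄
    · exact e
    · exact absurd (O.gtC_trans _ _ _ h₃ h₄) (O.gtC_irrefl _)

theorem leastFlat_finite (h : Fl.Finite) : (leastFlat O (renameFlat RC Fl)).Finite :=
  (h.image _).subset fun _ hp => hp.1

end Constants

/-! ### Preservation of the congruence closure. -/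

section Systems

variable {F : Sig.{u, v}} {K : Type w} [DecidableEq K]

/-- The set of pure equations with given parts. -/
def sys (RC : Set (K × K)) (Fl : Set (FlatTerm F K × K)) (G : F.A → Set (MRule K)) :
    Set (PureEq F K) :=
  {e | match e with
    | .con c d => (c, d) ∈ RC
    | .flat h a d => (⟨h, a⟩, d) ∈ Fl
    | .ac f M N => (M, N) ∈ G f}

/-- The congruence on `f`-monomials given by a congruence closure. -/
def monoCon (X : Set (Term F K × Term F K)) (f : F.A) : AddCon (Multiset K) where
  r M N := (M = 0 ↔ N = 0) ∧ ∀ s t, IsMono f M s → IsMono f N t → Closure X s t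
  iseqv := by
    refine ⟨fun M => ⟨Iff.rfl, fun s t hs ht => (hs.aceq ht).closure⟩,
      fun h => ⟨h.1.symm, fun s t hs ht => .symm (h.2 t s ht hs)⟩,
      fun {M N L} h h' => ⟨h.1.trans h'.1, fun s t hs ht => ?_⟩⟩
    -- Related monomials agree in being empty, which guarantees a term for the middle monomial; the
    -- empty one has none.
    obtain ⟨r, hr⟩ := exists_isMono (F := F) f (mt h.1.2 hs.ne_zero)
    exact .trans (h.2 s r hs hr) (h'.2 r t hr ht)
  add' := by
    intro M N A B h h'
    refine ⟨by rw [add_eq_zero, add_eq_zero, h.1, h'.1], fun s t hs ht => ?_⟩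
    by_cases hM : M = 0
    · obtain rfl := hM
      obtain rfl := h.1.1 rfl
      rw [zero_add] at hs ht
      exact h'.2 s t hs ht
    by_cases hA : A = 0
    · obtain rfl := hA
      obtain rfl := h'.1.1 rfl
      rw [add_zero] at hs ht
      exact h.2 s t hs ht
    obtain ⟨m, hm⟩ := exists_isMono (F := F) f hM
    obtain ⟨n, hn⟩ := exists_isMono (F := F) f (mt h.1.2 hM)
    obtain ⟨a, ha⟩ := exists_isMono (F := F) f hA
    obtain ⟨b, hb⟩ := exists_isMono (F := F) f (mt h'.1.2 hA)
    exact .trans (hs.aceq (.add hm ha)).closure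
      (.trans (.ac f (h.2 m n hm hn) (h'.2 a b ha hb)) ((IsMono.add hn hb).aceq ht).closure)

theorem monoCon_iff {X : Set (Term F K × Term F K)} {f : F.A} {M N : Multiset K} :
    monoCon X f M N ↔
      (M = 0 ↔ N = 0) ∧ ∀ s t, IsMono f M s → IsMono f N t → Closure X s t := Iff.rfl

theorem monoCon_singleton {X : Set (Term F K × Term F K)} {f : F.A} {c d : K} :
    monoCon X f {c} {d} ↔ Closure X (.con c) (.con d) := by
  rw [monoCon_iff]
  refine ⟨fun h => h.2 _ _ (.single c) (.single d), fun h => ⟨by simp, fun s t hs ht => ?_⟩⟩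
  rw [hs.eq_con, ht.eq_con]
  exact h

/-- The sides of all equations are nonempty monomials. -/
def NE (G : Set (MRule K)) : Prop := ∀ q ∈ G, q.1 ≠ 0 ∧ q.2 ≠ 0

variable {RC RC' : Set (K × K)} {Fl Fl' : Set (FlatTerm F K × K)} {G G' : F.A → Set (MRule K)}

theorem closure_of_sys {X : Set (Term F K × Term F K)}
    (hC : ∀ p ∈ RC, Closure X (.con p.1) (.con p.2))
    (hU : ∀ p ∈ Fl, Closure X (.app p.1.1 fun i => .con (p.1.2 i)) (.con p.2))
    (hA : ∀ f, ∀ q ∈ G f, monoCon X f q.1 q.2) {s t : Term F K}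
    (h : Closure (termEqs (sys RC Fl G)) s t) : Closure X s t := by
  refine Closure.bind ?_ h
  rintro ⟨s, t⟩ ⟨e, he, hd⟩
  dsimp only at hd
  cases hd with
  | con c d => exact hC (c, d) he
  | flat h a d => exact hU (⟨h, a⟩, d) he
  | ac f hM hN => exact (hA f _ he).2 _ _ hM hN

theorem sys_con {c d : K}
    (hcd : (c, d) ∈ eqvSet (RC ∪ ⋃ f, constOf (G f))) :
    Closure (termEqs (sys RC Fl G)) (.con c) (.con d) := by
  refine eqvSet_induction (p := (c, d)) (ρ := fun c d => Closure (termEqs (sys RC Fl G))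
    (.con c) (.con d)) ⟨fun _ => .refl _, .symm, .trans⟩ ?_ hcd
  rintro ⟨c, d⟩ (hp | hp)
  · exact .of ⟨.con c d, hp, .con c d⟩
  · obtain ⟨f, hf⟩ := Set.mem_iUnion.1 hp
    exact .of ⟨.ac f {c} {d}, hf, .ac f (.single c) (.single d)⟩

theorem sys_flat {p : FlatTerm F K × K} (hp : p ∈ Fl) :
    Closure (termEqs (sys RC Fl G)) (.app p.1.1 fun i => .con (p.1.2 i)) (.con p.2) :=
  .of ⟨.flat p.1.1 p.1.2 p.2, hp, .flat _ _ _⟩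

theorem sys_mono (h : ∀ f, NE (G f)) {f : F.A} {M N : Multiset K}
    (hMN : mcon (G f ∪ monoC RC) M N) : monoCon (termEqs (sys RC Fl G)) f M N := by
  refine mcon_le (c := monoCon (termEqs (sys RC Fl G)) f) ?_ hMN
  rintro q (hq | hq)
  · refine ⟨iff_of_false (h f q hq).1 (h f q hq).2, fun s t hs ht => .of ⟨.ac f q.1 q.2, hq, ?_⟩⟩
    exact .ac f hs ht
  · obtain ⟨c, d, hcd, rfl⟩ := mem_monoC.1 hq
    exact monoCon_singleton.2 (.of ⟨.con c d, hcd, .con c d⟩)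

/-- The system has the same congruence closure as the equations `P`. -/
def Pres (P : Set (PureEq F K)) (RC : Set (K × K)) (Fl : Set (FlatTerm F K × K))
    (G : F.A → Set (MRule K)) : Prop :=
  (∀ f, NE (G f)) ∧ ∀ s t, Closure (termEqs (sys RC Fl G)) s t ↔ Closure (termEqs P) s t

/-- With the flat rules unchanged, it suffices that the old and new constant parts, and for each
symbol the old and new monomial parts, derive each other. -/
theorem Pres.step {P : Set (PureEq F K)} (h : Pres P RC Fl G) (hG : ∀ f, NE (G' f))
    (h₁ : RC' ⊆ eqvSet (RC ∪ ⋃ f, constOf (G f))) (h₂ : RC ⊆ eqvSet (RC' ∪ ⋃ f, constOf (G' f)))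
    (h₃ : ∀ f, ∀ q ∈ G' f, mcon (G f ∪ monoC RC) q.1 q.2)
    (h₄ : ∀ f, ∀ q ∈ G f, mcon (G' f ∪ monoC RC') q.1 q.2) : Pres P RC' Fl G' := by
  refine ⟨hG, fun s t => Iff.trans ⟨?_, ?_⟩ (h.2 s t)⟩
  · exact closure_of_sys (fun p hp => sys_con (h₁ hp)) (fun p hp => sys_flat hp)
      (fun f q hq => sys_mono h.1 (h₃ f q hq))
  · exact closure_of_sys (fun p hp => sys_con (h₂ hp)) (fun p hp => sys_flat hp)
      (fun f q hq => sys_mono hG (h₄ f q hq))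

theorem renameFlat_closure {X : Set (Term F K × Term F K)}
    (hX : ∀ p ∈ RC, Closure X (.con p.1) (.con p.2)) {p : FlatTerm F K × K} :
    Closure X (.app p.1.1 fun i => .con (p.1.2 i)) (.con p.2) ↔
      Closure X (.app p.1.1 fun i => .con (rep RC (p.1.2 i))) (.con (rep RC p.2)) := by
  have hrep : ∀ c, Closure X (.con c) (.con (rep RC c)) := fun c => by
    rcases rep_mem_or (RC := RC) c with h' | ⟨h', _⟩
    · exact hX _ h'
    · rw [h']; exact .refl _
  exact ⟨fun h => .trans (.symm (.app _ fun i => hrep _)) (.trans h (hrep _)),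
    fun h => .trans (.app _ fun i => hrep _) (.trans h (.symm (hrep _)))⟩

/-- A flat rule dropped for a smaller right side is recovered from the rule that was kept and the
new constant rule between the two right sides. -/
theorem Pres.flat [Finite K] {O : Orderings F K} {P : Set (PureEq F K)} (h : Pres P RC Fl G) :
    Pres P (canonC O (RC ∪ newConst O (renameFlat RC Fl))) (leastFlat O (renameFlat RC Fl)) G := by
  refine ⟨h.1, fun s t => Iff.trans ⟨?_, ?_⟩ (h.2 s t)⟩
  · have hRC : ∀ p ∈ RC, Closure (termEqs (sys RC Fl G)) (.con p.1) (.con p.2) :=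
      fun p hp => sys_con (subset_eqvSet _ (.inl hp))
    have hren : ∀ p ∈ renameFlat RC Fl,
        Closure (termEqs (sys RC Fl G)) (.app p.1.1 fun i => .con (p.1.2 i)) (.con p.2) := by
      rintro p ⟨q, hq, rfl⟩
      exact (renameFlat_closure hRC).1 (sys_flat hq)
    refine closure_of_sys (fun p hp => ?_) (fun p hp => hren p hp.1)
      (fun f q hq => sys_mono h.1 (mcon_of_mem (.inl hq)))
    refine eqvSet_induction (E := RC ∪ newConst O (renameFlat RC Fl))
      (ρ := fun c d => Closure (termEqs (sys RC Fl G)) (.con c) (.con d))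
      ⟨fun _ => .refl _, .symm, .trans⟩ ?_ hp.2.1
    rintro p (hp | ⟨_, l, h₁, h₂⟩)
    · exact hRC p hp
    · exact .trans (.symm (hren _ h₁)) (hren _ h₂.1)
  · have hnew : ∀ p ∈ RC ∪ newConst O (renameFlat RC Fl),
        Closure (termEqs (sys (canonC O (RC ∪ newConst O (renameFlat RC Fl)))
          (leastFlat O (renameFlat RC Fl)) G)) (.con p.1) (.con p.2) := by
      intro p hp
      have hp' : p ∈ eqvSet (canonC O (RC ∪ newConst O (renameFlat RC Fl))) := by
        rw [eqvSet_canonC]; exact subset_eqvSet _ hp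
      exact sys_con (eqvSet_mono Set.subset_union_left hp')
    refine closure_of_sys (fun p hp => hnew p (.inl hp)) (fun p hp => ?_)
      (fun f q hq => sys_mono h.1 (mcon_of_mem (.inl hq)))
    rw [renameFlat_closure (RC := RC) fun p hp => hnew p (.inl hp)]
    have hmem : ((⟨p.1.1, fun i => rep RC (p.1.2 i)⟩, rep RC p.2) : FlatTerm F K × K) ∈
      renameFlat RC Fl := ⟨p, hp, rfl⟩
    obtain ⟨d, hd⟩ := exists_leastFlat (O := O) hmem
    have hd' := sys_flat (RC := canonC O (RC ∪ newConst O (renameFlat RC Fl))) (G := G) hd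
    by_cases hne : rep RC p.2 = d
    · rw [hne]; exact hd'
    · exact .trans hd' (.symm (hnew (rep RC p.2, d) (.inr ⟨hne, _, hmem, hd⟩)))

end Systems

/-! ### The steps of completion and of the update for one AC symbol. -/

section ACSteps

variable {F : Sig.{u, v}} {K : Type w} {O : Orderings F K} {f : F.A} [DecidableEq K]

theorem eq_singleton_of_le {M : Multiset K} {c : K} (h : M ≤ {c}) (hM : M ≠ 0) : M = {c} :=
  (Multiset.le_singleton.1 h).resolve_left hM

theorem exists_mstep_monoC {RC : Set (K × K)} {M : Multiset K} :
    (∃ L, MStep (monoC RC) M L) ↔ ∃ c ∈ M, ¬ IrrC RC c := by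
  constructor
  · rintro ⟨L, q, hq, hle, _⟩
    obtain ⟨c, d, hcd, rfl⟩ := mem_monoC.1 hq
    exact ⟨c, Multiset.singleton_le.1 hle, fun h => h d hcd⟩
  · rintro ⟨c, hc, h⟩
    rw [IrrC] at h
    push Not at h
    obtain ⟨d, hd⟩ := h
    exact ⟨_, ({c}, {d}), mem_monoC.2 ⟨c, d, hd, rfl⟩, Multiset.singleton_le.2 hc, rfl⟩

theorem singleton_msteps {R : Set (MRule K)} {E : Set (K × K)} (hR : MOriented O f R)
    (hE : constOf R ⊆ eqvSet E) {c : K} {M : Multiset K} (h : ReflTransGen (MStep R) {c} M) :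
    ∃ d, M = {d} ∧ (c, d) ∈ eqvSet E := by
  induction h with
  | refl => exact ⟨c, rfl, eqvSet_refl c⟩
  | tail _ h ih =>
    obtain ⟨d, rfl, hd⟩ := ih
    obtain ⟨q, hq, hle, rfl⟩ := h
    have h₁ := eq_singleton_of_le hle (hR q hq).2.1
    have h₂ := hR q hq
    rw [h₁] at h₂ ⊢
    obtain ⟨e, he⟩ := h₂.eq_singleton
    rw [he, tsub_self, zero_add]
    refine ⟨e, rfl, eqvSet_trans hd (hE ?_)⟩
    obtain ⟨q₁, q₂⟩ := q
    obtain rfl : q₁ = {d} := h₁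
    obtain rfl : q₂ = {e} := he
    exact hq

/-! ### Initialization of the update -/

section UInit

variable {RC : Set (K × K)} {Rf : Set (MRule K)}

theorem mem_stale {q : MRule K} : q ∈ stale RC Rf ↔ q ∈ Rf ∧ ∃ c ∈ q.1, ¬ IrrC RC c := by
  rw [← exists_mstep_monoC]; rfl

theorem kept_irr {q : MRule K} (hq : q ∈ Rf \ stale RC Rf) {c : K} (hc : c ∈ q.1) : IrrC RC c := by
  by_contra h
  exact hq.2 (mem_stale.2 ⟨hq.1, c, hc, h⟩)

variable [Finite K]

/-- A kept rule `c → d` has `c` irreducible and equivalent to `d`, so `RC` would contain `d → c`,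
and the two orientations contradict each other. -/
theorem kept_ne_singleton (hC : CanonSys O RC) (h : MOriented O f Rf)
    (hcon : constOf Rf ⊆ eqvSet RC) {q : MRule K} (hq : q ∈ Rf \ stale RC Rf) (c : K) :
    q.1 ≠ {c} := by
  intro hqc
  have hc : IrrC RC c := kept_irr hq (by rw [hqc]; simp)
  have hlt := h q hq.1
  rw [hqc] at hlt
  obtain ⟨d, hd⟩ := hlt.eq_singleton
  rw [hd] at hlt
  have hcd : (c, d) ∈ eqvSet RC := by
    apply hcon
    have := hq.1
    rwa [← Prod.mk.eta (p := q), hqc, hd] at this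
  have hgt := Orderings.mlt_singleton.1 hlt
  have hdc : (d, c) ∈ RC := hC.mem_of_eqvSet (eqvSet_symm hcd) hc
    (by rintro rfl; exact O.gtC_irrefl _ hgt)
  exact O.gtC_irrefl _ (O.gtC_trans _ _ _ hgt (hC.gtC hdc))

theorem UInit.rewritesRight {σ : UState K} (hσ : UInit RC Rf σ) :
    RewritesRight (monoC RC ∪ (Rf \ stale RC Rf)) σ.R := by
  obtain ⟨nf, hnf, rfl⟩ := hσ
  constructor
  · rintro q (hq | hq)
    · exact ⟨q.2, .inl hq, .refl⟩
    · exact ⟨nf q, .inr ⟨q, hq, rfl⟩, (hnf q hq).1⟩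
  · rintro r (hr | ⟨q, hq, rfl⟩)
    · exact ⟨r, .inl hr, rfl, .refl⟩
    · exact ⟨q, .inr hq, rfl, (hnf q hq).1⟩

theorem kept_oriented (hC : CanonSys O RC) (h : MOriented O f Rf) :
    MOriented O f (monoC RC ∪ (Rf \ stale RC Rf)) := by
  rintro q (hq | hq)
  · exact monoC_oriented (fun p hp => hC.gtC hp) q hq
  · exact h q hq.1

/-- Kept left sides contain no reducible constant, so they are disjoint from left sides of constant
rules. Connections between kept rules may use stale rules, which are pending. -/
theorem kept_critConn (hC : CanonSys O RC) (h : MSys O f Rf ∅) :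
    CritConn O f (monoC RC ∪ (Rf \ stale RC Rf))
      ((monoC RC ∪ (Rf \ stale RC Rf)) ∪ stale RC Rf) := by
  have hR := kept_oriented hC h.oriented
  have hsub := Set.subset_union_left (s := monoC RC ∪ (Rf \ stale RC Rf)) (t := stale RC Rf)
  have hcm : ∀ c d, (c, d) ∈ RC → ∀ q ∈ Rf \ stale RC Rf,
      Conn O f ((monoC RC ∪ (Rf \ stale RC Rf)) ∪ stale RC Rf) ({c} ∪ q.1)
        (critPair ({c}, {d}) q).1 (critPair ({c}, {d}) q).2 := by
    intro c d hcd q hq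
    refine conn_of_disjoint hR hsub (.inl (mem_monoC.2 ⟨c, d, hcd, rfl⟩)) (.inr hq) ?_
    exact singleton_union_eq_add fun hc => kept_irr hq hc d hcd
  rintro p (hp | hp) q (hq | hq)
  · obtain ⟨c, d, hcd, rfl⟩ := mem_monoC.1 hp
    obtain ⟨c', d', hcd', rfl⟩ := mem_monoC.1 hq
    by_cases hc : c = c'
    · subst hc
      obtain rfl := hC.det hcd hcd'
      exact .crit_self _
    · exact conn_of_disjoint hR hsub (.inl hp) (.inl hq)
        (singleton_union_eq_add (by simpa using hc))
  · obtain ⟨c, d, hcd, rfl⟩ := mem_monoC.1 hp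
    exact hcm c d hcd q hq
  · obtain ⟨c, d, hcd, rfl⟩ := mem_monoC.1 hq
    exact (hcm c d hcd p hp).crit_swap
  · refine (h.crit p hp.1 q hq.1).mono ?_
    rintro r (hr | hr)
    · by_cases hs : r ∈ stale RC Rf
      · exact .inr hs
      · exact .inl (.inr ⟨hr, hs⟩)
    · exact hr.elim

theorem UInit.left_right (hC : CanonSys O RC) (h : MSys O f Rf ∅)
    (hcon : constOf Rf ⊆ eqvSet RC) {σ : UState K} (hσ : UInit RC Rf σ) :
    (∀ r ∈ σ.R, ∀ s ∈ σ.R, r.1 ≤ s.1 → r = s) ∧ ∀ r ∈ σ.R, ∀ s ∈ σ.R, ¬ r.1 ≤ s.2 := by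
  have hns := fun {q} (hq : q ∈ Rf \ stale RC Rf) {c} =>
    kept_ne_singleton hC h.oriented hcon hq c
  have hright := hσ.rewritesRight
  obtain ⟨nf, hnf, rfl⟩ := hσ
  constructor
  · rintro r (hr | ⟨r, hr, rfl⟩) s (hs | ⟨s, hs, rfl⟩) hle
    · obtain ⟨c, d, hcd, rfl⟩ := mem_monoC.1 hr
      obtain ⟨c', d', hcd', rfl⟩ := mem_monoC.1 hs
      obtain rfl : c = c' := by simpa using hle
      rw [hC.det hcd hcd']
    · obtain ⟨c, d, hcd, rfl⟩ := mem_monoC.1 hr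
      exact absurd hcd (kept_irr hs (Multiset.singleton_le.1 hle) d)
    · obtain ⟨c', d', hcd', rfl⟩ := mem_monoC.1 hs
      exact absurd (eq_singleton_of_le hle (h.oriented r hr.1).2.1) (hns hr)
    · rw [h.left r hr.1 s hs.1 hle]
  · rintro r hr s (hs | ⟨s, hs, rfl⟩) hle
    · obtain ⟨c, d, hcd, rfl⟩ := mem_monoC.1 hs
      rcases hr with hr | ⟨r, hr, rfl⟩
      · obtain ⟨c', d', hcd', rfl⟩ := mem_monoC.1 hr
        obtain rfl : c' = d := by simpa using hle
        exact hC.irr hcd d' hcd'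
      · exact hns hr (eq_singleton_of_le hle (h.oriented r hr.1).2.1)
    · obtain ⟨q, hq, e, _⟩ := hright.back r hr
      exact (hnf s hs).not_le q hq (by rw [e]; exact hle)

/-- The clause that each constant reducible by `RC` is a left side persists through the update
(`AddStep.left_singleton`). It shows at each step that new constant rules are not consequences of
`RC`, and at the end that the rules use canonical constants. -/
theorem UInit.msys (hC : CanonSys O RC) (h : MSys O f Rf ∅) (hcon : constOf Rf ⊆ eqvSet RC)
    {σ : UState K} (hσ : UInit RC Rf σ) :
    MSys O f σ.R (σ.S ∪ σ.T) ∧ constOf σ.R ⊆ eqvSet RC ∧ (∀ p ∈ RC, ∃ m, ({p.1}, m) ∈ σ.R) ∧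
      (∀ q ∈ σ.R ∪ (σ.S ∪ σ.T), mcon (Rf ∪ monoC RC) q.1 q.2) ∧
      (∀ q ∈ Rf, mcon (σ.R ∪ (σ.S ∪ σ.T)) q.1 q.2) ∧ σ.NR = ∅ := by
  have hright := hσ.rewritesRight
  have hlr := hσ.left_right hC h hcon
  have hR := kept_oriented hC h.oriented
  have hsimR := hright.sim hR
  have hsub : monoC RC ∪ (Rf \ stale RC Rf) ⊆ Rf ∪ monoC RC :=
    Set.union_subset Set.subset_union_right fun q hq => .inl hq.1
  have hmc := fun {q} (hq : q ∈ σ.R) => mcon_mono hsub (hright.mcon hq)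
  have hns := fun {q} (hq : q ∈ Rf \ stale RC Rf) {c} =>
    kept_ne_singleton hC h.oriented hcon hq c
  obtain ⟨nf, hnf, rfl⟩ := hσ
  dsimp only at *
  rw [Set.union_empty]
  have hsim : Sim O f ((monoC RC ∪ (Rf \ stale RC Rf)) ∪ stale RC Rf)
      ((monoC RC ∪ (fun q => (q.1, nf q)) '' (Rf \ stale RC Rf)) ∪ stale RC Rf) :=
    .union (hsimR.mono_right Set.subset_union_left) (.of_subset Set.subset_union_right)
  refine ⟨⟨?_, ?_, hright.oriented hR, ?_, hlr.1, hlr.2, ?_⟩, ?_, ?_, ?_, ?_, rfl⟩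
  · exact ((Set.toFinite RC).image _).union ((h.finR.subset Set.sdiff_subset).image _)
  · exact h.finR.subset fun q hq => hq.1
  · exact fun q hq => ⟨(h.oriented q hq.1).2.1, (h.oriented q hq.1).1⟩
  · exact hright.critConn hR (fun p hp q hq => (kept_critConn hC h p hp q hq).sim hsim)
      (hsimR.mono_right Set.subset_union_left)
  · rintro ⟨c, d⟩ (hcd | ⟨q, hq, e⟩)
    · obtain ⟨c', d', h', e⟩ := mem_monoC.1 hcd
      simp only [Prod.mk.injEq, Multiset.singleton_inj] at e
      rw [e.1, e.2]
      exact subset_eqvSet _ h'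
    · exact absurd (congrArg Prod.fst e) (hns hq)
  · exact fun p hp => ⟨{p.2}, .inl (mem_monoC.2 ⟨_, _, hp, rfl⟩)⟩
  · rintro q (hq | hq)
    · exact hmc hq
    · exact mcon_of_mem (.inl hq.1)
  · intro q hq
    refine hsim.mcon ?_ (h.oriented q hq).2.1 (h.oriented q hq).1
    by_cases hs : q ∈ stale RC Rf
    · exact .inr hs
    · exact .inl (.inr ⟨hq, hs⟩)

theorem exists_uinit (hC : CanonSys O RC) (h : MOriented O f Rf) : ∃ σ, UInit RC Rf σ := by
  choose nf hnf using exists_isNF (kept_oriented hC h)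
  exact ⟨_, fun q => nf q.2, fun q _ => hnf q.2, rfl⟩

end UInit

/-! ### Steps of completion -/

/-- All constants of the monomial are irreducible. -/
def IrrM (RC : Set (K × K)) (M : Multiset K) : Prop := ∀ c ∈ M, IrrC RC c

/-- All constants of the rules are irreducible. -/
def IrrSys (RC : Set (K × K)) (R : Set (MRule K)) : Prop := ∀ q ∈ R, IrrM RC q.1 ∧ IrrM RC q.2

variable {RC : Set (K × K)}

theorem IrrM.add {M N : Multiset K} (h : IrrM RC M) (h' : IrrM RC N) : IrrM RC (M + N) :=
  fun c hc => (Multiset.mem_add.1 hc).elim (h c) (h' c)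

theorem IrrM.of_le {M N : Multiset K} (h : IrrM RC N) (hle : M ≤ N) : IrrM RC M :=
  fun c hc => h c (Multiset.mem_of_le hle hc)

theorem IrrM.union {M N : Multiset K} (h : IrrM RC M) (h' : IrrM RC N) : IrrM RC (M ∪ N) :=
  fun c hc => (Multiset.mem_union.1 hc).elim (h c) (h' c)

theorem IrrM.msteps {R : Set (MRule K)} (hR : IrrSys RC R) {M N : Multiset K} (hM : IrrM RC M)
    (h : ReflTransGen (MStep R) M N) : IrrM RC N := by
  induction h with
  | refl => exact hM
  | tail _ h ih =>
    obtain ⟨q, hq, _, rfl⟩ := h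
    exact (ih.of_le tsub_le_self).add (hR q hq).2

theorem IrrM.critPair {p q : MRule K} (hp : IrrM RC p.1 ∧ IrrM RC p.2)
    (hq : IrrM RC q.1 ∧ IrrM RC q.2) :
    IrrM RC (critPair p q).1 ∧ IrrM RC (critPair p q).2 := by
  rw [critPair_eq]
  exact ⟨((hp.1.union hq.1).of_le tsub_le_self).add hp.2,
    ((hp.1.union hq.1).of_le tsub_le_self).add hq.2⟩

theorem critPair_ne_zero {p q : MRule K} (hp : O.mlt f p.2 p.1) (hq : O.mlt f q.2 q.1) :
    (critPair p q).1 ≠ 0 ∧ (critPair p q).2 ≠ 0 :=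
  ⟨(critPair_mlt_left hp).1, (critPair_mlt_right hq).1⟩

theorem AddStep.irrSys {R E R' : Set (MRule K)} {e p : MRule K} {a b : Multiset K}
    (hs : AddStep O f R E e p a b R') (hR : IrrSys RC R) (hE : IrrSys RC E) :
    (IrrM RC p.1 ∧ IrrM RC p.2) ∧ IrrSys RC R' := by
  have hp : IrrM RC p.1 ∧ IrrM RC p.2 := by
    have ha := IrrM.msteps hR (hE e hs.mem).1 hs.nfl.1
    have hb := IrrM.msteps hR (hE e hs.mem).2 hs.nfr.1
    obtain ⟨_, rfl | rfl⟩ := hs.orient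
    · exact ⟨ha, hb⟩
    · exact ⟨hb, ha⟩
  have hR₀ : IrrSys RC (insert p (R \ collapsed R p)) := by
    rintro q (rfl | hq)
    · exact hp
    · exact hR q hq.1
  refine ⟨hp, fun r hr => ?_⟩
  obtain ⟨q, hq, e, hst⟩ := hs.inter.rewritesRight.back r hr
  exact ⟨e ▸ (hR₀ q hq).1, IrrM.msteps hR₀ (hR₀ q hq).2 hst⟩

variable [Finite K]

theorem CompStep.msys {σ σ' : Set (MRule K) × Set (MRule K)} (hst : CompStep O f σ σ')
    (h : MSys O f σ.1 σ.2) (hirr : IrrSys RC (σ.1 ∪ σ.2)) :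
    MSys O f σ'.1 σ'.2 ∧ IrrSys RC (σ'.1 ∪ σ'.2) ∧
      (∀ q ∈ σ'.1 ∪ σ'.2, mcon (σ.1 ∪ σ.2) q.1 q.2) ∧
      (∀ q ∈ σ.1 ∪ σ.2, mcon (σ'.1 ∪ σ'.2) q.1 q.2) ∧
      (reducibles σ.1 ⊂ reducibles σ'.1 ∨ σ'.1 = σ.1 ∧ σ'.2.ncard < σ.2.ncard) := by
  cases hst with
  | @discard R T e a he h₁ h₂ =>
    have hsub : T \ {e} ⊆ T := Set.sdiff_subset
    obtain ⟨hm, hmc⟩ := h.discard h₁ h₂ hsub (by rw [Set.insert_sdiff_singleton]; exact Set.subset_insert _ _)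
    refine ⟨hm, fun q hq => hirr q (Set.union_subset_union_right _ hsub hq), fun q hq => ?_, hmc,
      .inr ⟨rfl, Set.ncard_sdiff_singleton_lt_of_mem he h.finE⟩⟩
    exact mcon_of_mem (Set.union_subset_union_right _ hsub hq)
  | @add R R' T e p a b he h₁ h₂ hne hor hint =>
    have hs : AddStep O f R T e p a b R' := ⟨he, h₁, h₂, hne, hor, hint⟩
    have hR : IrrSys RC R := fun q hq => hirr q (.inl hq)
    have hT : IrrSys RC T := fun q hq => hirr q (.inr hq)
    obtain ⟨hp, hR'⟩ := hs.irrSys hR hT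
    have hmlt := hs.mlt h
    have := hs.msys h (E' := (T \ {e}) ∪ critPair p '' R ∪ collapsed R p) ?_ ?_
      Set.subset_union_right ?_ ?_
    · obtain ⟨hm, hmc⟩ := this
      refine ⟨hm, ?_, ?_, hmc, .inl hs.reducibles⟩
      · rintro q (hq | (hq | ⟨q, hq, rfl⟩) | hq)
        · exact hR' q hq
        · exact hT q hq.1
        · exact IrrM.critPair hp (hR q hq)
        · exact hR q hq.1
      · rintro q (hq | (hq | ⟨q, hq, rfl⟩) | hq)
        · exact hs.mcon_new q hq
        · exact mcon_of_mem (.inr hq.1)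
        · refine mcon_le (E := insert p R) ?_ (critPair_mcon (.inl rfl) (.inr hq))
          rintro r (rfl | hr)
          · exact hs.mcon_rule
          · exact mcon_of_mem (.inl hr)
        · exact mcon_of_mem (.inl hq.1)
    · exact ((h.finE.subset Set.sdiff_subset).union (h.finR.image _)).union
        (h.finR.subset fun q hq => hq.1)
    · rintro q ((hq | ⟨q, hq, rfl⟩) | hq)
      · exact h.neE q hq.1
      · exact critPair_ne_zero hmlt (h.oriented q hq)
      · exact ⟨(h.oriented q hq.1).2.1, (h.oriented q hq.1).1⟩
    · intro q hq
      by_cases hqe : q = e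
      · exact .inl hqe
      · exact .inr (.inl (.inl ⟨hq, hqe⟩))
    · intro q hq
      -- The critical pair is itself pending, so one step with it in the empty context connects its
      -- ends, and both lie below the overlap.
      refine .rel _ _ ⟨mstep_iff.2 ⟨critPair p q, .inr (.inl (.inr ⟨q, hq, rfl⟩)), 0, by simp, by simp⟩,
        critPair_mlt_left hmlt, critPair_mlt_right (h.oriented q hq)⟩

theorem exists_addStep {R E : Set (MRule K)} (h : MSys O f R E) {e : MRule K} (he : e ∈ E) :
    (∃ a, IsNF R e.1 a ∧ IsNF R e.2 a) ∨ ∃ p a b R', AddStep O f R E e p a b R' := by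
  obtain ⟨a, ha⟩ := exists_isNF h.oriented e.1
  obtain ⟨b, hb⟩ := exists_isNF h.oriented e.2
  by_cases hab : a = b
  · subst hab; exact .inl ⟨a, ha, hb⟩
  · have ha0 := ha.ne_zero h.oriented (h.neE e he).1
    have hb0 := hb.ne_zero h.oriented (h.neE e he).2
    obtain ⟨p, hp⟩ := exists_isOrient (O := O) (f := f) ha0 hb0 hab
    obtain ⟨R', hR'⟩ := exists_interreduce h.oriented (hp.mlt ha0 hb0)
    exact .inr ⟨p, a, b, R', he, ha, hb, hab, hp, hR'⟩

theorem exists_compStep {R T : Set (MRule K)} (h : MSys O f R T) (hT : T.Nonempty) :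
    ∃ σ', CompStep O f (R, T) σ' := by
  obtain ⟨e, he⟩ := hT
  rcases exists_addStep h he with ⟨a, h₁, h₂⟩ | ⟨p, a, b, R', hs⟩
  · exact ⟨_, .discard he h₁ h₂⟩
  · exact ⟨_, .add he hs.nfl hs.nfr hs.ne hs.orient hs.inter⟩

/-! ### Steps of the update -/

/-- A constant right side can be rewritten only by constant rules, so interreduction stays within
the equivalence they generate. -/
theorem AddStep.constOf {R E R' : Set (MRule K)} {e p : MRule K} {a b : Multiset K}
    (hs : AddStep O f R E e p a b R') (h : MSys O f R E) {X Y : Set (K × K)}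
    (hX : ACC.constOf R ⊆ eqvSet X) (hXY : X ⊆ Y) (hp : ACC.constOf {p} ⊆ Y) :
    ACC.constOf R' ⊆ eqvSet Y := by
  have hR₀ : ACC.constOf (insert p (R \ collapsed R p)) ⊆ eqvSet Y := by
    rintro ⟨c, d⟩ (hcd | hcd)
    · exact subset_eqvSet _ (hp hcd)
    · exact eqvSet_mono hXY (hX hcd.1)
  rintro ⟨c, d⟩ hcd
  obtain ⟨⟨q₁, q₂⟩, hq, e, hst⟩ := hs.inter.rewritesRight.back _ hcd
  obtain rfl : q₁ = {c} := e
  obtain ⟨b, rfl⟩ := (hs.oriented₀ h _ hq).eq_singleton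
  obtain ⟨d', hd, hbd⟩ := singleton_msteps (hs.oriented₀ h) hR₀ hst
  obtain rfl : d = d' := by simpa using hd
  exact eqvSet_trans (hR₀ hq) hbd

/-- A rule with constant left side never collapses: the new left side would have to be that same
constant, but it is in normal form. -/
theorem AddStep.left_singleton {R E R' : Set (MRule K)} {e p : MRule K} {a b : Multiset K}
    (hs : AddStep O f R E e p a b R') (h : MSys O f R E) {c : K} {m : Multiset K}
    (hc : ({c}, m) ∈ R) : ∃ m', ({c}, m') ∈ R' := by
  have hnc : ({c}, m) ∉ collapsed R p := by
    rintro ⟨_, hle⟩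
    have := eq_singleton_of_le hle (hs.mlt h).2.1
    exact (hs.not_le _ hc).1 this.ge
  obtain ⟨m', hm', _⟩ := hs.inter.rewritesRight.forth _ (.inr ⟨hc, hnc⟩)
  exact ⟨m', hm'⟩

theorem AddStep.mem_new {R E R' : Set (MRule K)} {e p : MRule K} {a b : Multiset K}
    (hs : AddStep O f R E e p a b R') : p ∈ R' := by
  obtain ⟨nf, _, rfl⟩ := hs.inter
  exact .inl rfl

variable (O f) in
/-- What a step of the update preserves and decreases. -/
structure UStepSpec (X : Set (K × K)) (σ σ' : UState K) : Prop where
  msys : MSys O f σ'.R (σ'.S ∪ σ'.T)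
  back : ∀ q ∈ σ'.R ∪ (σ'.S ∪ σ'.T), mcon (σ.R ∪ (σ.S ∪ σ.T)) q.1 q.2
  forth : ∀ q ∈ σ.R ∪ (σ.S ∪ σ.T), mcon (σ'.R ∪ (σ'.S ∪ σ'.T)) q.1 q.2
  const : constOf σ'.R ⊆ eqvSet (X ∪ σ'.NR)
  left : ∀ c, (∃ m, ({c}, m) ∈ σ.R) → ∃ m, ({c}, m) ∈ σ'.R
  mono : σ.NR ⊆ σ'.NR
  new : ∀ p ∈ σ'.NR, p ∈ σ.NR ∨
    p ∈ constOf σ'.R ∧ p.1 ≠ p.2 ∧ ∀ q ∈ σ.R, ¬ q.1 ≤ {p.1} ∧ ¬ q.1 ≤ {p.2}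
  measure : reducibles σ.R ⊂ reducibles σ'.R ∨ σ'.R = σ.R ∧
    (σ'.T.ncard < σ.T.ncard ∨ σ'.T = σ.T ∧ σ'.S.ncard < σ.S.ncard)

theorem UStep.spec {X : Set (K × K)} {σ σ' : UState K} (hst : UStep O f σ σ')
    (h : MSys O f σ.R (σ.S ∪ σ.T)) (hX : constOf σ.R ⊆ eqvSet (X ∪ σ.NR)) :
    UStepSpec O f X σ σ' := by
  cases hst with
  | @discard R S T NR e a he h₁ h₂ =>
    have hsub : S \ {e} ∪ T ⊆ S ∪ T := Set.union_subset_union_left _ Set.sdiff_subset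
    obtain ⟨hm, hmc⟩ := h.discard h₁ h₂ hsub (by
      rintro q (hq | hq)
      · by_cases hqe : q = e
        · exact .inl hqe
        · exact .inr (.inl ⟨hq, hqe⟩)
      · exact .inr (.inr hq))
    exact ⟨hm, fun q hq => mcon_of_mem (Set.union_subset_union_right _ hsub hq), hmc, hX,
      fun _ h => h, subset_rfl, fun _ h => .inl h, .inr ⟨rfl, .inr ⟨rfl,
        Set.ncard_sdiff_singleton_lt_of_mem he (h.finE.subset Set.subset_union_left)⟩⟩⟩
  | @next R T NR hT =>
    have e : (∅ ∪ T : Set (MRule K)) = T ∪ ∅ := Set.union_comm _ _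
    refine ⟨e ▸ h, fun q hq => mcon_of_mem (e ▸ hq), fun q hq => mcon_of_mem (e ▸ hq), hX,
      fun _ h => h, subset_rfl, fun _ h => .inl h, .inr ⟨rfl, .inl ?_⟩⟩
    -- The size of `T` precedes that of `S` in the measure, so emptying `T` outweighs the growth of
    -- `S`.
    rw [Set.ncard_empty]
    exact (Set.ncard_pos (h.finE.subset Set.subset_union_right)).2 hT
  | @add R R' S T NR e p a b nf₁ nf₂ he h₁ h₂ hne hor hnf hint =>
    have hs : AddStep O f R (S ∪ T) e p a b R' := ⟨.inl he, h₁, h₂, hne, hor, hint⟩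
    have hmlt := hs.mlt h
    have hcp := fun {q} (hq : q ∈ R) => critPair_ne_zero hmlt (h.oriented q hq)
    have := hs.msys h (E' := (S \ {e}) ∪
        (T ∪ {x | ∃ q ∈ R, nf₁ q ≠ nf₂ q ∧ x = (nf₁ q, nf₂ q)} ∪ collapsed R p)) ?_ ?_
        (fun q hq => .inr (.inr hq)) ?_ ?_
    · obtain ⟨hm, hmc⟩ := this
      refine ⟨hm, ?_, hmc, ?_, ?_, Set.subset_union_left, ?_, .inl hs.reducibles⟩
      · rintro q (hq | hq | (hq | ⟨q, hq, _, rfl⟩) | hq)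
        · exact hs.mcon_new q hq
        · exact mcon_of_mem (.inr (.inl hq.1))
        · exact mcon_of_mem (.inr (.inr hq))
        · have hins : ∀ r ∈ insert p R, mcon (R ∪ (S ∪ T)) r.1 r.2 := by
            rintro r (rfl | hr)
            · exact hs.mcon_rule
            · exact mcon_of_mem (.inl hr)
          have hR : R ⊆ insert p R := Set.subset_insert _ _
          refine mcon_le (E := insert p R) hins ((mcon _).trans ((mcon _).symm ?_)
            ((mcon _).trans (critPair_mcon (.inl rfl) (.inr hq)) ?_))
          · exact msteps_mcon (msteps_mono hR (hnf q hq).1.1)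
          · exact msteps_mcon (msteps_mono hR (hnf q hq).2.1)
        · exact mcon_of_mem (.inl hq.1)
      · exact hs.constOf h hX (Set.union_subset_union_right _ Set.subset_union_left)
          (fun x hx => .inr (.inr hx))
      · rintro c ⟨m, hcm⟩
        exact hs.left_singleton h hcm
      · rintro ⟨c, d⟩ (hx | hx)
        · exact .inl hx
        · obtain rfl : ({c}, {d}) = p := hx
          refine .inr ⟨hs.mem_new, fun hcd => ?_, hs.not_le⟩
          obtain rfl : c = d := hcd
          exact hmlt.irrefl
    · refine ((h.finE.subset Set.subset_union_left).subset Set.sdiff_subset).union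
        (((h.finE.subset Set.subset_union_right).union ?_).union (h.finR.subset fun q hq => hq.1))
      refine (h.finR.image fun q => (nf₁ q, nf₂ q)).subset ?_
      rintro x ⟨q, hq, _, rfl⟩
      exact ⟨q, hq, rfl⟩
    · rintro q (hq | (hq | ⟨q, hq, _, rfl⟩) | hq)
      · exact h.neE q (.inl hq.1)
      · exact h.neE q (.inr hq)
      · exact ⟨(hnf q hq).1.ne_zero h.oriented (hcp hq).1,
          (hnf q hq).2.ne_zero h.oriented (hcp hq).2⟩
      · exact ⟨(h.oriented q hq.1).2.1, (h.oriented q hq.1).1⟩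
    · rintro q (hq | hq)
      · by_cases hqe : q = e
        · exact .inl hqe
        · exact .inr (.inl ⟨hq, hqe⟩)
      · exact .inr (.inr (.inl (.inl hq)))
    · intro q hq
      -- Both components descend to their normal forms below the overlap; these are equal or form a
      -- pending equation.
      have := sim_of_joinable (O := O) (f := f) (E := insert p R ∪ ((S \ {e}) ∪
        (T ∪ {x | ∃ q ∈ R, nf₁ q ≠ nf₂ q ∧ x = (nf₁ q, nf₂ q)} ∪ collapsed R p)))
        h.oriented (fun _ hr => .inl (.inr hr)) (hnf q hq).1.1 (hnf q hq).2.1 ?_ (p.1 ∪ q.1) 0 ?_ ?_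
      · rwa [add_zero, add_zero] at this
      · by_cases heq : nf₁ q = nf₂ q
        · rw [heq]
          exact fun _ _ _ _ => .refl _
        · refine Sim.of_subset (O := O) (f := f) (E := {(nf₁ q, nf₂ q)}) ?_ _ rfl
          rintro _ rfl
          exact .inr (.inr (.inl (.inr ⟨q, hq, heq, rfl⟩)))
      · rw [add_zero]; exact critPair_mlt_left hmlt
      · rw [add_zero]; exact critPair_mlt_right (h.oriented q hq)

theorem exists_uStep {σ : UState K} (h : MSys O f σ.R (σ.S ∪ σ.T))
    (hne : ¬ (σ.S = ∅ ∧ σ.T = ∅)) : ∃ σ', UStep O f σ σ' := by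
  obtain ⟨R, S, T, NR⟩ := σ
  by_cases hS : S = ∅
  · subst hS
    exact ⟨_, .next (Set.nonempty_iff_ne_empty.2 fun hT => hne ⟨rfl, hT⟩)⟩
  · obtain ⟨e, he⟩ := Set.nonempty_iff_ne_empty.2 hS
    rcases exists_addStep h (.inl he) with ⟨a, h₁, h₂⟩ | ⟨p, a, b, R', hs⟩
    · exact ⟨_, .discard he h₁ h₂⟩
    · choose nf hnf using exists_isNF h.oriented
      exact ⟨_, .add (nf₁ := fun q => nf (critPair p q).1) (nf₂ := fun q => nf (critPair p q).2) he
        hs.nfl hs.nfr hs.ne hs.orient (fun q _ => ⟨hnf _, hnf _⟩) hs.inter⟩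

end ACSteps

/-! ### Closure preservation when one part of the system changes. -/

section PresSteps

variable {F : Sig.{u, v}} {K : Type w} [DecidableEq K] {P : Set (PureEq F K)}
  {RC RC' : Set (K × K)} {Fl : Set (FlatTerm F K × K)} {G G' : F.A → Set (MRule K)}

theorem Pres.const (h : Pres P RC Fl G) (h₁ : RC' ⊆ eqvSet (RC ∪ ⋃ f, constOf (G f)))
    (h₂ : RC ⊆ eqvSet (RC' ∪ ⋃ f, constOf (G f))) : Pres P RC' Fl G :=
  h.step h.1 h₁ h₂ (fun _ _ hq => mcon_of_mem (.inl hq)) (fun _ _ hq => mcon_of_mem (.inl hq))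

theorem Pres.modify (h : Pres P RC Fl G) {f : F.A} (hG : ∀ g, g ≠ f → G' g = G g) (hne : NE (G' f))
    (h₁ : ∀ q ∈ G' f, mcon (G f ∪ monoC RC) q.1 q.2)
    (h₂ : ∀ q ∈ G f, mcon (G' f ∪ monoC RC) q.1 q.2) : Pres P RC Fl G' := by
  refine h.step (fun g => ?_) (fun p hp => subset_eqvSet _ (.inl hp))
    (fun p hp => subset_eqvSet _ (.inl hp)) (fun g => ?_) (fun g => ?_)
  · by_cases hg : g = f
    · subst hg; exact hne
    · rw [hG g hg]; exact h.1 g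
  · by_cases hg : g = f
    · subst hg; exact h₁
    · rw [hG g hg]; exact fun q hq => mcon_of_mem (.inl hq)
  · by_cases hg : g = f
    · subst hg; exact h₂
    · rw [hG g hg]; exact fun q hq => mcon_of_mem (.inl hq)

theorem mcon_map_rep (RC : Set (K × K)) (M : Multiset K) :
    mcon (monoC RC) M (M.map (rep RC)) := by
  induction M using Multiset.induction with
  | empty => exact (mcon _).refl _
  | cons c M ih =>
    rw [Multiset.map_cons, ← Multiset.singleton_add, ← Multiset.singleton_add]
    refine (mcon _).add ?_ ih
    rcases rep_mem_or (RC := RC) c with h | ⟨h, _⟩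
    · exact mcon_of_mem (q := ({c}, {rep RC c})) (mem_monoC.2 ⟨_, _, h, rfl⟩)
    · rw [h]; exact (mcon _).refl _

end PresSteps

/-! ### Invariant, termination and progress of the combination algorithm. -/

section Algorithm

variable {F : Sig.{u, v}} {K : Type w} [DecidableEq K]

/-- The constants of `R` are irreducible, except for left sides that are constants. -/
def Clean (RC : Set (K × K)) (R : Set (MRule K)) : Prop :=
  ∀ q ∈ R, IrrM RC q.2 ∧ ∀ c ∈ q.1, ¬ IrrC RC c → q.1 = {c}

theorem IrrSys.clean {RC : Set (K × K)} {R : Set (MRule K)} (h : IrrSys RC R) : Clean RC R :=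
  fun q hq => ⟨(h q hq).2, fun c hc hn => absurd ((h q hq).1 c hc) hn⟩

variable (O : Orderings F K) (P : Set (PureEq F K))

/-- The invariant of a system of constant and flat rules. -/
structure BaseInv (RC : Set (K × K)) (Fl : Set (FlatTerm F K × K)) : Prop where
  canon : CanonSys O RC
  fin : Fl.Finite

/-- The invariant of the systems for the AC symbols in the main loop. -/
structure LoopInv (RC : Set (K × K)) (todo : Set F.A) (NN : Set (K × K)) (g : F.A)
    (Rg : Set (MRule K)) : Prop where
  msys : MSys O g Rg ∅
  old : g ∈ todo → constOf Rg ⊆ eqvSet RC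
  done : g ∉ todo → constOf Rg ⊆ eqvSet (RC ∪ NN) ∧ Clean RC Rg

open Classical in
/-- The equations and rules for the AC symbols in the first loop. -/
noncomputable def loopG (todo : Set F.A) (R : F.A → Set (MRule K)) (f : F.A) : Set (MRule K) :=
  if f ∈ todo then mrules P f else R f

/-- The invariant of the state returned by the algorithm. -/
structure HaltInv (RC : Set (K × K)) (Fl : Set (FlatTerm F K × K)) (R : F.A → Set (MRule K)) :
    Prop where
  base : BaseInv O RC Fl
  flat : FlatOK RC Fl
  pres : Pres P RC Fl R
  msys : ∀ f, MSys O f (R f) ∅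
  const : ∀ f, constOf (R f) ⊆ eqvSet RC
  clean : ∀ f, Clean RC (R f)

variable [DecidableEq F.A]

/-- The invariant of the algorithm. -/
def Inv : State F K → Prop
  | .cc RC Fl => BaseInv O RC Fl ∧ Pres P RC Fl (mrules P)
  | .loopComp RC Fl todo R => BaseInv O RC Fl ∧ FlatOK RC Fl ∧ Pres P RC Fl (loopG P todo R) ∧
      ∀ g, g ∉ todo → MSys O g (R g) ∅ ∧ IrrSys RC (R g)
  | .comp RC Fl todo R f σ => BaseInv O RC Fl ∧ FlatOK RC Fl ∧
      Pres P RC Fl (Function.update (loopG P todo R) f (σ.1 ∪ σ.2)) ∧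
      (∀ g, g ∉ todo → g ≠ f → MSys O g (R g) ∅ ∧ IrrSys RC (R g)) ∧
      f ∉ todo ∧ MSys O f σ.1 σ.2 ∧ IrrSys RC (σ.1 ∪ σ.2)
  | .updU RC Fl R => BaseInv O RC Fl ∧ Pres P RC Fl R ∧
      ∀ g, MSys O g (R g) ∅ ∧ constOf (R g) ⊆ eqvSet RC
  | .loopUpd RC Fl todo R NN => BaseInv O RC Fl ∧ FlatOK RC Fl ∧ Pres P (RC ∪ NN) Fl R ∧
      (∀ p ∈ NN, p ∉ eqvSet RC) ∧ ∀ g, LoopInv O RC todo NN g (R g)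
  | .updAC RC Fl todo R NN f σ => BaseInv O RC Fl ∧ FlatOK RC Fl ∧
      Pres P (RC ∪ (NN ∪ σ.NR)) Fl (Function.update R f (σ.R ∪ (σ.S ∪ σ.T))) ∧
      (∀ p ∈ NN ∪ σ.NR, p ∉ eqvSet RC) ∧ (∀ g, g ≠ f → LoopInv O RC todo NN g (R g)) ∧
      f ∉ todo ∧ MSys O f σ.R (σ.S ∪ σ.T) ∧ constOf σ.R ⊆ eqvSet (RC ∪ σ.NR) ∧
      ∀ p ∈ RC, ∃ m, ({p.1}, m) ∈ σ.R
  | .halt RC Fl R => HaltInv O P RC Fl R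

variable {O P} [Finite K]

theorem MSys.ne {f : F.A} {R E : Set (MRule K)} (h : MSys O f R E) : NE (R ∪ E) := by
  rintro q (hq | hq)
  · exact ⟨(h.oriented q hq).2.1, (h.oriented q hq).1⟩
  · exact h.neE q hq

theorem inv_start (hP : P.Finite) (hne : ∀ f M M', PureEq.ac f M M' ∈ P → M ≠ 0 ∧ M' ≠ 0) :
    Inv O P (start O P) := by
  refine ⟨⟨canonSys_canonC _, ?_⟩, ?_⟩
  · refine hP.preimage (f := fun p : FlatTerm F K × K => PureEq.flat p.1.1 p.1.2 p.2) ?_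
    rintro ⟨⟨h, a⟩, d⟩ _ ⟨⟨h', a'⟩, d'⟩ _ e
    dsimp only at e
    cases e
    rfl
  · have h₀ : Pres P {p | PureEq.con p.1 p.2 ∈ P} {p | PureEq.flat p.1.1 p.1.2 p.2 ∈ P}
        (mrules P) := by
      refine ⟨fun f q hq => hne f _ _ hq, fun s t => ?_⟩
      have : sys {p | PureEq.con p.1 p.2 ∈ P} {p | PureEq.flat p.1.1 p.1.2 p.2 ∈ P} (mrules P) = P := by
        ext e
        cases e <;> rfl
      rw [this]
    refine h₀.const (fun p hp => eqvSet_mono Set.subset_union_left hp.2.1) ?_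
    refine (subset_eqvSet _).trans ?_
    rw [← eqvSet_canonC O {p | PureEq.con p.1 p.2 ∈ P}]
    exact eqvSet_mono Set.subset_union_left

theorem BaseInv.flat {RC : Set (K × K)} {Fl : Set (FlatTerm F K × K)} (h : BaseInv O RC Fl) :
    BaseInv O (canonC O (RC ∪ newConst O (renameFlat RC Fl))) (leastFlat O (renameFlat RC Fl)) :=
  ⟨canonSys_canonC _, leastFlat_finite h.fin⟩

theorem BaseInv.flat_done {RC : Set (K × K)} {Fl : Set (FlatTerm F K × K)} (h : BaseInv O RC Fl)
    {G : F.A → Set (MRule K)} (hG : Pres P RC Fl G) (he : newConst O (renameFlat RC Fl) = ∅) :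
    BaseInv O RC (leastFlat O (renameFlat RC Fl)) ∧ FlatOK RC (leastFlat O (renameFlat RC Fl)) ∧
      Pres P RC (leastFlat O (renameFlat RC Fl)) G := by
  refine ⟨⟨h.canon, leastFlat_finite h.fin⟩, flatOK_leastFlat h.canon, ?_⟩
  have := hG.flat (O := O)
  rwa [he, h.canon.canonC_union_empty] at this

theorem LoopInv.mono {RC : Set (K × K)} {todo : Set F.A} {NN NN' : Set (K × K)} {g : F.A}
    {Rg : Set (MRule K)} (h : LoopInv O RC todo NN g Rg) (hN : NN ⊆ NN') :
    LoopInv O RC todo NN' g Rg :=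
  ⟨h.msys, h.old, fun hg => ⟨(h.done hg).1.trans (eqvSet_mono (Set.union_subset_union_right _ hN)),
    (h.done hg).2⟩⟩

theorem mem_loopG {todo : Set F.A} {R : F.A → Set (MRule K)} {f : F.A} (hf : f ∈ todo) :
    loopG P todo R f = mrules P f := if_pos hf

theorem not_mem_loopG {todo : Set F.A} {R : F.A → Set (MRule K)} {f : F.A} (hf : f ∉ todo) :
    loopG P todo R f = R f := if_neg hf

theorem mrules_finite (hP : P.Finite) (f : F.A) : (mrules P f).Finite := by
  refine hP.preimage (f := fun q : MRule K => PureEq.ac f q.1 q.2) ?_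
  rintro ⟨M, N⟩ _ ⟨M', N'⟩ _ e
  dsimp only at e
  cases e
  rfl

/-- Each reducible constant is a left side of an interreduced system, so no other side can contain
it. -/
theorem clean_of_left {f : F.A} {RC : Set (K × K)} {R E : Set (MRule K)} (h : MSys O f R E)
    (hl : ∀ p ∈ RC, ∃ m, ({p.1}, m) ∈ R) : Clean RC R := by
  have key : ∀ c, ¬ IrrC RC c → ∃ m, ({c}, m) ∈ R := by
    intro c hc
    rw [IrrC] at hc
    push Not at hc
    obtain ⟨d, hd⟩ := hc
    exact hl _ hd
  refine fun q hq => ⟨fun c hc => ?_, fun c hc hn => ?_⟩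
  · by_contra hn
    obtain ⟨m, hm⟩ := key c hn
    exact h.right _ hm q hq (Multiset.singleton_le.2 hc)
  · obtain ⟨m, hm⟩ := key c hn
    rw [← h.left _ hm q hq (Multiset.singleton_le.2 hc)]

theorem not_needsUpdate {RC : Set (K × K)} {R : Set (MRule K)} (h : ¬ NeedsUpdate RC R) :
    IrrSys RC R := by
  intro q hq
  constructor
  · intro c hc
    by_contra hn
    exact h ⟨q, hq, .inl (exists_mstep_monoC.2 ⟨c, hc, hn⟩)⟩
  · intro c hc
    by_contra hn
    exact h ⟨q, hq, .inr (exists_mstep_monoC.2 ⟨c, hc, hn⟩)⟩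

theorem Step.inv (hP : P.Finite) {σ σ' : State F K} (hst : Step O P σ σ') (h : Inv O P σ) :
    Inv O P σ' := by
  cases hst with
  | cc_again hn => exact ⟨h.1.flat, h.2.flat⟩
  | cc_done he =>
    obtain ⟨h₁, h₂, h₃⟩ := h.1.flat_done h.2 he
    refine ⟨h₁, h₂, ?_, fun g hg => absurd (Set.mem_univ g) hg⟩
    have : loopG P Set.univ (fun _ => ∅) = mrules P := funext fun g => mem_loopG (Set.mem_univ g)
    rwa [this]
  | @comp_start RC Fl todo R f hf =>
    obtain ⟨hb, hfl, hp, hR⟩ := h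
    have hne : NE (mrules P f) := by rw [← mem_loopG (R := R) hf]; exact hp.1 f
    have hne' : NE ((fun q : MRule K => (q.1.map (rep RC), q.2.map (rep RC))) '' mrules P f) := by
      rintro _ ⟨q, hq, rfl⟩
      simpa only [ne_eq, Multiset.map_eq_zero] using hne q hq
    have hrep := fun M => mcon_map_rep (K := K) RC M
    refine ⟨hb, hfl, hp.modify (f := f) ?_ ?_ ?_ ?_, ?_, fun hf => hf.2 rfl,
      .empty ((mrules_finite hP f).image _) hne', ?_⟩
    · intro g hg
      rw [Function.update_of_ne hg]
      by_cases hgt : g ∈ todo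
      · rw [mem_loopG hgt, mem_loopG (todo := todo \ {f}) ⟨hgt, hg⟩]
      · rw [not_mem_loopG hgt, not_mem_loopG (todo := todo \ {f}) fun h => hgt h.1]
    · rw [Function.update_self, Set.empty_union]
      exact hne'
    · rw [Function.update_self, Set.empty_union, mem_loopG hf]
      rintro _ ⟨q, hq, rfl⟩
      exact (mcon _).trans ((mcon _).symm (mcon_mono Set.subset_union_right (hrep _)))
        ((mcon _).trans (mcon_of_mem (.inl hq)) (mcon_mono Set.subset_union_right (hrep _)))
    · rw [Function.update_self, Set.empty_union, mem_loopG hf]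
      intro q hq
      exact (mcon _).trans (mcon_mono Set.subset_union_right (hrep _))
        ((mcon _).trans (mcon_of_mem (q := (q.1.map (rep RC), q.2.map (rep RC))) (.inl ⟨q, hq, rfl⟩))
          ((mcon _).symm (mcon_mono Set.subset_union_right (hrep _))))
    · exact fun g hg hgf => hR g fun h => hg ⟨h, hgf⟩
    · rintro q (hq | ⟨q, hq, rfl⟩)
      · exact hq.elim
      · constructor <;> intro c hc <;> obtain ⟨c', _, rfl⟩ := Multiset.mem_map.1 hc <;>
          exact hb.canon.rep_irr _
  | @comp_step RC Fl todo R f σ σ' hst =>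
    obtain ⟨hb, hfl, hp, hR, hf, hm, hirr⟩ := h
    obtain ⟨hm', hirr', h₁, h₂, _⟩ := hst.msys hm hirr
    refine ⟨hb, hfl, hp.modify (f := f) ?_ ?_ ?_ ?_, hR, hf, hm', hirr'⟩
    · intro g hg
      rw [Function.update_of_ne hg, Function.update_of_ne hg]
    · rw [Function.update_self]; exact hm'.ne
    · simp only [Function.update_self]
      exact fun q hq => mcon_mono Set.subset_union_left (h₁ q hq)
    · simp only [Function.update_self]
      exact fun q hq => mcon_mono Set.subset_union_left (h₂ q hq)
  | @comp_done RC Fl todo R f Rf =>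
    obtain ⟨hb, hfl, hp, hR, hf, hm, hirr⟩ := h
    rw [Set.union_empty] at hp hirr
    refine ⟨hb, hfl, ?_, fun g hg => ?_⟩
    · have : loopG P todo (Function.update R f Rf) = Function.update (loopG P todo R) f Rf := by
        funext g
        by_cases hg : g = f
        · subst hg
          rw [not_mem_loopG hf, Function.update_self, Function.update_self]
        · rw [Function.update_of_ne hg]
          by_cases hgt : g ∈ todo
          · rw [mem_loopG hgt, mem_loopG hgt]
          · rw [not_mem_loopG hgt, not_mem_loopG hgt, Function.update_of_ne hg]
      rwa [this]
    · by_cases hgf : g = f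
      · subst hgf
        rw [Function.update_self]
        exact ⟨hm, hirr⟩
      · rw [Function.update_of_ne hgf]
        exact hR g hg hgf
  | @propagate RC Fl R hne =>
    obtain ⟨hb, hfl, hp, hR⟩ := h
    have e : loopG P ∅ R = R := funext fun g => not_mem_loopG (Set.notMem_empty g)
    rw [e] at hp
    refine ⟨⟨canonSys_canonC _, hb.fin⟩, hp.const (fun p hp => hp.2.1) ?_, fun g =>
      ⟨(hR g (Set.notMem_empty g)).1, ?_⟩⟩
    · refine Set.Subset.trans ?_ (eqvSet_mono Set.subset_union_left)
      rw [eqvSet_canonC]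
      exact Set.subset_union_left.trans (subset_eqvSet _)
    · rw [eqvSet_canonC]
      exact (Set.subset_iUnion (fun f => constOf (R f)) g).trans
        (Set.subset_union_right.trans (subset_eqvSet _))
  | @no_propagate RC Fl R he =>
    obtain ⟨hb, hfl, hp, hR⟩ := h
    have e : loopG P ∅ R = R := funext fun g => not_mem_loopG (Set.notMem_empty g)
    rw [e] at hp
    refine ⟨hb, hfl, hp, fun g => (hR g (Set.notMem_empty g)).1, fun g => ?_,
      fun g => (hR g (Set.notMem_empty g)).2.clean⟩
    rw [← he, eqvSet_canonC]
    exact (Set.subset_iUnion (fun f => constOf (R f)) g).trans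
      (Set.subset_union_right.trans (subset_eqvSet _))
  | @updU_again RC Fl R hn =>
    obtain ⟨hb, hp, hR⟩ := h
    refine ⟨hb.flat, hp.flat, fun g => ⟨(hR g).1, (hR g).2.trans ?_⟩⟩
    rw [eqvSet_canonC]
    exact eqvSet_mono Set.subset_union_left
  | @updU_done RC Fl R he =>
    obtain ⟨hb, hp, hR⟩ := h
    obtain ⟨h₁, h₂, h₃⟩ := hb.flat_done hp he
    refine ⟨h₁, h₂, by rwa [Set.union_empty], fun _ h => h.elim, fun g => ⟨(hR g).1,
      fun _ => (hR g).2, fun hg => absurd (Set.mem_univ g) hg⟩⟩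
  | @updAC_skip RC Fl todo R NN f hf hn =>
    obtain ⟨hb, hfl, hp, hN, hR⟩ := h
    refine ⟨hb, hfl, hp, hN, fun g => ⟨(hR g).msys, fun hg => (hR g).old hg.1, fun hg => ?_⟩⟩
    by_cases hgf : g = f
    · subst hgf
      exact ⟨((hR g).old hf).trans (eqvSet_mono Set.subset_union_left), (not_needsUpdate hn).clean⟩
    · exact (hR g).done fun h => hg ⟨h, hgf⟩
  | @updAC_start RC Fl todo R NN f σ hf hn hσ =>
    obtain ⟨hb, hfl, hp, hN, hR⟩ := h
    obtain ⟨h₁, h₂, h₃, h₄, h₅, h₆⟩ := hσ.msys hb.canon (hR f).msys ((hR f).old hf)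
    refine ⟨hb, hfl, ?_, ?_, fun g hg => ⟨(hR g).msys, fun h => (hR g).old h.1, fun h =>
      (hR g).done fun h' => h ⟨h', hg⟩⟩, fun h => h.2 rfl, h₁, ?_, h₃⟩
    · rw [h₆, Set.union_empty]
      refine hp.modify (f := f) (fun g hg => Function.update_of_ne hg _ _) ?_ ?_ ?_
      · rw [Function.update_self]; exact h₁.ne
      · rw [Function.update_self]
        intro q hq
        refine mcon_mono (Set.union_subset_union_right _ ?_) (h₄ q hq)
        exact Set.image_mono Set.subset_union_left
      · rw [Function.update_self]
        exact fun q hq => mcon_mono Set.subset_union_left (h₅ q hq)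
    · rw [h₆, Set.union_empty]; exact hN
    · rw [h₆, Set.union_empty]; exact h₂
  | @updAC_step RC Fl todo R NN f σ σ' hst =>
    obtain ⟨hb, hfl, hp, hN, hR, hf, hm, hc, hl⟩ := h
    have hs := hst.spec hm hc
    refine ⟨hb, hfl, ?_, ?_, hR, hf, hs.msys, hs.const, fun p hp => hs.left _ (hl p hp)⟩
    · have hp' : Pres P (RC ∪ (NN ∪ σ.NR)) Fl (Function.update R f (σ'.R ∪ (σ'.S ∪ σ'.T))) := by
        refine hp.modify (f := f) ?_ ?_ ?_ ?_
        · intro g hg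
          rw [Function.update_of_ne hg, Function.update_of_ne hg]
        · rw [Function.update_self]; exact hs.msys.ne
        · simp only [Function.update_self]
          exact fun q hq => mcon_mono Set.subset_union_left (hs.back q hq)
        · simp only [Function.update_self]
          exact fun q hq => mcon_mono Set.subset_union_left (hs.forth q hq)
      refine hp'.const ?_ ?_
      · refine Set.Subset.trans ?_ (subset_eqvSet _)
        rintro p (hp | hp | hp)
        · exact .inl (.inl hp)
        · exact .inl (.inr (.inl hp))
        · rcases hs.new p hp with hp | ⟨hp, _⟩
          · exact .inl (.inr (.inr hp))
          · refine .inr (Set.mem_iUnion.2 ⟨f, ?_⟩)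
            rw [Function.update_self]
            exact .inl hp
      · refine Set.Subset.trans ?_ (subset_eqvSet _)
        exact (Set.union_subset_union_right _ (Set.union_subset_union_right _ hs.mono)).trans
          Set.subset_union_left
    · rintro p (hp | hp)
      · exact hN p (.inl hp)
      · rcases hs.new p hp with hp | ⟨_, hne, hirr⟩
        · exact hN p (.inr hp)
        · intro hp
          -- Both constants are irreducible by `RC`, since every left side of `RC` is a left side of
          -- the current rules and the new rule was normalized by these. Being distinct, they are
          -- not equated by `RC`.
          refine hne (hb.canon.eq_of_irr hp ?_ ?_)
          · intro d hd
            obtain ⟨m, hm⟩ := hl _ hd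
            exact (hirr _ hm).1 le_rfl
          · intro d hd
            obtain ⟨m, hm⟩ := hl _ hd
            exact (hirr _ hm).2 le_rfl
  | @updAC_done RC Fl todo R NN f Rf NR =>
    obtain ⟨hb, hfl, hp, hN, hR, hf, hm, hc, hl⟩ := h
    rw [Set.union_empty] at hm
    rw [Set.union_empty, Set.union_empty] at hp
    refine ⟨hb, hfl, hp, hN, fun g => ?_⟩
    by_cases hgf : g = f
    · subst hgf
      rw [Function.update_self]
      exact ⟨hm, fun h => absurd h hf, fun _ => ⟨hc.trans (eqvSet_mono
        (Set.union_subset_union_right _ Set.subset_union_right)), clean_of_left hm hl⟩⟩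
    · rw [Function.update_of_ne hgf]
      exact (hR g hgf).mono Set.subset_union_left
  | @again RC Fl R NN hn =>
    obtain ⟨hb, hfl, hp, hN, hR⟩ := h
    refine ⟨⟨canonSys_canonC _, hb.fin⟩, hp.const ?_ ?_, fun g => ⟨(hR g).msys, ?_⟩⟩
    · exact fun p hp => eqvSet_mono Set.subset_union_left hp.2.1
    · refine Set.Subset.trans ?_ (eqvSet_mono Set.subset_union_left)
      rw [eqvSet_canonC]
      exact subset_eqvSet _
    · rw [eqvSet_canonC]
      exact ((hR g).done (Set.notMem_empty g)).1
  | @finish RC Fl R =>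
    obtain ⟨hb, hfl, hp, hN, hR⟩ := h
    rw [Set.union_empty] at hp
    refine ⟨hb, hfl, hp, fun g => (hR g).msys, fun g => ?_,
      fun g => ((hR g).done (Set.notMem_empty g)).2⟩
    have := ((hR g).done (Set.notMem_empty g)).1
    rwa [Set.union_empty] at this

/-! ### Termination -/

/-- The measure of a state. -/
noncomputable def State.measure : State F K → Set (K × K) × ℕ × ℕ × Set (MRule K) × ℕ × ℕ
  | .cc RC _ => (eqvSet RC, 5, 0, ∅, 0, 0)
  | .loopComp RC _ todo _ => (eqvSet RC, 4, 2 * todo.ncard, ∅, 0, 0)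
  | .comp RC _ todo _ _ σ => (eqvSet RC, 4, 2 * todo.ncard + 1, σ.1, 0, σ.2.ncard)
  | .updU RC _ _ => (eqvSet RC, 3, 0, ∅, 0, 0)
  | .loopUpd RC _ todo _ _ => (eqvSet RC, 2, 2 * todo.ncard, ∅, 0, 0)
  | .updAC RC _ todo _ _ _ σ => (eqvSet RC, 2, 2 * todo.ncard + 1, σ.R, σ.T.ncard, σ.S.ncard)
  | .halt RC _ _ => (eqvSet RC, 0, 0, ∅, 0, 0)

/-- The lexicographic ordering of the measures of states. -/
def MeasureLT : Set (K × K) × ℕ × ℕ × Set (MRule K) × ℕ × ℕ →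
    Set (K × K) × ℕ × ℕ × Set (MRule K) × ℕ × ℕ → Prop :=
  Prod.Lex (fun A B => B ⊂ A) (Prod.Lex (· < ·) (Prod.Lex (· < ·)
    (Prod.Lex (fun R' R => reducibles R ⊂ reducibles R') (Prod.Lex (· < ·) (· < ·)))))

theorem measureLT_wf : WellFounded (MeasureLT (K := K)) := by
  have hlt : WellFounded ((· < ·) : ℕ → ℕ → Prop) := wellFounded_lt
  have h : WellFounded fun A B : Set (K × K) => B ⊂ A :=
    (inferInstance : WellFoundedGT (Set (K × K))).wf
  exact h.prod_lex (hlt.prod_lex (hlt.prod_lex (reducibles_wf.prod_lex (hlt.prod_lex hlt))))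

theorem measureLT_of_ssubset {A B : Set (K × K)} {x y} (h : B ⊂ A) : MeasureLT (A, x) (B, y) :=
  .left _ _ h

theorem measureLT_of_phase {A : Set (K × K)} {m n : ℕ} {x y} (h : m < n) :
    MeasureLT (A, m, x) (A, n, y) :=
  .right _ (.left _ _ h)

theorem measureLT_of_todo {A : Set (K × K)} {i m n : ℕ} {x y} (h : m < n) :
    MeasureLT (A, i, m, x) (A, i, n, y) :=
  .right _ (.right _ (.left _ _ h))

theorem measureLT_of_step {A : Set (K × K)} {i j : ℕ} {R R' : Set (MRule K)} {m n m' n' : ℕ}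
    (h : reducibles R ⊂ reducibles R' ∨ R' = R ∧ (m' < m ∨ m' = m ∧ n' < n)) :
    MeasureLT (A, i, j, R', m', n') (A, i, j, R, m, n) := by
  refine .right _ (.right _ (.right _ ?_))
  rcases h with h | ⟨rfl, h | ⟨rfl, h⟩⟩
  · exact .left _ _ h
  · exact .right _ (.left _ _ h)
  · exact .right _ (.right _ h)

theorem ncard_sdiff_lt [Finite F.A] {todo : Set F.A} {f : F.A} (hf : f ∈ todo) :
    (todo \ {f}).ncard < todo.ncard :=
  Set.ncard_sdiff_singleton_lt_of_mem hf (Set.toFinite _)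

/-- Phases are numbered downwards along the run; repeating or re-entering a closure phase requires
strict growth of the equivalence on constants. Doubling the number of remaining symbols leaves an
odd value for the symbol being treated. Within its treatment the reducible monomials grow or the
pending equations become fewer. -/
theorem Step.measure_lt [Finite F.A] {σ σ' : State F K} (hst : Step O P σ σ') (h : Inv O P σ) :
    MeasureLT σ'.measure σ.measure := by
  cases hst with
  | cc_again hn =>
    obtain ⟨p, hp⟩ := hn
    exact measureLT_of_ssubset (eqvSet_ssubset hp (newConst_not_mem h.1.canon p hp))
  | cc_done he => exact measureLT_of_phase (by norm_num)
  | comp_start hf =>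
    have := ncard_sdiff_lt hf
    exact measureLT_of_todo (by omega)
  | comp_step hst =>
    obtain ⟨hb, hfl, hp, hR, hf, hm, hirr⟩ := h
    obtain ⟨_, _, _, _, h⟩ := hst.msys hm hirr
    exact measureLT_of_step (h.imp_right fun h => ⟨h.1, .inr ⟨rfl, h.2⟩⟩)
  | comp_done => exact measureLT_of_todo (by omega)
  | propagate hne => exact measureLT_of_ssubset (h.1.canon.eqvSet_ssubset_of_ne hne)
  | no_propagate he => exact measureLT_of_phase (by norm_num)
  | updU_again hn =>
    obtain ⟨p, hp⟩ := hn
    exact measureLT_of_ssubset (eqvSet_ssubset hp (newConst_not_mem h.1.canon p hp))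
  | updU_done he => exact measureLT_of_phase (by norm_num)
  | updAC_skip hf hn =>
    have := ncard_sdiff_lt hf
    exact measureLT_of_todo (by omega)
  | updAC_start hf hn hσ =>
    have := ncard_sdiff_lt hf
    exact measureLT_of_todo (by omega)
  | updAC_step hst =>
    obtain ⟨hb, hfl, hp, hN, hR, hf, hm, hc, hl⟩ := h
    exact measureLT_of_step ((hst.spec hm hc).measure.imp_right fun h => ⟨h.1, h.2.imp_right fun h =>
      ⟨congrArg Set.ncard h.1, h.2⟩⟩)
  | updAC_done => exact measureLT_of_todo (by omega)
  | again hn =>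
    obtain ⟨hb, hfl, hp, hN, hR⟩ := h
    obtain ⟨p, hp⟩ := hn
    exact measureLT_of_ssubset (eqvSet_ssubset hp (hN p hp))
  | finish => exact measureLT_of_phase (by norm_num)

theorem Inv.acc [Finite F.A] (hP : P.Finite) {σ : State F K} (h : Inv O P σ) :
    Acc (fun σ' σ => Step O P σ σ') σ := by
  induction σ using (InvImage.wf (State.measure (F := F) (K := K)) measureLT_wf).induction with
  | _ σ ih => exact ⟨_, fun σ' hst => ih σ' (hst.measure_lt h) (hst.inv hP h)⟩

theorem Inv.progress {σ : State F K} (h : Inv O P σ) (hst : ∀ σ', ¬ Step O P σ σ') :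
    ∃ RC Fl R, σ = State.halt RC Fl R := by
  cases σ with
  | cc RC Fl =>
    rcases (newConst O (renameFlat RC Fl)).eq_empty_or_nonempty with he | he
    · exact (hst _ (.cc_done he)).elim
    · exact (hst _ (.cc_again he)).elim
  | loopComp RC Fl todo R =>
    rcases todo.eq_empty_or_nonempty with rfl | ⟨f, hf⟩
    · by_cases hc : canonC O (RC ∪ ⋃ f, constOf (R f)) = RC
      · exact (hst _ (.no_propagate hc)).elim
      · exact (hst _ (.propagate hc)).elim
    · exact (hst _ (.comp_start hf)).elim
  | comp RC Fl todo R f σ =>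
    obtain ⟨Rf, T⟩ := σ
    rcases T.eq_empty_or_nonempty with rfl | hT
    · exact (hst _ .comp_done).elim
    · obtain ⟨σ', hσ⟩ := exists_compStep h.2.2.2.2.2.1 hT
      exact (hst _ (.comp_step hσ)).elim
  | updU RC Fl R =>
    rcases (newConst O (renameFlat RC Fl)).eq_empty_or_nonempty with he | he
    · exact (hst _ (.updU_done he)).elim
    · exact (hst _ (.updU_again he)).elim
  | loopUpd RC Fl todo R NN =>
    rcases todo.eq_empty_or_nonempty with rfl | ⟨f, hf⟩
    · rcases NN.eq_empty_or_nonempty with rfl | hN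
      · exact (hst _ .finish).elim
      · exact (hst _ (.again hN)).elim
    · by_cases hn : NeedsUpdate RC (R f)
      · obtain ⟨σ, hσ⟩ := exists_uinit h.1.canon (h.2.2.2.2 f).msys.oriented
        exact (hst _ (.updAC_start hf hn hσ)).elim
      · exact (hst _ (.updAC_skip hf hn)).elim
  | updAC RC Fl todo R NN f σ =>
    by_cases hσ : σ.S = ∅ ∧ σ.T = ∅
    · obtain ⟨Rf, S, T, NR⟩ := σ
      obtain ⟨rfl, rfl⟩ := hσ
      exact (hst _ .updAC_done).elim
    · obtain ⟨σ', hσ'⟩ := exists_uStep h.2.2.2.2.2.2.1 hσ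
      exact (hst _ (.updAC_step hσ')).elim
  | halt RC Fl R => exact ⟨RC, Fl, R, rfl⟩

theorem Inv.of_reflTransGen (hP : P.Finite) {σ σ' : State F K}
    (hst : ReflTransGen (Step O P) σ σ') (h : Inv O P σ) : Inv O P σ' := by
  induction hst with
  | refl => exact h
  | tail _ hst ih => exact hst.inv hP ih

end Algorithm

/-! ### The returned system is good and presents the closure of the input. -/

section Output

variable {F : Sig.{u, v}} {K : Type w} [DecidableEq K] {O : Orderings F K} {P : Set (PureEq F K)}
  {RC : Set (K × K)} {Fl : Set (FlatTerm F K × K)} {R : F.A → Set (MRule K)}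

/-- The rules that are not rules between constants. -/
def nonconst (R : Set (MRule K)) : Set (MRule K) :=
  {q ∈ R | ¬ (Multiset.card q.1 = 1 ∧ Multiset.card q.2 = 1)}

theorem mem_nonconst_or {R : Set (MRule K)} {q : MRule K} (hq : q ∈ R) :
    q ∈ nonconst R ∨ ∃ p ∈ constOf R, q = ({p.1}, {p.2}) := by
  by_cases h : Multiset.card q.1 = 1 ∧ Multiset.card q.2 = 1
  · obtain ⟨c, hc⟩ := Multiset.card_eq_one.1 h.1
    obtain ⟨d, hd⟩ := Multiset.card_eq_one.1 h.2
    obtain ⟨q₁, q₂⟩ := q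
    obtain rfl : q₁ = {c} := hc
    obtain rfl : q₂ = {d} := hd
    exact .inr ⟨(c, d), hq, rfl⟩
  · exact .inl ⟨hq, h⟩

variable [Finite K]

/-- On return, constant rules inside an AC system are consequences of `RC` with irreducible right
side, hence rules of `RC`. -/
theorem HaltInv.constOf_subset (h : HaltInv O P RC Fl R) (f : F.A) : constOf (R f) ⊆ RC := by
  rintro ⟨c, d⟩ hcd
  refine h.base.canon.mem_of_eqvSet (h.const f hcd) ((h.clean f _ hcd).1 d (by simp)) ?_
  rintro rfl
  exact ((h.msys f).oriented _ hcd).irrefl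

theorem HaltInv.two_le (h : HaltInv O P RC Fl R) {f : F.A} {q : MRule K}
    (hq : q ∈ nonconst (R f)) : 2 ≤ Multiset.card q.1 := by
  by_contra hlt
  have hor := (h.msys f).oriented q hq.1
  have h₁ : Multiset.card q.1 = 1 := by
    have := Multiset.card_pos.2 hor.2.1
    omega
  obtain ⟨c, hc⟩ := Multiset.card_eq_one.1 h₁
  rw [hc] at hor
  exact hq.2 ⟨h₁, Multiset.card_eq_one.2 hor.eq_singleton⟩

theorem HaltInv.irr (h : HaltInv O P RC Fl R) {f : F.A} {q : MRule K}
    (hq : q ∈ nonconst (R f)) : IrrM RC q.1 ∧ IrrM RC q.2 := by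
  refine ⟨fun c hc => ?_, (h.clean f q hq.1).1⟩
  by_contra hn
  have h₂ := h.two_le hq
  rw [(h.clean f q hq.1).2 c hc hn, Multiset.card_singleton] at h₂
  omega

theorem HaltInv.output_eq (h : HaltInv O P RC Fl R) :
    output RC Fl R = sys RC Fl fun f => nonconst (R f) := by
  ext e
  cases e with
  | con c d => exact ⟨fun he => he.elim id fun ⟨f, hf⟩ => h.constOf_subset f hf, .inl⟩
  | flat l a d => exact Iff.rfl
  | ac f M N => exact Iff.rfl

/-- Constant rules never fire on monomials of irreducible constants, and rewriting introduces only
such constants. Joins of critical pairs therefore survive the removal of constant rules from the AC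
part. -/
theorem HaltInv.msteps_nonconst (h : HaltInv O P RC Fl R) {f : F.A} {M N : Multiset K}
    (hM : IrrM RC M) (hMN : ReflTransGen (MStep (R f)) M N) :
    ReflTransGen (MStep (nonconst (R f))) M N := by
  suffices ReflTransGen (MStep (nonconst (R f))) M N ∧ IrrM RC N from this.1
  induction hMN with
  | refl => exact ⟨.refl, hM⟩
  | tail _ hst ih =>
    obtain ⟨q, hq, hle, rfl⟩ := hst
    have hq' : q ∈ nonconst (R f) := by
      rcases mem_nonconst_or hq with hq' | ⟨p, hp, rfl⟩
      · exact hq'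
      · exact absurd (h.constOf_subset f hp) (ih.2 _ (Multiset.singleton_le.1 hle) _)
    exact ⟨ih.1.tail ⟨q, hq', hle, rfl⟩, (ih.2.of_le tsub_le_self).add (h.irr hq').2⟩

theorem HaltInv.good (h : HaltInv O P RC Fl R) : Good O (output RC Fl R) := by
  rw [h.output_eq]
  refine ⟨⟨fun c d hcd => h.base.canon.gtC hcd, fun f M N hq => ?_⟩, ?_, ?_, ?_, ?_, ?_, ?_, ?_, ?_, ?_⟩
  · have := (h.msys f).oriented _ hq.1
    exact ⟨h.two_le hq, this.1, this.2.2⟩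
  · exact fun h₁ h₂ => h.base.canon.det h₁ h₂
  · exact fun h₁ => h.base.canon.irr h₁ _
  · exact fun h₁ i e => (h.flat.1 _ h₁).1 i e
  · exact fun h₁ e => (h.flat.1 _ h₁).2 e
  · exact fun h₁ h₂ => h.flat.2 _ _ _ h₁ h₂
  · exact fun h₁ c hc e => hc.elim (fun hc => (h.irr h₁).1 c hc e) fun hc => (h.irr h₁).2 c hc e
  · intro f p hp q hq
    have hm := h.msys f
    have hcr : CritConn O f (R f) (R f) := by
      have := hm.crit
      rwa [Set.union_empty] at this
    have hp' : p ∈ nonconst (R f) := hp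
    have hq' : q ∈ nonconst (R f) := hq
    -- The two components are the one-step reducts of the overlap, so confluence of the full system
    -- joins them.
    obtain ⟨v, h₁, h₂⟩ := hcr.join hm.oriented (t := p.1 ∪ q.1) (u₁ := (critPair p q).1)
      (u₂ := (critPair p q).2)
      (.single ⟨p, hp'.1, Multiset.le_union_left, by rw [critPair_eq]⟩)
      (.single ⟨q, hq'.1, Multiset.le_union_right, by rw [critPair_eq]⟩)
    have hirr := IrrM.critPair (h.irr hp') (h.irr hq')
    exact ⟨v, h.msteps_nonconst hirr.1 h₁, h.msteps_nonconst hirr.2 h₂⟩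
  · exact fun f p hp q hq => (h.msys f).left p hp.1 q hq.1
  · exact fun f p hp q hq => (h.msys f).right p hp.1 q hq.1

theorem HaltInv.closure_iff (h : HaltInv O P RC Fl R) (s t : Term F K) :
    Closure (termEqs (output RC Fl R)) s t ↔ Closure (termEqs P) s t := by
  rw [h.output_eq]
  refine (h.pres.step (G' := fun f => nonconst (R f)) (fun f q hq => h.pres.1 f q hq.1)
    (fun p hp => subset_eqvSet _ (.inl hp)) (fun p hp => subset_eqvSet _ (.inl hp))
    (fun f q hq => mcon_of_mem (.inl hq.1)) fun f q hq => ?_).2 s t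
  rcases mem_nonconst_or hq with hq' | ⟨p, hp, rfl⟩
  · exact mcon_of_mem (.inl hq')
  · exact mcon_of_mem (q := ({p.1}, {p.2}))
      (.inr (mem_monoC.2 ⟨_, _, h.constOf_subset f hp, rfl⟩))

theorem HaltInv.output_finite [Finite F.A] (h : HaltInv O P RC Fl R) :
    (output RC Fl R).Finite := by
  rw [h.output_eq]
  have hsub : sys RC Fl (fun f => nonconst (R f)) ⊆
      ((fun p : K × K => PureEq.con p.1 p.2) '' RC ∪
        (fun p : FlatTerm F K × K => PureEq.flat p.1.1 p.1.2 p.2) '' Fl) ∪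
        ⋃ f, (fun q : MRule K => PureEq.ac f q.1 q.2) '' R f := by
    rintro (⟨c, d⟩ | ⟨l, a, d⟩ | ⟨f, M, N⟩) he
    · exact .inl (.inl ⟨(c, d), he, rfl⟩)
    · exact .inl (.inr ⟨(⟨l, a⟩, d), he, rfl⟩)
    · exact .inr (Set.mem_iUnion.2 ⟨f, (M, N), he.1, rfl⟩)
  exact ((((Set.toFinite RC).image _).union (h.base.fin.image _)).union
    (Set.finite_iUnion fun f => (h.msys f).finR.image _)).subset hsub

end Output

theorem eq_union_parts {F : Sig.{u, v}} {K : Type w} (R : Set (PureEq F K)) :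
    R = partC R ∪ partU R ∪ ⋃ f, partAC R f := by
  ext e
  constructor
  · intro he
    cases e with
    | con c d => exact .inl (.inl ⟨he, _, _, rfl⟩)
    | flat h a d => exact .inl (.inr ⟨he, _, _, _, rfl⟩)
    | ac f M N => exact .inr (Set.mem_iUnion.2 ⟨f, he, _, _, rfl⟩)
  · rintro ((he | he) | he)
    · exact he.1
    · exact he.1
    · obtain ⟨f, hf⟩ := Set.mem_iUnion.1 he
      exact hf.1

/-- At least one run returns. This provides the witness for the common result; agreement of all runs
alone could be vacuous. -/
theorem exists_reachable_halt {F : Sig.{u, v}} {K : Type w} [DecidableEq K] [DecidableEq F.A]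
    {O : Orderings F K} {P : Set (PureEq F K)} {σ : State F K}
    (hacc : Acc (fun σ' σ => Step O P σ σ') σ)
    (hprog : ∀ σ', ReflTransGen (Step O P) σ σ' → (∀ σ'', ¬ Step O P σ' σ'') →
      ∃ RC Fl R, σ' = State.halt RC Fl R) :
    ∃ RC Fl R, ReflTransGen (Step O P) σ (State.halt RC Fl R) := by
  induction hacc with
  | intro σ _ ih =>
    by_cases h : ∃ σ', Step O P σ σ'
    · obtain ⟨σ', hσ⟩ := h
      obtain ⟨RC, Fl, R, hr⟩ := ih σ' hσ fun τ hτ => hprog τ (.head hσ hτ)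
      exact ⟨RC, Fl, R, .head hσ hr⟩
    · obtain ⟨RC, Fl, R, rfl⟩ := hprog σ .refl fun σ' hσ => h ⟨σ', hσ⟩
      exact ⟨RC, Fl, R, .refl⟩

end ACC

theorem theorem8p1 {C : Type*} [Finite C] [DecidableEq C] (F : Sig) [Finite F.A]
    [DecidableEq F.A] (S : Set (Term F C × Term F C)) (hS : S.Finite) :
    -- every finite set of ground equations can be purified
    (∃ (n : ℕ) (δ : Fin n → Term F C) (P : Set (PureEq F (C ⊕ Fin n))), IsPurification S δ P) ∧
    -- the algorithm, for every purification and every family of orderings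
    ∀ (N : Type*) [Finite N] [DecidableEq N] (δ : N → Term F C) (P : Set (PureEq F (C ⊕ N))),
      IsPurification S δ P → ∀ O : Orderings F (C ⊕ N),
        -- there is no infinite run, and a run can only end by returning
        Acc (fun σ' σ => Step O P σ σ') (start O P) ∧
        (∀ σ, Relation.ReflTransGen (Step O P) (start O P) σ → (∀ σ', ¬ Step O P σ σ') →
          ∃ RC Fl Rf, σ = State.halt RC Fl Rf) ∧
        ∃ R : Set (PureEq F (C ⊕ N)),
          -- every run returns the same system `R`
          (∀ RC Fl Rf, Relation.ReflTransGen (Step O P) (start O P) (State.halt RC Fl Rf) →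
            output RC Fl Rf = R) ∧
          -- `R` and each of its components are reduced and canonical
          R.Finite ∧ R = partC R ∪ partU R ∪ ⋃ f, partAC R f ∧
          ReducedCanonical O R ∧ ReducedCanonical O (partC R) ∧ ReducedCanonical O (partU R) ∧
          (∀ f, ReducedCanonical O (partAC R f) ∧ Canonical (MStep (mrules R f))) ∧
          -- `R` presents the closure of the input, and on the original signature that of `S`
          (∀ s t : Term F (C ⊕ N), Closure (termEqs R) s t ↔ Closure (termEqs P) s t) ∧
          (∀ s t : Term F C,
            Closure (termEqs R) (s.subst fun c => .con (Sum.inl c)) (t.subst fun c => .con (Sum.inl c)) ↔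
              Closure S s t) ∧
          -- `R` is the only reduced canonical system for this closure and these orderings
          ∀ R' : Set (PureEq F (C ⊕ N)), ReducedCanonical O R' →
            (∀ s t : Term F (C ⊕ N), Closure (termEqs R') s t ↔ Closure (termEqs P) s t) → R' = R := by
  refine ⟨exists_isPurification hS, fun N _ _ δ P hP O => ?_⟩
  have hstart : Inv O P (start O P) := inv_start hP.finite hP.nonempty
  have hacc := hstart.acc hP.finite
  have hprog : ∀ σ, Relation.ReflTransGen (Step O P) (start O P) σ → (∀ σ', ¬ Step O P σ σ') →
      ∃ RC Fl Rf, σ = State.halt RC Fl Rf :=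
    fun σ hσ hst => (hstart.of_reflTransGen hP.finite hσ).progress hst
  have hhalt : ∀ RC Fl Rf, Relation.ReflTransGen (Step O P) (start O P) (State.halt RC Fl Rf) →
      HaltInv O P RC Fl Rf :=
    fun _ _ _ hσ => hstart.of_reflTransGen hP.finite hσ
  refine ⟨hacc, hprog, ?_⟩
  obtain ⟨RC, Fl, Rf, hr⟩ := exists_reachable_halt hacc hprog
  have h := hhalt _ _ _ hr
  have hg := h.good
  -- Used twice: for the uniqueness claim, and for the output of any other run, which is again
  -- reduced and canonical with the closure of `P`.
  have huniq : ∀ R', ReducedCanonical O R' →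
      (∀ s t, Closure (termEqs R') s t ↔ Closure (termEqs P) s t) → R' = output RC Fl Rf :=
    fun R' hR' hcl => hR'.unique hg.reducedCanonical
      fun s t => (hcl s t).trans (h.closure_iff s t).symm
  exact ⟨output RC Fl Rf,
    fun RC' Fl' Rf' hr' => huniq _ (hhalt _ _ _ hr').good.reducedCanonical
      (hhalt _ _ _ hr').closure_iff,
    h.output_finite, eq_union_parts _, hg.reducedCanonical, hg.partC.reducedCanonical,
    hg.partU.reducedCanonical, fun f => ⟨(hg.partAC f).reducedCanonical, hg.canonical_mrules f⟩,
    h.closure_iff, fun s t => (h.closure_iff _ _).trans (hP.closure_iff s t), huniq⟩
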